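/- Let $\Bbbk=\bigoplus_{i\in\mathbb Z}\Bbbk^i$ be a graded strongly commutative ring, that is, a $\mathbb Z$-graded ring with $ba=(-1)^{|a||b|}ab$ for homogeneous $a,b$ and $c^2=0$ for $c$ of odd degree. Modules are $\mathbb Z$-graded $\Bbbk$-modules, $\otimes=\otimes_\Bbbk$, maps are written on the right of their arguments and composed from left to right, and $(x\otimes y).(f\otimes g)=(-1)^{|y||f|}x.f\otimes y.g$. Write $M[a]^i=M^{a+i}$, and let $\sigma^a:M\to M[a]$ be the identity map, of degree $-a$; $\sigma=\sigma^1$. Write $XT^\ge=\bigoplus_{n\ge0}X^{\otimes n}$, with $\mathrm{inj}_0:\Bbbk\to XT^\ge$ and $\mathrm{pr}_0:XT^\ge\to\Bbbk$ the inclusion of and the projection to the summand $n=0$. **Algebras.** A *unit-complemented curved algebra* $(A,m_2,m_1,m_0,\eta,\mathsf v)$ is a unital associative graded algebra $(A,m_2,\eta)$ with a derivation $m_1:A\to A$ of degree $1$ (so $m_2m_1=(1\otimes m_1+m_1\otimes1)m_2$), a map $m_0:\Bbbk\to A$ of degree $2$ with $m_1^2=(m_0\otimes1-1\otimes m_0)m_2$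 and $m_0m_1=0$, and a map $\mathsf v:A\to\Bbbk$ of degree $0$ with $\eta\mathsf v=1_\Bbbk$. Morphisms in $\mathrm{uccAlg}$ are the homomorphisms of unital graded algebras that commute with $m_1$ and preserve $m_0$ (no compatibility with $\mathsf v$). The full subcategory of *unit-complemented dg-algebras*, those with $m_0=0$, is $\mathrm{ucdgAlg}$. **Coalgebras.** A *curved augmented coalgebra* $(C,\delta_2,\delta_1,\delta_0,\varepsilon,\mathsf w)$ is a counital coassociative graded coalgebra $(C,\delta_2,\varepsilon)$ with maps $\delta_1:C\to C$ of degree $1$, $\delta_0:C\to\Bbbk$ of degree $2$ and $\mathsf w:\Bbbk\to C$ of degree $0$ such that $\delta_1\delta_2=\delta_2(1\otimes\delta_1+\delta_1\otimes1)$, $\delta_1^2=\delta_2(1\otimes\delta_0-\delta_0\otimes1)$, $\delta_1\delta_0=0$, $\delta_1\varepsilon=0$, $\mathsf w\varepsilon=1_\Bbbk$, $\mathsf w\delta_2=\mathsf w\otimes\mathsf w$, and which is conilpotent: every element of $\bar C=\operatorname{Ker}\varepsilon$ is annihilated by the iterated reduced comultiplication $\bar C\to\bar C^{\otimes n}$ for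 some $n>1$ (the reduced comultiplication being $\bar C\to C\to C\otimes C\to\bar C\otimes\bar C$, with the projection $1-\varepsilon\mathsf w:C\to\bar C$). A morphism $C\to D$ in $\mathrm{caCoalg}$ is a pair $(g_1,g_0)$ of a homomorphism $g_1:C\to D$ of counital graded coalgebras with $\mathsf wg_1=\mathsf w$ and a map $g_0:C\to\Bbbk$ of degree $1$ with $\mathsf wg_0=0$ (equivalently, a map $\bar C\to\Bbbk$) such that $$\delta_1g_1+\delta_2(g_0\otimes g_1-g_1\otimes g_0)=g_1\delta_1,\qquad \delta_0-\delta_1g_0-\delta_2(g_0\otimes g_0)=g_1\delta_0 .$$ The composite of $(f_1,f_0)$ and $(g_1,g_0)$ is $(f_1g_1,\,f_0+f_1g_0)$. The full subcategory of *augmented curved coalgebras*, those with $\mathsf w\delta_1=0$ and $\mathsf w\delta_0=0$, is $\mathrm{acCoalg}$. **Bar.** For $A\in\mathrm{uccAlg}$ put $\bar A=\operatorname{Ker}\mathsf v$, with projection $1-\mathsf v\eta:A\to\bar A$, and $b_0=m_0\sigma$, $b_1=-\sigma^{-1}m_1\sigma$, $b_2=-(\sigma^{-1}\otimes\sigma^{-1})m_2\sigma$.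 Let $\check b_n:\bar A[1]^{\otimes n}\to A[1]$ be the restriction of $b_n$ ($\check b_n=0$ for $n>2$), $\bar b_n$ its composite with the projection to $\bar A[1]$, and $\mathbf v=\sigma^{-1}\mathsf v:A[1]\to\Bbbk$. Then $\mathrm{Bar}\,A=\bar A[1]T^\ge$ with $\delta_2$ the cut comultiplication, $\delta_1=\sum1^{\otimes r}\otimes\bar b_n\otimes1^{\otimes t}$, $\delta_0$ equal to $-\check b_n\mathbf v$ on $\bar A[1]^{\otimes n}$, $\varepsilon=\mathrm{pr}_0$, $\mathsf w=\mathrm{inj}_0$. For $f:A\to B$ in $\mathrm{uccAlg}$, $\mathrm{Bar}\,f=(\bar f_1T^\ge,g_0)$, where $\bar f_1:\bar A[1]\to A[1]\xrightarrow{f[1]}B[1]\to\bar B[1]$, and $g_0$ is $\bar A[1]\to A[1]\xrightarrow{f[1]}B[1]\xrightarrow{\mathbf v}\Bbbk$ on $\bar A[1]$ and zero on $\bar A[1]^{\otimes n}$, $n\ne1$. **Cobar.** For $C\in\mathrm{caCoalg}$ let $\sigma:C[-1]\to C$ be the identity map, of degree $-1$, and $\xi_0=\sigma\delta_0$, $\xi_1=-\sigma\delta_1\sigma^{-1}$,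 $\xi_2=-\sigma\delta_2(\sigma^{-1}\otimes\sigma^{-1})$; let $\bar\xi_n:\bar C[-1]\to\bar C[-1]^{\otimes n}$ be obtained from $\xi_n$ by restriction and projection, and $\mathbf w=\mathsf w\sigma^{-1}$. Then $\mathrm{Cobar}\,C=\bar C[-1]T^\ge$ is the tensor algebra with unit $\eta=\mathrm{inj}_0$, with $m_1$ the derivation equal to $\bar\xi_0+\bar\xi_1+\bar\xi_2$ on $\bar C[-1]$, with $m_0=-\mathbf w\otimes\mathbf w-\mathbf w\xi_0-\mathbf w\xi_1-\mathbf w\xi_2=-\mathbf w\xi_0-\mathbf w\xi_1\in\Bbbk\oplus\bar C[-1]$, and $\mathsf v=\mathrm{pr}_0$. For $g=(g_1,g_0):C\to D$ in $\mathrm{caCoalg}$, $\mathrm{Cobar}\,g$ is the algebra homomorphism that is on $\bar C[-1]$ the sum of the map $\bar C[-1]\to\bar D[-1]$ given by $g_1$ and of the functional $\bar C[-1]\to C[-1]\xrightarrow{\sigma}C\xrightarrow{g_0}\Bbbk$. **Proposition.** These formulas define functors $\mathrm{Bar}:\mathrm{uccAlg}\to\mathrm{caCoalg}$ and $\mathrm{Cobar}:\mathrm{caCoalg}\to\mathrm{uccAlg}$.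 If $m_0=0$ in $A$, then $\mathrm{Bar}\,A\in\mathrm{acCoalg}$; if $C\in\mathrm{acCoalg}$, then $\mathrm{Cobar}\,C$ has $m_0=0$. So the functors restrict to $\mathrm{Bar}:\mathrm{ucdgAlg}\to\mathrm{acCoalg}$ and $\mathrm{Cobar}:\mathrm{acCoalg}\to\mathrm{ucdgAlg}$, and the restricted $\mathrm{Cobar}$ is left adjoint to the restricted $\mathrm{Bar}$. -/

import Mathlib

open scoped DirectSum TensorProduct

noncomputable section

set_option linter.unusedSectionVars false

namespace Curved

universe u

/-- A `ℤ`-graded ring in which `b a = (-1)^{|a||b|} a b` for homogeneous `a`, `b` and `c ^ 2 = 0` for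
`c` of odd degree. -/
class GradedStronglyCommutative {k : Type u} [Ring k] (𝒦 : ℤ → AddSubgroup k) [GradedRing 𝒦] :
    Prop where
  mul_comm' : ∀ {i j : ℤ} {a b : k}, a ∈ 𝒦 i → b ∈ 𝒦 j →
    b * a = ((i * j).negOnePow : ℤ) • (a * b)
  sq_zero' : ∀ {i : ℤ} {c : k}, Odd i → c ∈ 𝒦 i → c * c = 0

/-- The sign `(-1)^n`, as an integer. -/
def sg (n : ℤ) : ℤ := (n.negOnePow : ℤ)

theorem sg_add (m n : ℤ) : sg (m + n) = sg m * sg n := by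
  simp [sg, Int.negOnePow_add]

theorem sg_zero : sg 0 = 1 := by simp [sg]

theorem sg_one : sg 1 = -1 := by simp [sg]

theorem sg_mul_self (n : ℤ) : sg n * sg n = 1 := by
  rw [← sg_add]; simp [sg, Int.negOnePow_even _ (⟨n, rfl⟩ : Even (n + n))]

theorem sg_eq {m n : ℤ} (h : Even (m - n)) : sg m = sg n := by
  simp [sg, (Int.negOnePow_eq_iff m n).2 h]

/-- A `ℤ`-graded (left) module over the graded ring `(k, 𝒦)`. -/
structure GrMod {k : Type u} [Ring k] (𝒦 : ℤ → AddSubgroup k) where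
  /-- the total module -/
  carrier : Type u
  [addCommGroup : AddCommGroup carrier]
  [module : Module k carrier]
  /-- the homogeneous components -/
  gr : ℤ → AddSubgroup carrier
  internal : DirectSum.IsInternal gr
  smul_mem' : ∀ {i j : ℤ} {a : k} {x : carrier}, a ∈ 𝒦 i → x ∈ gr j → a • x ∈ gr (i + j)

variable {k : Type u} [Ring k] {𝒦 : ℤ → AddSubgroup k}

namespace GrMod

instance : CoeSort (GrMod 𝒦) (Type u) := ⟨carrier⟩
instance (M : GrMod 𝒦) : AddCommGroup M := M.addCommGroup
instance (M : GrMod 𝒦) : Module k M := M.module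

theorem smul_mem (M : GrMod 𝒦) {i j : ℤ} {a : k} {x : M} (ha : a ∈ 𝒦 i) (hx : x ∈ M.gr j) :
    a • x ∈ M.gr (i + j) := M.smul_mem' ha hx

/-- The decomposition of a graded module into its components. -/
def decomp (M : GrMod 𝒦) : M ≃+ ⨁ i, M.gr i :=
  (AddEquiv.ofBijective (DirectSum.coeAddMonoidHom M.gr) M.internal).symm

/-- The additive map that is given by `F i` on the component of degree `i`. -/
def byDegree (M : GrMod 𝒦) {P : Type*} [AddCommGroup P] (F : ℤ → M →+ P) : M →+ P :=
  (DirectSum.toAddMonoid (fun i => (F i).comp (M.gr i).subtype)).comp M.decomp.toAddMonoidHom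

theorem decomp_of_mem (M : GrMod 𝒦) {i : ℤ} {x : M} (hx : x ∈ M.gr i) :
    M.decomp x = DirectSum.of (fun i => M.gr i) i ⟨x, hx⟩ := by
  rw [decomp, AddEquiv.symm_apply_eq]
  exact (DirectSum.coeAddMonoidHom_of M.gr i ⟨x, hx⟩).symm

theorem byDegree_apply (M : GrMod 𝒦) {P : Type*} [AddCommGroup P] (F : ℤ → M →+ P)
    {i : ℤ} {x : M} (hx : x ∈ M.gr i) : M.byDegree F x = F i x := by
  simp [byDegree, decomp_of_mem M hx]

theorem induction (M : GrMod 𝒦) {p : M → Prop} (x : M) (h : ∀ i, ∀ x ∈ M.gr i, p x)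
    (hadd : ∀ x y, p x → p y → p (x + y)) : p x := by
  obtain ⟨y, rfl⟩ := M.internal.2 x
  induction y using DirectSum.induction_on with
  | zero => simpa using h 0 0 (zero_mem _)
  | of i x => simpa using h i x x.2
  | add x y hx hy => simpa using hadd _ _ hx hy

/-- The decomposition as a finitely supported function. -/
def comps (M : GrMod 𝒦) : M →+ (ℤ →₀ M) := M.byDegree fun i => Finsupp.singleAddHom i

theorem comps_apply (M : GrMod 𝒦) {i : ℤ} {x : M} (hx : x ∈ M.gr i) :
    M.comps x = Finsupp.single i x := by
  simp [comps, M.byDegree_apply _ hx]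

theorem comps_mem (M : GrMod 𝒦) (x : M) (i : ℤ) : M.comps x i ∈ M.gr i := by
  classical
  induction x using M.induction with
  | h j x hx =>
    rw [M.comps_apply hx, Finsupp.single_apply]
    split_ifs with h
    · exact h ▸ hx
    · exact zero_mem _
  | hadd x y hx hy => simpa using add_mem hx hy

theorem comps_sum (M : GrMod 𝒦) (x : M) :
    Finsupp.liftAddHom (fun _ => AddMonoidHom.id M) (M.comps x) = x := by
  induction x using M.induction with
  | h j x hx => simp [M.comps_apply hx]
  | hadd x y hx hy => rw [map_add, map_add, hx, hy]

end GrMod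

/-- A criterion for a family of subgroups to be a grading. -/
theorem isInternal_of {M : Type u} [AddCommGroup M] {gr : ℤ → AddSubgroup M} (D : M →+ (ℤ →₀ M))
    (h1 : ∀ x, Finsupp.liftAddHom (fun _ => AddMonoidHom.id M) (D x) = x)
    (h2 : ∀ x i, D x i ∈ gr i)
    (h3 : ∀ i, ∀ x ∈ gr i, D x = Finsupp.single i x) : DirectSum.IsInternal gr := by
  classical
  constructor
  · rw [injective_iff_map_eq_zero]
    intro y hy
    have key : ∀ y : ⨁ i, gr i, ∀ i, D (DirectSum.coeAddMonoidHom gr y) i = (y i : M) := by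
      intro y i
      induction y using DirectSum.induction_on with
      | zero => simp
      | of j x =>
        rw [DirectSum.coeAddMonoidHom_of, h3 j x x.2, Finsupp.single_apply]
        split_ifs with h
        · subst h; simp
        · rw [DirectSum.of_eq_of_ne _ _ _ (Ne.symm h)]; simp
      | add x y hx hy => simp [hx, hy]
    ext i
    rw [← key, hy]; simp
  · intro x
    refine ⟨∑ i ∈ (D x).support, DirectSum.of (fun i => gr i) i ⟨D x i, h2 x i⟩, ?_⟩
    rw [map_sum]
    conv_rhs => rw [← h1 x]
    simp [Finsupp.liftAddHom_apply, Finsupp.sum]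

/-- Homogeneous `k`-linear maps of degree `d`. Maps are written on the right of their arguments in
the sign conventions below, so that they commute with left multiplication by scalars. -/
structure GrHom (d : ℤ) (M N : GrMod 𝒦) where
  /-- the underlying linear map -/
  lin : M →ₗ[k] N
  mem' : ∀ {i : ℤ} {x : M}, x ∈ M.gr i → lin x ∈ N.gr (i + d)

namespace GrHom

variable {M N P Q : GrMod 𝒦} {d e n : ℤ}

instance : FunLike (GrHom d M N) M N where
  coe f := f.lin
  coe_injective := by
    rintro ⟨f, _⟩ ⟨g, _⟩ h
    congr
    exact DFunLike.coe_injective h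

instance : LinearMapClass (GrHom d M N) k M N where
  map_add f := map_add f.lin
  map_smulₛₗ f := map_smul f.lin

@[ext] theorem ext {f g : GrHom d M N} (h : ∀ x, f x = g x) : f = g := DFunLike.ext _ _ h

theorem mem (f : GrHom d M N) {i j : ℤ} {x : M} (hx : x ∈ M.gr i)
    (h : i + d = j := by first | rfl | lia) :
    f x ∈ N.gr j := h ▸ f.mem' hx

instance : Zero (GrHom d M N) := ⟨⟨0, fun _ => zero_mem _⟩⟩
instance : Add (GrHom d M N) := ⟨fun f g => ⟨f.lin + g.lin, fun h => add_mem (f.mem' h) (g.mem' h)⟩⟩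
instance : Neg (GrHom d M N) := ⟨fun f => ⟨-f.lin, fun h => neg_mem (f.mem' h)⟩⟩
instance : Sub (GrHom d M N) := ⟨fun f g => ⟨f.lin - g.lin, fun h => sub_mem (f.mem' h) (g.mem' h)⟩⟩

@[simp] theorem zero_apply (x : M) : (0 : GrHom d M N) x = 0 := rfl
@[simp] theorem add_apply (f g : GrHom d M N) (x : M) : (f + g) x = f x + g x := rfl
@[simp] theorem neg_apply (f : GrHom d M N) (x : M) : (-f) x = -f x := rfl
@[simp] theorem sub_apply (f g : GrHom d M N) (x : M) : (f - g) x = f x - g x := rfl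

/-- The identity map. -/
def id (M : GrMod 𝒦) : GrHom 0 M M := ⟨LinearMap.id, fun h => by simpa using h⟩

@[simp] theorem id_apply (x : M) : GrHom.id M x = x := rfl

/-- `f.comp g h : M → P` is the composite: first `f : M → N`, then `g : N → P`. -/
def comp (f : GrHom d M N) (g : GrHom e N P) (h : d + e = n := by first | rfl | lia) :
    GrHom n M P :=
  ⟨g.lin ∘ₗ f.lin, fun hx => by
    subst h; rw [← add_assoc]; exact g.mem' (f.mem' hx)⟩

@[simp] theorem comp_apply (f : GrHom d M N) (g : GrHom e N P) (h : d + e = n) (x : M) :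
    f.comp g h x = g (f x) := rfl

end GrHom

namespace GrMod

variable (M N P : GrMod 𝒦)

/-- The graded module `k` itself. -/
def unit (𝒦 : ℤ → AddSubgroup k) [GradedRing 𝒦] : GrMod 𝒦 where
  carrier := k
  gr := 𝒦
  internal := DirectSum.Decomposition.isInternal 𝒦
  smul_mem' := fun ha hx => SetLike.mul_mem_graded ha hx

/-- The kernel of a degree `0` map. -/
def ker {M N : GrMod 𝒦} (f : GrHom 0 M N) : GrMod 𝒦 where
  carrier := LinearMap.ker f.lin
  gr i := (M.gr i).comap (LinearMap.ker f.lin).subtype.toAddMonoidHom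
  internal := by
    have hk : ∀ (x : LinearMap.ker f.lin) (i : ℤ), M.comps x i ∈ LinearMap.ker f.lin := by
      intro x i
      have key : ∀ y : M, f (M.comps y i) = N.comps (f y) i := by
        classical
        intro y
        induction y using M.induction with
        | h j x hx =>
          rw [M.comps_apply hx, N.comps_apply (f.mem hx (add_zero j)), Finsupp.single_apply,
            Finsupp.single_apply]
          split_ifs <;> simp
        | hadd x y hx hy => simp [hx, hy]
      have h0 : f x = 0 := x.2
      change f _ = 0
      rw [key, h0]; simp
    let D : LinearMap.ker f.lin →+ (ℤ →₀ LinearMap.ker f.lin) :=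
      { toFun := fun x => Finsupp.onFinset (M.comps x).support (fun i => ⟨M.comps x i, hk x i⟩)
          (by intro i hi; rw [Finsupp.mem_support_iff]; intro h; exact hi (Subtype.ext h))
        map_zero' := by ext; simp
        map_add' := fun x y => by ext; simp }
    have hD : ∀ x i, ((D x i : LinearMap.ker f.lin) : M) = M.comps x i := fun x i => rfl
    refine isInternal_of D ?_ ?_ ?_
    · intro x
      apply Subtype.ext
      conv_rhs => rw [← M.comps_sum x]
      rw [Finsupp.liftAddHom_apply, Finsupp.liftAddHom_apply, Finsupp.sum, Finsupp.sum]
      have hs : (D x).support = (M.comps x).support := by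
        ext i
        rw [Finsupp.mem_support_iff, Finsupp.mem_support_iff, ← hD, Ne, Ne, ZeroMemClass.coe_eq_zero]
      rw [hs]
      simp [hD]
    · intro x i
      exact M.comps_mem _ i
    · intro i x hx
      classical
      ext j
      rw [hD, M.comps_apply (show (x : M) ∈ M.gr i from hx), Finsupp.single_apply,
        Finsupp.single_apply]
      split_ifs <;> simp
  smul_mem' := fun ha hx => M.smul_mem ha hx

/-- The inclusion of the kernel. -/
def kerInc {M N : GrMod 𝒦} (f : GrHom 0 M N) : GrHom 0 (ker f) M :=
  ⟨(LinearMap.ker f.lin).subtype, fun {i _} h => (add_zero i).symm ▸ h⟩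

/-- The map to the kernel defined by a map to the ambient module. -/
def kerLift {M N P : GrMod 𝒦} {d : ℤ} (f : GrHom 0 M N) (g : GrHom d P M) (h : ∀ x, f (g x) = 0) :
    GrHom d P (ker f) :=
  ⟨g.lin.codRestrict (LinearMap.ker f.lin) h, fun hx => g.mem' hx⟩

/-- The shift: `M[a]^i = M^{a+i}`. -/
def shift (a : ℤ) : GrMod 𝒦 where
  carrier := M
  gr i := M.gr (a + i)
  internal := by
    refine isInternal_of ((Finsupp.mapDomain.addMonoidHom (fun i => i - a)).comp M.comps) ?_ ?_ ?_
    · intro x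
      induction x using M.induction with
      | h j x hx => simp [M.comps_apply hx]
      | hadd x y hx hy => rw [map_add, map_add, hx, hy]
    · classical
      intro x i
      induction x using M.induction with
      | h j x hx =>
        simp only [AddMonoidHom.coe_comp, Function.comp_apply, M.comps_apply hx,
          Finsupp.mapDomain.addMonoidHom_apply, Finsupp.mapDomain_single, Finsupp.single_apply]
        split_ifs with h
        · rw [← h]; simpa using hx
        · exact zero_mem _
      | hadd x y hx hy =>
        rw [map_add, Finsupp.add_apply]
        exact add_mem hx hy
    · intro i x hx
      simp [M.comps_apply hx]
  smul_mem' := fun {i j a' x} ha hx => by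
    have := M.smul_mem ha hx
    rwa [add_left_comm] at this

/-- The map `σ^a : M → M[a]` of degree `d = -a`. -/
def toShift (a : ℤ) {d : ℤ} (h : d = -a := by lia) : GrHom d M (M.shift a) :=
  ⟨LinearMap.id, fun {i x} hx => show x ∈ M.gr _ by
    rw [show a + (i + d) = i by lia]; exact hx⟩

/-- The map `σ^{-a} : M[a] → M` of degree `a`, inverse to `toShift`. -/
def ofShift (a : ℤ) : GrHom a (M.shift a) M :=
  ⟨LinearMap.id, fun {i x} h => show x ∈ M.gr _ by rw [add_comm]; exact h⟩

/-- `f[a] : M[a] → N[a]` for `f` of degree `0`. -/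
def shiftMap (a : ℤ) {M N : GrMod 𝒦} (f : GrHom 0 M N) : GrHom 0 (M.shift a) (N.shift a) :=
  (M.ofShift a).comp (f.comp (N.toShift a (d := -a)) (n := -a))

end GrMod

/-! ### The tensor product over `k` -/

namespace GrMod

variable [GradedRing 𝒦]

section Tensor

theorem ring_induction (𝒦 : ℤ → AddSubgroup k) [GradedRing 𝒦] {p : k → Prop} (b : k)
    (h : ∀ i, ∀ b ∈ 𝒦 i, p b) (hadd : ∀ x y, p x → p y → p (x + y)) : p b :=
  (unit 𝒦).induction b h hadd

variable (M N : GrMod 𝒦)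

/-- The relations `(a x) ⊗ y = (-1)^{|a||x|} x ⊗ (a y)` that define the tensor product over `k`. -/
def tensorRel : Submodule k (M ⊗[ℤ] N) :=
  Submodule.span k {z | ∃ (i j : ℤ) (a : k) (x : M) (y : N), a ∈ 𝒦 i ∧ x ∈ M.gr j ∧
    z = (a • x) ⊗ₜ[ℤ] y - sg (i * j) • x ⊗ₜ[ℤ] (a • y)}

/-- The underlying module of the tensor product. -/
abbrev TensorCarrier : Type u := (M ⊗[ℤ] N) ⧸ tensorRel M N

/-- `x ↦ y ↦ x ⊗ y`, as a biadditive map. -/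
def tmulAux : M →+ N →+ TensorCarrier M N :=
  AddMonoidHom.mk' (fun x => (((tensorRel M N).mkQ.toAddMonoidHom).comp
    (TensorProduct.mk ℤ M N x).toAddMonoidHom)) (fun x y => by
      ext z
      simp)

/-- The part of degree `d` of the tensor product: spanned by `x ⊗ y` with `|x| + |y| = d`. -/
def tensorGr (d : ℤ) : AddSubgroup (TensorCarrier M N) :=
  AddSubgroup.closure {z | ∃ (i j : ℤ) (x : M) (y : N), x ∈ M.gr i ∧ y ∈ N.gr j ∧ i + j = d ∧
    z = tmulAux M N x y}

variable {M N}

theorem tmulAux_smul_left (a : k) (x : M) (y : N) :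
    tmulAux M N (a • x) y = a • tmulAux M N x y := rfl

theorem tmulAux_smul_right {i j : ℤ} {a : k} {x : M} (y : N) (ha : a ∈ 𝒦 i) (hx : x ∈ M.gr j) :
    tmulAux M N x (a • y) = sg (i * j) • a • tmulAux M N x y := by
  have h : tmulAux M N (a • x) y - sg (i * j) • tmulAux M N x (a • y) = 0 := by
    refine (Submodule.Quotient.mk_eq_zero (tensorRel M N)).2
      (Submodule.subset_span ⟨i, j, a, x, y, ha, hx, rfl⟩)
  rw [sub_eq_zero, tmulAux_smul_left] at h
  rw [h, smul_smul, sg_mul_self, one_smul]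

theorem tensorCarrier_induction {p : TensorCarrier M N → Prop} (z : TensorCarrier M N)
    (h : ∀ i j x y, x ∈ M.gr i → y ∈ N.gr j → p (tmulAux M N x y))
    (hadd : ∀ x y, p x → p y → p (x + y)) : p z := by
  obtain ⟨z, rfl⟩ := (tensorRel M N).mkQ_surjective z
  induction z using TensorProduct.induction_on with
  | zero => simpa using h 0 0 0 0 (zero_mem _) (zero_mem _)
  | tmul x y =>
    change p (tmulAux M N x y)
    induction x using M.induction with
    | h i x hx =>
      induction y using N.induction with
      | h j y hy => exact h i j x y hx hy
      | hadd y y' hy hy' => rw [map_add]; exact hadd _ _ hy hy'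
    | hadd x x' hx hx' => rw [map_add]; exact hadd _ _ hx hx'
  | add z z' hz hz' => rw [map_add]; exact hadd _ _ hz hz'

/-- Additive maps from the tensor product. -/
def tensorLiftAux {P : Type*} [AddCommGroup P] (φ : M →+ N →+ P)
    (h : ∀ (b : k) (i j : ℤ) (a : k) (x : M) (y : N), a ∈ 𝒦 i → x ∈ M.gr j →
      φ (b • a • x) y = sg (i * j) • φ (b • x) (a • y)) : TensorCarrier M N →+ P :=
  QuotientAddGroup.lift (tensorRel M N).toAddSubgroup
    (TensorProduct.liftAddHom (R := ℤ) φ (fun r m n => by simp)) (by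
      intro z hz
      have key : ∀ b : k, TensorProduct.liftAddHom (R := ℤ) φ (fun r m n => by simp) (b • z) = 0 := by
        refine Submodule.span_induction (p := fun z _ => ∀ b : k,
          TensorProduct.liftAddHom (R := ℤ) φ (fun r m n => by simp) (b • z) = 0) ?_ ?_ ?_ ?_ hz
        · rintro _ ⟨i, j, a, x, y, ha, hx, rfl⟩ b
          rw [smul_sub, map_sub, smul_comm b (sg (i * j)), map_zsmul, TensorProduct.smul_tmul',
            TensorProduct.smul_tmul', TensorProduct.liftAddHom_tmul, TensorProduct.liftAddHom_tmul,
            h b i j a x y ha hx, sub_self]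
        · simp
        · intro x y _ _ hx hy b
          rw [smul_add, map_add, hx, hy, add_zero]
        · intro a x _ hx b
          rw [smul_smul, hx]
      simpa using key 1)

theorem tensorLiftAux_apply {P : Type*} [AddCommGroup P] (φ : M →+ N →+ P) (h) (x : M) (y : N) :
    tensorLiftAux φ h (tmulAux M N x y) = φ x y := rfl

variable (M N) in
/-- The decomposition of a pure tensor into homogeneous parts. -/
def tensorCompsAux : M →+ N →+ (ℤ →₀ TensorCarrier M N) :=
  M.byDegree fun i => AddMonoidHom.mk' (fun x => N.byDegree fun j =>
    (Finsupp.singleAddHom (i + j)).comp (tmulAux M N x)) (fun x x' => by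
      ext1 y
      induction y using N.induction with
      | h j y hy => simp [N.byDegree_apply _ hy]
      | hadd y y' hy hy' => rw [map_add, hy, hy', map_add])

theorem tensorCompsAux_apply {i j : ℤ} {x : M} {y : N} (hx : x ∈ M.gr i) (hy : y ∈ N.gr j) :
    tensorCompsAux M N x y = Finsupp.single (i + j) (tmulAux M N x y) := by
  rw [tensorCompsAux, M.byDegree_apply _ hx, AddMonoidHom.mk'_apply, N.byDegree_apply _ hy]
  rfl

theorem tensorCompsAux_rel (b : k) (i j : ℤ) (a : k) (x : M) (y : N) (ha : a ∈ 𝒦 i)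
    (hx : x ∈ M.gr j) : tensorCompsAux M N (b • a • x) y =
      sg (i * j) • tensorCompsAux M N (b • x) (a • y) := by
  induction b using ring_induction 𝒦 with
  | h l b hb =>
    induction y using N.induction with
    | h m y hy =>
      rw [tensorCompsAux_apply (M.smul_mem hb (M.smul_mem ha hx)) hy,
        tensorCompsAux_apply (M.smul_mem hb hx) (N.smul_mem ha hy),
        tmulAux_smul_left, tmulAux_smul_left, tmulAux_smul_left, tmulAux_smul_right y ha hx,
        Finsupp.smul_single, smul_comm b (sg (i * j)), smul_smul (sg _), sg_mul_self, one_smul]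
      congr 1
      ring
    | hadd y y' hy hy' => rw [smul_add, map_add, map_add, hy, hy', smul_add]
  | hadd b b' hb hb' =>
    rw [add_smul, add_smul, map_add, map_add, AddMonoidHom.add_apply, AddMonoidHom.add_apply,
      hb, hb', smul_add]

variable (M N) in
/-- The decomposition of a tensor into homogeneous parts. -/
def tensorComps : TensorCarrier M N →+ (ℤ →₀ TensorCarrier M N) :=
  tensorLiftAux (tensorCompsAux M N) tensorCompsAux_rel

theorem tensorComps_apply {i j : ℤ} {x : M} {y : N} (hx : x ∈ M.gr i) (hy : y ∈ N.gr j) :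
    tensorComps M N (tmulAux M N x y) = Finsupp.single (i + j) (tmulAux M N x y) := by
  rw [tensorComps, tensorLiftAux_apply, tensorCompsAux_apply hx hy]

variable (M N) in
/-- The tensor product `M ⊗ N` over `k` of graded modules. -/
def tensor : GrMod 𝒦 where
  carrier := TensorCarrier M N
  gr := tensorGr M N
  internal := by
    refine isInternal_of (tensorComps M N) ?_ ?_ ?_
    · intro z
      induction z using tensorCarrier_induction with
      | h i j x y hx hy => simp [tensorComps_apply hx hy]
      | hadd x y hx hy => rw [map_add, map_add, hx, hy]
    · classical
      intro z d
      induction z using tensorCarrier_induction with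
      | h i j x y hx hy =>
        rw [tensorComps_apply hx hy, Finsupp.single_apply]
        split_ifs with h
        · exact AddSubgroup.subset_closure ⟨i, j, x, y, hx, hy, h, rfl⟩
        · exact zero_mem _
      | hadd x y hx hy => rw [map_add]; exact add_mem hx hy
    · intro d z hz
      induction hz using AddSubgroup.closure_induction with
      | mem z hz =>
        obtain ⟨i, j, x, y, hx, hy, h, rfl⟩ := hz
        rw [tensorComps_apply hx hy, h]
      | zero => simp
      | add x y _ _ hx hy => rw [map_add, hx, hy, Finsupp.single_add]
      | neg x _ hx => rw [map_neg, hx, Finsupp.single_neg]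
  smul_mem' := by
    intro d e a z ha hz
    induction hz using AddSubgroup.closure_induction with
    | mem z hz =>
      obtain ⟨i, j, x, y, hx, hy, h, rfl⟩ := hz
      exact AddSubgroup.subset_closure ⟨d + i, j, a • x, y, M.smul_mem ha hx, hy, by lia, rfl⟩
    | zero => simp
    | add x y _ _ hx hy => rw [smul_add]; exact add_mem hx hy
    | neg x _ hx => rw [smul_neg]; exact neg_mem hx

/-- The tensor `x ⊗ y`, biadditive in `x` and `y`. -/
def tmul : M →+ N →+ tensor M N := tmulAux M N

theorem tmul_smul_left (a : k) (x : M) (y : N) : tmul (a • x) y = a • tmul x y := rfl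

theorem tmul_smul_right {i j : ℤ} {a : k} {x : M} (y : N) (ha : a ∈ 𝒦 i) (hx : x ∈ M.gr j) :
    tmul x (a • y) = sg (i * j) • a • tmul x y := tmulAux_smul_right y ha hx

theorem tmul_mem {i j d : ℤ} {x : M} {y : N} (hx : x ∈ M.gr i) (hy : y ∈ N.gr j)
    (h : i + j = d := by first | rfl | lia) : tmul x y ∈ (tensor M N).gr d :=
  AddSubgroup.subset_closure ⟨i, j, x, y, hx, hy, h, rfl⟩

/-- Additive maps from the tensor product. -/
def tensorLiftAdd {P : Type*} [AddCommGroup P] (φ : M →+ N →+ P)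
    (h : ∀ (b : k) (i j : ℤ) (a : k) (x : M) (y : N), a ∈ 𝒦 i → x ∈ M.gr j →
      φ (b • a • x) y = sg (i * j) • φ (b • x) (a • y)) : tensor M N →+ P :=
  tensorLiftAux φ h

theorem tensorLiftAdd_tmul {P : Type*} [AddCommGroup P] (φ : M →+ N →+ P) (h) (x : M) (y : N) :
    tensorLiftAdd φ h (tmul x y) = φ x y := rfl

theorem tensor_induction {p : tensor M N → Prop} (z : tensor M N)
    (h : ∀ i j x y, x ∈ M.gr i → y ∈ N.gr j → p (tmul x y))
    (hadd : ∀ x y, p x → p y → p (x + y)) : p z :=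
  tensorCarrier_induction z h hadd

theorem tensor_gr_induction {d : ℤ} {p : ∀ z : tensor M N, z ∈ (tensor M N).gr d → Prop}
    {z : tensor M N} (hz : z ∈ (tensor M N).gr d)
    (h : ∀ i j x y (hx : x ∈ M.gr i) (hy : y ∈ N.gr j) (h : i + j = d),
      p (tmul x y) (AddSubgroup.subset_closure ⟨i, j, x, y, hx, hy, h, rfl⟩))
    (hzero : p 0 (zero_mem _)) (hadd : ∀ x y hx hy, p x hx → p y hy → p (x + y) (add_mem hx hy))
    (hneg : ∀ x hx, p x hx → p (-x) (neg_mem hx)) : p z hz :=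
  AddSubgroup.closure_induction (p := p)
    (by rintro _ ⟨i, j, x, y, hx, hy, hd, rfl⟩; exact h i j x y hx hy hd) hzero hadd hneg hz

/-- The `k`-linear map of degree `d` on `M ⊗ N` that is defined by a `k`-bilinear one. -/
def tensorLift {P : GrMod 𝒦} {d : ℤ} (φ : M →+ N →+ P)
    (h1 : ∀ (a : k) x y, φ (a • x) y = a • φ x y)
    (h2 : ∀ {i j : ℤ} {a : k} {x : M} {y : N} {l : ℤ}, a ∈ 𝒦 i → x ∈ M.gr j → y ∈ N.gr l →
      φ x (a • y) = sg (i * j) • a • φ x y)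
    (h3 : ∀ {i j x y}, x ∈ M.gr i → y ∈ N.gr j → φ x y ∈ P.gr (i + j + d)) :
    GrHom d (tensor M N) P where
  lin :=
    { toFun := tensorLiftAdd φ (by
        intro b i j a x y ha hx
        induction y using N.induction with
        | h m y hy =>
          rw [h1, h1, h1, h2 ha hx hy, smul_comm b (sg (i * j)), smul_smul (sg _), sg_mul_self,
            one_smul]
        | hadd y y' hy hy' => rw [smul_add, map_add, map_add, hy, hy', smul_add])
      map_add' := map_add _
      map_smul' := by
        intro a z
        induction z using tensor_induction with
        | h i j x y hx hy => exact h1 a x y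
        | hadd x y hx hy => rw [smul_add, map_add, hx, hy, map_add, smul_add] }
  mem' := by
    intro e z hz
    induction hz using tensor_gr_induction with
    | h i j x y hx hy h =>
      exact h ▸ h3 hx hy
    | hzero => rw [map_zero]; exact zero_mem _
    | hadd x y _ _ hx hy => rw [map_add]; exact add_mem hx hy
    | hneg x _ hx => rw [map_neg]; exact neg_mem hx

@[simp] theorem tensorLift_tmul {P : GrMod 𝒦} {d : ℤ} (φ : M →+ N →+ P) (h1 h2 h3) (x : M)
    (y : N) : tensorLift (d := d) φ h1 h2 h3 (tmul x y) = φ x y := rfl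

theorem tensor_hom_ext {P : GrMod 𝒦} {d : ℤ} {f g : GrHom d (tensor M N) P}
    (h : ∀ i j x y, x ∈ M.gr i → y ∈ N.gr j → f (tmul x y) = g (tmul x y)) : f = g := by
  ext z
  induction z using tensor_induction with
  | h i j x y hx hy => exact h i j x y hx hy
  | hadd x y hx hy => rw [map_add, hx, hy, map_add]

end Tensor

/-- The additive automorphism `y ↦ (-1)^{p|y|} y`. -/
def sgn (M : GrMod 𝒦) (p : ℤ) : M →+ M := M.byDegree fun i => sg (p * i) • AddMonoidHom.id M

theorem sgn_apply (M : GrMod 𝒦) (p : ℤ) {i : ℤ} {y : M} (hy : y ∈ M.gr i) :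
    M.sgn p y = sg (p * i) • y := by
  rw [sgn, M.byDegree_apply _ hy]; rfl

variable {M M' N N' P Q : GrMod 𝒦} {d e n : ℤ}

/-- The tensor product of maps, `(x ⊗ y).(f ⊗ g) = (-1)^{|y||f|} x.f ⊗ y.g`. -/
def tmap (f : GrHom d M M') (g : GrHom e N N') (h : d + e = n := by first | rfl | lia) :
    GrHom n (tensor M N) (tensor M' N') :=
  tensorLift (AddMonoidHom.mk' (fun x => (tmul (f x)).comp
      ((g.lin : N →ₗ[k] N').toAddMonoidHom.comp (N.sgn d))) (fun x x' => by ext; simp))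
    (fun a x y => by simp [tmul_smul_left])
    (fun {i j a x y l} ha hx hy => by
      simp only [AddMonoidHom.mk'_apply, AddMonoidHom.comp_apply]
      rw [N.sgn_apply d (N.smul_mem ha hy), N.sgn_apply d hy]
      simp only [map_zsmul, LinearMap.toAddMonoidHom_coe, map_smul]
      rw [tmul_smul_right _ ha (f.mem hx rfl), smul_comm a (sg (d * l)), smul_smul, smul_smul,
        ← sg_add, ← sg_add]
      congr 1
      exact sg_eq ⟨d * i, by ring⟩)
    (fun {i j x y} hx hy => by
      simp only [AddMonoidHom.mk'_apply, AddMonoidHom.comp_apply]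
      rw [N.sgn_apply d hy, map_zsmul, map_zsmul]
      exact zsmul_mem (tmul_mem (f.mem hx rfl) (g.mem hy rfl)) _)

theorem tmap_tmul (f : GrHom d M M') (g : GrHom e N N') (h : d + e = n) (x : M) {j : ℤ} {y : N}
    (hy : y ∈ N.gr j) : tmap f g h (tmul x y) = sg (d * j) • tmul (f x) (g y) := by
  rw [tmap, tensorLift_tmul]
  simp only [AddMonoidHom.mk'_apply, AddMonoidHom.comp_apply]
  rw [N.sgn_apply d hy, map_zsmul, map_zsmul]
  rfl

/-- The map `x ⊗ y ↦ x ⊗ (y ⊗ z)`. -/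
def assocAux (M N : GrMod 𝒦) {P : GrMod 𝒦} (z : P) : tensor M N →+ tensor M (tensor N P) :=
  tensorLiftAdd (AddMonoidHom.mk' (fun x => (tmul x).comp (tmul.flip z))
      (fun x x' => by ext; simp))
    (fun b i j a x y ha hx => by
      simp only [AddMonoidHom.mk'_apply, AddMonoidHom.comp_apply, AddMonoidHom.flip_apply,
        tmul_smul_left, tmul_smul_right _ ha hx]
      rw [smul_comm b (sg (i * j)), smul_smul (sg _), sg_mul_self, one_smul])

theorem assocAux_tmul (z : P) (x : M) (y : N) :
    assocAux M N z (tmul x y) = tmul x (tmul y z) := rfl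

/-- The associativity isomorphism `(x ⊗ y) ⊗ z ↦ x ⊗ (y ⊗ z)`. -/
def assoc (M N P : GrMod 𝒦) : GrHom 0 (tensor (tensor M N) P) (tensor M (tensor N P)) :=
  tensorLift (AddMonoidHom.flip (AddMonoidHom.mk' (assocAux M N) (fun z z' => by
        ext w
        induction w using tensor_induction with
        | h i j x y hx hy => simp [assocAux_tmul]
        | hadd x y hx hy => rw [map_add, hx, hy, map_add])))
    (fun a w z => by
      simp only [AddMonoidHom.flip_apply, AddMonoidHom.mk'_apply]
      induction w using tensor_induction with
      | h i j x y hx hy => rfl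
      | hadd x y hx hy => rw [smul_add, map_add, map_add, hx, hy, smul_add])
    (fun {i j a w z l} ha hw hz => by
      simp only [AddMonoidHom.flip_apply, AddMonoidHom.mk'_apply]
      induction hw using tensor_gr_induction with
      | h m n x y hx hy h =>
        change assocAux M N (a • z) (tmul x y) = sg (i * j) • a • assocAux M N z (tmul x y)
        rw [assocAux_tmul, assocAux_tmul, tmul_smul_right z ha hy, map_zsmul,
          tmul_smul_right _ ha hx, smul_smul, ← sg_add, ← h, mul_add, add_comm]
      | hzero =>
        rw [map_zero (assocAux M N (a • z)), map_zero (assocAux M N z), smul_zero, smul_zero]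
      | hadd x y _ _ hx hy =>
        rw [map_add (assocAux M N (a • z)), map_add (assocAux M N z), hx, hy, smul_add, smul_add]
      | hneg x _ hx =>
        rw [map_neg (assocAux M N (a • z)), map_neg (assocAux M N z), hx, smul_neg, smul_neg])
    (fun {i j w z} hw hz => by
      simp only [AddMonoidHom.flip_apply, AddMonoidHom.mk'_apply]
      induction hw using tensor_gr_induction with
      | h m n x y hx hy h =>
        exact tmul_mem hx (tmul_mem hy hz rfl)
      | hzero => rw [map_zero (assocAux M N z)]; exact zero_mem _
      | hadd x y _ _ hx hy => rw [map_add (assocAux M N z)]; exact add_mem hx hy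
      | hneg x _ hx => rw [map_neg (assocAux M N z)]; exact neg_mem hx)

@[simp] theorem assoc_tmul (x : M) (y : N) (z : P) :
    assoc M N P (tmul (tmul x y) z) = tmul x (tmul y z) := rfl

/-- The map `y ⊗ z ↦ (x ⊗ y) ⊗ z`. -/
def assocInvAux {M : GrMod 𝒦} (N P : GrMod 𝒦) (x : M) : tensor N P →+ tensor (tensor M N) P :=
  tensorLiftAdd (tmul.comp (tmul x)) (fun b i j a y z ha hy => by
    simp only [AddMonoidHom.comp_apply]
    induction x using M.induction with
    | h m x hx =>
      induction b using ring_induction 𝒦 with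
      | h l b hb =>
        rw [tmul_smul_right _ hb hx, tmul_smul_right _ ha hx, tmul_smul_right _ hb hx]
        simp only [map_zsmul, AddMonoidHom.smul_apply, tmul_smul_left]
        rw [tmul_smul_right _ ha (tmul_mem hx hy rfl)]
        simp only [smul_comm b (_ : ℤ), smul_smul (_ : ℤ) (_ : ℤ), ← sg_add]
        congr 1
        exact sg_eq ⟨-(i * j), by ring⟩
      | hadd b b' hb hb' =>
        rw [add_smul, add_smul, map_add, map_add, map_add, map_add, AddMonoidHom.add_apply,
          AddMonoidHom.add_apply, hb, hb', smul_add]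
    | hadd x x' hx hx' =>
      rw [map_add]
      simp only [AddMonoidHom.add_apply, map_add, hx, hx', smul_add])

theorem assocInvAux_tmul (x : M) (y : N) (z : P) :
    assocInvAux N P x (tmul y z) = tmul (tmul x y) z := rfl

/-- The inverse `x ⊗ (y ⊗ z) ↦ (x ⊗ y) ⊗ z` of the associativity isomorphism. -/
def assocInv (M N P : GrMod 𝒦) : GrHom 0 (tensor M (tensor N P)) (tensor (tensor M N) P) :=
  tensorLift (AddMonoidHom.mk' (assocInvAux N P) (fun x x' => by
        ext w
        induction w using tensor_induction with
        | h i j y z hy hz => simp [assocInvAux_tmul]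
        | hadd x y hx hy => rw [map_add, hx, hy, map_add]))
    (fun a x w => by
      simp only [AddMonoidHom.mk'_apply]
      induction w using tensor_induction with
      | h i j y z hy hz => rfl
      | hadd x y hx hy => rw [map_add, map_add, hx, hy, smul_add])
    (fun {i j a x w l} ha hx hw => by
      simp only [AddMonoidHom.mk'_apply]
      clear hw
      induction w using tensor_induction with
      | h m n y z hy hz =>
        rw [← tmul_smul_left, assocInvAux_tmul, assocInvAux_tmul, tmul_smul_right _ ha hx,
          map_zsmul, AddMonoidHom.smul_apply, tmul_smul_left]
      | hadd x y hx hy => rw [smul_add, map_add, map_add, hx, hy, smul_add, smul_add])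
    (fun {i j x w} hx hw => by
      simp only [AddMonoidHom.mk'_apply]
      induction hw using tensor_gr_induction with
      | h m n y z hy hz h =>
        exact tmul_mem (tmul_mem hx hy rfl) hz
      | hzero => rw [map_zero (assocInvAux N P x)]; exact zero_mem _
      | hadd x y _ _ hx hy => rw [map_add (assocInvAux N P _)]; exact add_mem hx hy
      | hneg x _ hx => rw [map_neg (assocInvAux N P _)]; exact neg_mem hx)

@[simp] theorem assocInv_tmul (x : M) (y : N) (z : P) :
    assocInv M N P (tmul x (tmul y z)) = tmul (tmul x y) z := rfl

end GrMod

/-! ### The unit object, direct sums and tensor powers -/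

namespace GrMod

section Unit

variable [GradedRing 𝒦]

/-- The map `k → M`, `a ↦ a x`, of degree `|x|`. -/
def ofElem {M : GrMod 𝒦} {d : ℤ} (x : M) (hx : x ∈ M.gr d) : GrHom d (unit 𝒦) M :=
  ⟨LinearMap.toSpanSingleton k M x, fun ha => M.smul_mem ha hx⟩

@[simp] theorem ofElem_apply {M : GrMod 𝒦} {d : ℤ} (x : M) (hx : x ∈ M.gr d) (a : k) :
    ofElem x hx (show unit 𝒦 from a) = a • x := rfl

/-- The element `1` of the graded module `k`. -/
def one (𝒦 : ℤ → AddSubgroup k) [GradedRing 𝒦] : unit 𝒦 := (1 : k)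

theorem one_mem : one 𝒦 ∈ (unit 𝒦).gr 0 := SetLike.one_mem_graded 𝒦

theorem smul_one (a : k) : a • one 𝒦 = (show unit 𝒦 from a) := mul_one a

/-- The isomorphism `M ≅ k ⊗ M`, `x ↦ 1 ⊗ x`. -/
def lidInv (M : GrMod 𝒦) : GrHom 0 M (tensor (unit 𝒦) M) where
  lin :=
    { toFun := fun x => tmul (one 𝒦) x
      map_add' := fun x y => map_add _ x y
      map_smul' := fun a x => by
        induction a using ring_induction 𝒦 with
        | h i a ha => simp [tmul_smul_right x ha one_mem, sg_zero]
        | hadd a b ha hb =>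
          simp only [RingHom.id_apply] at ha hb ⊢
          rw [add_smul, map_add, ha, hb, add_smul] }
  mem' := fun hx => tmul_mem one_mem hx (by lia)

@[simp] theorem lidInv_apply {M : GrMod 𝒦} (x : M) : lidInv M x = tmul (one 𝒦) x := rfl

/-- The isomorphism `M ≅ M ⊗ k`, `x ↦ x ⊗ 1`. -/
def ridInv (M : GrMod 𝒦) : GrHom 0 M (tensor M (unit 𝒦)) where
  lin :=
    { toFun := fun x => tmul x (one 𝒦)
      map_add' := fun x y => by simp
      map_smul' := fun a x => rfl }
  mem' := fun hx => tmul_mem hx one_mem (by lia)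

@[simp] theorem ridInv_apply {M : GrMod 𝒦} (x : M) : ridInv M x = tmul x (one 𝒦) := rfl

variable [GradedStronglyCommutative 𝒦]

theorem scalar_comm {i j : ℤ} {a b : k} (ha : a ∈ 𝒦 i) (hb : b ∈ 𝒦 j) :
    b * a = sg (i * j) • (a * b) := GradedStronglyCommutative.mul_comm' ha hb

/-- The isomorphism `k ⊗ M ≅ M`, `a ⊗ x ↦ a x`. -/
def lid (M : GrMod 𝒦) : GrHom 0 (tensor (unit 𝒦) M) M :=
  tensorLift (M := unit 𝒦) (smulAddHom k M)
    (fun a x y => mul_smul a x y)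
    (fun {i j a x y l} ha hx hy => by
      change (show k from x) • a • y = sg (i * j) • a • (show k from x) • y
      rw [← mul_smul, ← mul_smul, scalar_comm ha hx, smul_assoc])
    (fun {i j a y} ha hy => by rw [add_zero]; exact M.smul_mem ha hy)

@[simp] theorem lid_tmul {M : GrMod 𝒦} (a : k) (x : M) :
    lid M (tmul (show unit 𝒦 from a) x) = a • x := rfl

/-- The right action `x a = (-1)^{|a||x|} a x`. -/
def rsmul (M : GrMod 𝒦) : M →+ k →+ M :=
  AddMonoidHom.flip ((unit 𝒦).byDegree (fun i => AddMonoidHom.mk'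
    (fun a => (smulAddHom k M a).comp (M.sgn i))
    (fun a b => by ext x; exact add_smul (R := k) a b (M.sgn i x))))

theorem rsmul_apply {M : GrMod 𝒦} {i j : ℤ} {a : k} {x : M} (ha : a ∈ 𝒦 i) (hx : x ∈ M.gr j) :
    rsmul M x a = sg (i * j) • a • x := by
  have h := (unit 𝒦).byDegree_apply (fun i => AddMonoidHom.mk'
    (fun a => (smulAddHom k M a).comp (M.sgn i))
    (fun a b => by ext x; exact add_smul (R := k) a b (M.sgn i x))) (i := i) (x := a) ha
  refine (DFunLike.congr_fun h x).trans ?_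
  change a • (M.sgn i x) = _
  rw [M.sgn_apply i hx, smul_comm]

theorem rsmul_smul {M : GrMod 𝒦} (b : k) (x : M) (a : k) :
    rsmul M (b • x) a = b • rsmul M x a := by
  induction x using M.induction with
  | h j x hx =>
    induction a using ring_induction 𝒦 with
    | h i a ha =>
      induction b using ring_induction 𝒦 with
      | h l b hb =>
        rw [rsmul_apply ha (M.smul_mem hb hx), rsmul_apply ha hx, ← mul_smul, scalar_comm hb ha,
          smul_comm b (sg _), smul_assoc, smul_smul, ← sg_add, ← mul_smul]
        congr 1
        exact sg_eq ⟨i * l, by ring⟩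
      | hadd b b' hb hb' =>
        rw [add_smul, map_add, AddMonoidHom.add_apply, hb, hb', add_smul]
    | hadd a a' ha ha' => rw [map_add, map_add, ha, ha', smul_add]
  | hadd x x' hx hx' =>
    rw [smul_add, map_add, map_add, AddMonoidHom.add_apply, AddMonoidHom.add_apply, hx, hx',
      smul_add]

theorem rsmul_mul {M : GrMod 𝒦} {i j l : ℤ} {a b : k} {x : M} (ha : a ∈ 𝒦 i) (hx : x ∈ M.gr j)
    (hb : b ∈ 𝒦 l) : rsmul M x (a * b) = sg (i * j) • a • rsmul M x b := by
  have hab : (a * b : k) ∈ 𝒦 (i + l) := SetLike.mul_mem_graded (A := 𝒦) ha hb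
  rw [rsmul_apply hab hx, rsmul_apply hb hx, smul_comm a (sg _), smul_smul, ← sg_add, ← mul_smul,
    add_mul]

theorem rsmul_mem {M : GrMod 𝒦} {i j : ℤ} {a : k} {x : M} (hx : x ∈ M.gr i) (ha : a ∈ 𝒦 j) :
    rsmul M x a ∈ M.gr (i + j + 0) := by
  rw [rsmul_apply ha hx, add_zero, add_comm]
  exact zsmul_mem (M.smul_mem ha hx) _

/-- The isomorphism `M ⊗ k ≅ M`, `x ⊗ a ↦ x a = (-1)^{|a||x|} a x`. -/
def rid (M : GrMod 𝒦) : GrHom 0 (tensor M (unit 𝒦)) M :=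
  tensorLift (N := unit 𝒦) (show M →+ unit 𝒦 →+ M from rsmul M)
    (fun b x a => rsmul_smul b x a) (fun ha hx hb => rsmul_mul (k := k) (𝒦 := 𝒦) ha hx hb)
    (fun hx ha => rsmul_mem hx ha)

theorem rid_tmul {M : GrMod 𝒦} {i j : ℤ} {a : k} {x : M} (hx : x ∈ M.gr j) (ha : a ∈ 𝒦 i) :
    rid M (tmul x (show unit 𝒦 from a)) = sg (i * j) • a • x :=
  rsmul_apply ha hx

end Unit

section DirectSum

variable (M : ℕ → GrMod 𝒦) {P : GrMod 𝒦} {d : ℤ}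

/-- The homogeneous components of a direct sum. -/
def dsumGr (i : ℤ) : AddSubgroup (⨁ n, M n) where
  carrier := {x | ∀ n, x n ∈ (M n).gr i}
  zero_mem' := fun _ => zero_mem _
  add_mem' := fun hx hy n => add_mem (hx n) (hy n)
  neg_mem' := fun hx n => neg_mem (hx n)

variable {M} in
theorem of_mem_dsumGr {i : ℤ} {n : ℕ} {x : M n} (hx : x ∈ (M n).gr i) :
    DirectSum.of (fun n => M n) n x ∈ dsumGr M i := by
  classical
  intro m
  by_cases h : n = m
  · subst h; simpa using hx
  · rw [DirectSum.of_eq_of_ne _ _ _ (Ne.symm h)]; exact zero_mem _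

variable {M} in
theorem dsumGr_induction {i : ℤ} {p : (⨁ n, M n) → Prop} {z : ⨁ n, M n} (hz : z ∈ dsumGr M i)
    (h0 : p 0) (h : ∀ n, ∀ x ∈ (M n).gr i, p (DirectSum.of (fun n => M n) n x))
    (hadd : ∀ x y, p x → p y → p (x + y)) : p z := by
  classical
  rw [← DirectSum.sum_support_of z]
  generalize DFinsupp.support z = s
  induction s using Finset.induction_on with
  | empty => simpa using h0
  | insert n s hn ih =>
    rw [Finset.sum_insert hn]
    exact hadd _ _ (h n _ (hz n)) ih

/-- The direct sum of a sequence of graded modules. -/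
def dsum : GrMod 𝒦 where
  carrier := ⨁ n, M n
  gr := dsumGr M
  internal := by
    classical
    let D : (⨁ n, M n) →+ (ℤ →₀ ⨁ n, M n) := DirectSum.toAddMonoid fun n =>
      (Finsupp.mapRange.addMonoidHom (DirectSum.of (fun n => M n) n)).comp (M n).comps
    have hD : ∀ n x, D (DirectSum.of (fun n => M n) n x) =
        Finsupp.mapRange.addMonoidHom (DirectSum.of (fun n => M n) n) ((M n).comps x) :=
      fun n x => by simp [D]
    have hDi : ∀ x i n, (D x i) n = (M n).comps (x n) i := by
      intro x i n
      induction x using DirectSum.induction_on with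
      | zero => simp
      | of m x =>
        rw [hD]
        simp only [Finsupp.mapRange.addMonoidHom_apply, Finsupp.mapRange_apply]
        by_cases h : m = n
        · subst h; simp
        · rw [DirectSum.of_eq_of_ne _ _ _ (Ne.symm h), DirectSum.of_eq_of_ne _ _ _ (Ne.symm h)]
          simp
      | add x y hx hy => simp [hx, hy]
    refine isInternal_of D ?_ ?_ ?_
    · intro x
      induction x using DirectSum.induction_on with
      | zero => simp
      | of n x =>
        rw [hD]
        induction x using (M n).induction with
        | h i x hx => simp [(M n).comps_apply hx]
        | hadd x y hx hy => simp only [map_add] at hx hy ⊢; rw [hx, hy]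
      | add x y hx hy => rw [map_add, map_add, hx, hy]
    · intro x i n
      rw [hDi]
      exact (M n).comps_mem _ _
    · intro i x hx
      ext j n
      rw [hDi, (M n).comps_apply (hx n), Finsupp.single_apply, Finsupp.single_apply]
      split_ifs <;> simp
  smul_mem' := fun ha hx n => (M n).smul_mem ha (hx n)

/-- The inclusion of the `n`-th summand. -/
def inj (n : ℕ) : GrHom 0 (M n) (dsum M) where
  lin := DirectSum.lof k ℕ (fun n => M n) n
  mem' := fun {i x} hx => by rw [add_zero]; exact of_mem_dsumGr hx

variable {M}

theorem dsum_induction {p : dsum M → Prop} (z : dsum M) (h : ∀ n x, p (inj M n x))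
    (hadd : ∀ x y, p x → p y → p (x + y)) : p z :=
  DirectSum.induction_on (motive := p) z ((map_zero (inj M 0)) ▸ h 0 0) h hadd

theorem dsum_gr_induction {i : ℤ} {p : ∀ z : dsum M, z ∈ (dsum M).gr i → Prop} {z : dsum M}
    (hz : z ∈ (dsum M).gr i)
    (h : ∀ n x (hx : x ∈ (M n).gr i), p (inj M n x) ((inj M n).mem hx (add_zero i)))
    (hadd : ∀ x y hx hy, p x hx → p y hy → p (x + y) (add_mem hx hy)) : p z hz := by
  suffices H : ∃ hz, p z hz from H.2
  refine dsumGr_induction (p := fun z => ∃ hz : z ∈ (dsum M).gr i, p z hz) hz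
    ⟨zero_mem _, ?_⟩ (fun n x hx => ⟨_, h n x hx⟩)
    (fun x y hx hy => ⟨_, hadd x y hx.1 hy.1 hx.2 hy.2⟩)
  have h0 := h 0 0 (zero_mem _)
  have e : inj M 0 0 = 0 := map_zero (inj M 0)
  have H : ∀ w : dsum M, w = 0 → ∀ hw, p w hw → p 0 (zero_mem _) := by
    rintro _ rfl _ h
    exact h
  exact H _ e _ h0

/-- The linear map that underlies `dsumDesc`. -/
def dsumDescLin (F : ∀ n, GrHom d (M n) P) : dsum M →ₗ[k] P :=
  DirectSum.toModule k ℕ P fun n => (F n).lin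

theorem dsumDescLin_inj (F : ∀ n, GrHom d (M n) P) (n : ℕ) (x : M n) :
    dsumDescLin F (inj M n x) = F n x :=
  DirectSum.toModule_lof (M := fun n => M n) (φ := fun n => (F n).lin) k n x

/-- The map from a direct sum that is `F n` on the `n`-th summand. -/
def dsumDesc (F : ∀ n, GrHom d (M n) P) : GrHom d (dsum M) P where
  lin := dsumDescLin F
  mem' := fun {i x} hx => by
    induction hx using dsum_gr_induction with
    | h n x hx => rw [dsumDescLin_inj]; exact (F n).mem hx rfl
    | hadd x y _ _ hx hy => rw [map_add]; exact add_mem hx hy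

@[simp] theorem dsumDesc_inj (F : ∀ n, GrHom d (M n) P) (n : ℕ) (x : M n) :
    dsumDesc F (inj M n x) = F n x := dsumDescLin_inj F n x

/-- The biadditive map that underlies `tensorDsumDesc`. -/
def tensorDsumDescAux [GradedRing 𝒦] {N : GrMod 𝒦} (F : ∀ n, GrHom d (tensor (M n) N) P) :
    dsum M →+ N →+ P :=
  DirectSum.toAddMonoid (β := fun n => M n) fun n => AddMonoidHom.mk'
      (fun x => ((F n).lin.toAddMonoidHom).comp (tmul x)) (fun x x' => by ext; simp)

theorem tensorDsumDescAux_inj [GradedRing 𝒦] {N : GrMod 𝒦}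
    (F : ∀ n, GrHom d (tensor (M n) N) P) (n : ℕ) (x : M n) (y : N) :
    tensorDsumDescAux F (inj M n x) y = F n (tmul x y) := by
  have h := DirectSum.toAddMonoid_of (β := fun n => M n) (fun n => AddMonoidHom.mk'
      (fun x => ((F n).lin.toAddMonoidHom).comp (tmul (N := N) x)) (fun x x' => by ext; simp)) n x
  exact DFunLike.congr_fun h y

/-- The map `(⨁ M n) ⊗ N → P` that is `F n` on `M n ⊗ N`. -/
def tensorDsumDesc [GradedRing 𝒦] {N : GrMod 𝒦} (F : ∀ n, GrHom d (tensor (M n) N) P) :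
    GrHom d (tensor (dsum M) N) P :=
  tensorLift (tensorDsumDescAux F)
    (fun a x y => by
      induction x using dsum_induction with
      | h n x =>
        rw [← map_smul, tensorDsumDescAux_inj, tensorDsumDescAux_inj, tmul_smul_left, map_smul]
      | hadd x x' hx hx' =>
        rw [smul_add, map_add, map_add, AddMonoidHom.add_apply, AddMonoidHom.add_apply, hx, hx',
          smul_add])
    (fun {i j a x y l} ha hx hy => by
      induction hx using dsum_gr_induction with
      | h n x hx =>
        rw [tensorDsumDescAux_inj, tensorDsumDescAux_inj, tmul_smul_right y ha hx, map_zsmul,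
          map_smul]
      | hadd x x' _ _ hx hx' =>
        rw [map_add, AddMonoidHom.add_apply, AddMonoidHom.add_apply, hx, hx', smul_add, smul_add])
    (fun {i j x y} hx hy => by
      induction hx using dsum_gr_induction with
      | h n x hx =>
        rw [tensorDsumDescAux_inj]
        exact (F n).mem (tmul_mem hx hy rfl) rfl
      | hadd x x' _ _ hx hx' =>
        rw [map_add, AddMonoidHom.add_apply]
        exact add_mem hx hx')

@[simp] theorem tensorDsumDesc_tmul [GradedRing 𝒦] {N : GrMod 𝒦}
    (F : ∀ n, GrHom d (tensor (M n) N) P) (n : ℕ) (x : M n) (y : N) :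
    tensorDsumDesc F (tmul (inj M n x) y) = F n (tmul x y) := tensorDsumDescAux_inj F n x y

end DirectSum

end GrMod

/-! ### Tensor algebras and tensor coalgebras -/

namespace GrMod

section TensorPowers

variable [GradedRing 𝒦]

section Right

variable {M : ℕ → GrMod 𝒦} {N P : GrMod 𝒦} {d : ℤ}

/-- The biadditive map that underlies `tensorDsumDescRight`. -/
def tensorDsumDescRightAux (F : ∀ n, GrHom d (tensor N (M n)) P) : N →+ dsum M →+ P :=
  AddMonoidHom.flip (M := dsum M) (DirectSum.toAddMonoid (β := fun n => M n) fun n =>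
    AddMonoidHom.mk' (fun y => ((F n).lin.toAddMonoidHom).comp (tmul.flip y))
      (fun y y' => by ext; simp))

theorem tensorDsumDescRightAux_inj (F : ∀ n, GrHom d (tensor N (M n)) P) (n : ℕ) (x : N)
    (y : M n) : tensorDsumDescRightAux F x (inj M n y) = F n (tmul x y) := by
  have h := DirectSum.toAddMonoid_of (β := fun n => M n) (fun n => AddMonoidHom.mk'
      (fun y => ((F n).lin.toAddMonoidHom).comp (tmul.flip (M := N) y))
      (fun y y' => by ext; simp)) n y
  exact DFunLike.congr_fun h x

/-- The map `N ⊗ (⨁ M n) → P` that is `F n` on `N ⊗ M n`. -/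
def tensorDsumDescRight (F : ∀ n, GrHom d (tensor N (M n)) P) : GrHom d (tensor N (dsum M)) P :=
  tensorLift (tensorDsumDescRightAux F)
    (fun a x y => by
      induction y using dsum_induction with
      | h n y =>
        rw [tensorDsumDescRightAux_inj, tensorDsumDescRightAux_inj, tmul_smul_left, map_smul]
      | hadd y y' hy hy' => rw [map_add, map_add, hy, hy', smul_add])
    (fun {i j a x y l} ha hx hy => by
      clear hy
      induction y using dsum_induction with
      | h n y =>
        rw [← map_smul, tensorDsumDescRightAux_inj, tensorDsumDescRightAux_inj,
          tmul_smul_right y ha hx, map_zsmul, map_smul]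
      | hadd y y' hy hy' => rw [smul_add, map_add, map_add, hy, hy', smul_add, smul_add])
    (fun {i j x y} hx hy => by
      induction hy using dsum_gr_induction with
      | h n y hy =>
        rw [tensorDsumDescRightAux_inj]
        exact (F n).mem (tmul_mem hx hy rfl) rfl
      | hadd y y' _ _ hy hy' =>
        rw [map_add]
        exact add_mem hy hy')

@[simp] theorem tensorDsumDescRight_tmul (F : ∀ n, GrHom d (tensor N (M n)) P) (n : ℕ) (x : N)
    (y : M n) : tensorDsumDescRight F (tmul x (inj M n y)) = F n (tmul x y) :=
  tensorDsumDescRightAux_inj F n x y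

end Right

/-- The tensor powers `X^{⊗ 0} = k`, `X^{⊗ (n+1)} = X ⊗ X^{⊗ n}`. -/
def tpow (X : GrMod 𝒦) : ℕ → GrMod 𝒦
  | 0 => unit 𝒦
  | n + 1 => tensor X (tpow X n)

/-- The graded module `XT^≥ = ⨁ₙ X^{⊗ n}`. -/
def T (X : GrMod 𝒦) : GrMod 𝒦 := dsum (tpow X)

variable {X Y : GrMod 𝒦} {P : GrMod 𝒦} {d : ℤ}

/-- The inclusion of `X^{⊗ n}`. -/
def tinj (X : GrMod 𝒦) (n : ℕ) : GrHom 0 (tpow X n) (T X) := inj (tpow X) n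

/-- The map on `XT^≥` that is `F n` on `X^{⊗ n}`. -/
def tdesc (F : ∀ n, GrHom d (tpow X n) P) : GrHom d (T X) P := dsumDesc F

@[simp] theorem tdesc_tinj (F : ∀ n, GrHom d (tpow X n) P) (n : ℕ) (t : tpow X n) :
    tdesc F (tinj X n t) = F n t := dsumDesc_inj F n t

/-- The inclusion `X → XT^≥`. -/
def tinj1 (X : GrMod 𝒦) : GrHom 0 X (T X) := (ridInv X).comp (tinj X 1)

/-- The inclusion `X ⊗ X → XT^≥`. -/
def tinj2 (X : GrMod 𝒦) : GrHom 0 (tensor X X) (T X) :=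
  (tmap (.id X) (ridInv X)).comp (tinj X 2)

/-- The map `X ⊗ XT^≥ → XT^≥`, `x ⊗ (x₁ ⋯ xₙ) ↦ x x₁ ⋯ xₙ`. -/
def tcons (X : GrMod 𝒦) : GrHom 0 (tensor X (T X)) (T X) :=
  tensorDsumDescRight fun n => tinj X (n + 1)

@[simp] theorem tcons_tmul (x : X) (n : ℕ) (t : tpow X n) :
    tcons X (tmul x (tinj X n t)) = tinj X (n + 1) (tmul x t) :=
  tensorDsumDescRight_tmul (fun n => tinj X (n + 1)) n x t

/-- The projection `pr₀ : XT^≥ → k`. -/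
def tpr0 (X : GrMod 𝒦) : GrHom 0 (T X) (unit 𝒦) :=
  tdesc fun
    | 0 => .id _
    | _ + 1 => 0

/-- The unit `1 ∈ k = X^{⊗ 0} ⊆ XT^≥`. -/
def tone (X : GrMod 𝒦) : T X := tinj X 0 (one 𝒦)

theorem tone_mem : tone X ∈ (T X).gr 0 := (tinj X 0).mem one_mem

theorem tpr0_tone : tpr0 X (tone X) = one 𝒦 := tdesc_tinj _ 0 _

/-- The powers `f^{⊗ n} : X^{⊗ n} → Y^{⊗ n}` of a map of degree `0`. -/
def tpowMap (f : GrHom 0 X Y) : ∀ n, GrHom 0 (tpow X n) (tpow Y n)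
  | 0 => .id _
  | n + 1 => tmap f (tpowMap f n)

/-- The map `fT^≥ : XT^≥ → YT^≥`. -/
def tMap (f : GrHom 0 X Y) : GrHom 0 (T X) (T Y) := tdesc fun n => (tpowMap f n).comp (tinj Y n)

/-- The cut coproduct on `X^{⊗ n}`, that is
`(x₁ ⋯ xₙ)Δ = ∑ₖ x₁ ⋯ xₖ ⊗ xₖ₊₁ ⋯ xₙ`, by recursion: `1Δ = 1 ⊗ 1` and `(x t)Δ = 1 ⊗ x t + x (tΔ)`. -/
def cutPow (X : GrMod 𝒦) : ∀ n, GrHom 0 (tpow X n) (tensor (T X) (T X))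
  | 0 => (lidInv _).comp (tmap (tinj X 0) (tinj X 0))
  | n + 1 => (lidInv _).comp (tmap (tinj X 0) (tinj X (n + 1))) +
      (tmap (.id X) (cutPow X n)).comp ((assocInv _ _ _).comp (tmap (tcons X) (.id (T X))))

/-- The cut coproduct `Δ : XT^≥ → XT^≥ ⊗ XT^≥`. -/
def cut (X : GrMod 𝒦) : GrHom 0 (T X) (tensor (T X) (T X)) := tdesc (cutPow X)

section Coderivation

variable (b₀ : GrHom 1 (unit 𝒦) X) (b₁ : GrHom 1 X X) (b₂ : GrHom 1 (tensor X X) X)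

/-- The sum `∑ₖ bₖ ⊗ 1^{⊗ t}` (over `k + t = n`) of the maps `bₖ` applied to the first `k` factors
of `X^{⊗ n}`. -/
def headPow : ∀ n, GrHom 1 (tpow X n) (T X)
  | 0 => (lidInv _).comp ((tmap b₀ (.id _)).comp (tinj X 1))
  | 1 => (lidInv _).comp ((tmap b₀ (.id _)).comp (tinj X 2)) + (tmap b₁ (.id _)).comp (tinj X 1)
  | n + 2 => (lidInv _).comp ((tmap b₀ (.id _)).comp (tinj X (n + 3))) +
      (tmap b₁ (.id _)).comp (tinj X (n + 2)) +
      (assocInv _ _ _).comp ((tmap b₂ (.id _)).comp (tinj X (n + 1)))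

/-- The map `∑ 1^{⊗ r} ⊗ bₖ ⊗ 1^{⊗ t}` (over `r + k + t = n`) on `X^{⊗ n}`. -/
def coderPow : ∀ n, GrHom 1 (tpow X n) (T X)
  | 0 => headPow b₀ b₁ b₂ 0
  | n + 1 => headPow b₀ b₁ b₂ (n + 1) + (tmap (.id X) (coderPow n)).comp (tcons X)

/-- The coderivation of `XT^≥` of degree `1` with components `b₀`, `b₁`, `b₂`. -/
def coder : GrHom 1 (T X) (T X) := tdesc (coderPow b₀ b₁ b₂)

end Coderivation

variable [GradedStronglyCommutative 𝒦]

/-- The multiplication `X^{⊗ n} ⊗ XT^≥ → XT^≥`. -/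
def tmulPow (X : GrMod 𝒦) : ∀ n, GrHom 0 (tensor (tpow X n) (T X)) (T X)
  | 0 => lid (T X)
  | n + 1 => (assoc _ _ _).comp ((tmap (.id X) (tmulPow X n)).comp (tcons X))

/-- The multiplication of the tensor algebra `XT^≥`. -/
def tMul (X : GrMod 𝒦) : GrHom 0 (tensor (T X) (T X)) (T X) := tensorDsumDesc (tmulPow X)

/-- The derivation on `X^{⊗ n}`: `1 ↦ 0` and `x t ↦ x (t.d) + (-1)^{|t|} (x.ξ) t`. -/
def derPow (ξ : GrHom 1 X (T X)) : ∀ n, GrHom 1 (tpow X n) (T X)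
  | 0 => 0
  | n + 1 => (tmap (.id X) (derPow ξ n)).comp (tcons X) + (tmap ξ (tinj X n)).comp (tMul X)

/-- The derivation of degree `1` of `XT^≥` that is `ξ` on the generators `X`. -/
def der (ξ : GrHom 1 X (T X)) : GrHom 1 (T X) (T X) := tdesc (derPow ξ)

/-- The homomorphism of algebras `XT^≥ → YT^≥` that is `φ` on the generators, on `X^{⊗ n}`. -/
def extPow (φ : GrHom 0 X (T Y)) : ∀ n, GrHom 0 (tpow X n) (T Y)
  | 0 => tinj Y 0
  | n + 1 => (tmap φ (extPow φ n)).comp (tMul Y)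

/-- The homomorphism of unital algebras `XT^≥ → YT^≥` that is `φ` on the generators `X`. -/
def ext (φ : GrHom 0 X (T Y)) : GrHom 0 (T X) (T Y) := tdesc (extPow φ)

end TensorPowers

end GrMod

/-! ### Compatibilities of the tensor product -/

namespace GrMod

section Compat

variable [GradedRing 𝒦] {M M' M'' N N' N'' P Q : GrMod 𝒦} {d e d' e' n n' m l : ℤ}

/-- `(f ⊗ g)(f' ⊗ g') = (-1)^{|g||f'|} f f' ⊗ g g'`. -/
theorem tmap_tmap (f : GrHom d M M') (g : GrHom e N N') (f' : GrHom d' M' M'')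
    (g' : GrHom e' N' N'') (h : d + e = n) (h' : d' + e' = n') (hf : d + d' = m) (hg : e + e' = l)
    (hl : m + l = n + n') (z : tensor M N) :
    tmap f' g' h' (tmap f g h z) =
      sg (e * d') • tmap (f.comp f' hf) (g.comp g' hg) hl z := by
  induction z using tensor_induction with
  | h i j x y hx hy =>
    rw [tmap_tmul f g h x hy, map_zsmul, tmap_tmul f' g' h' _ (g.mem hy rfl), tmap_tmul _ _ _ x hy,
      smul_smul, smul_smul, ← sg_add, ← sg_add]
    congr 1
    subst hf
    exact sg_eq ⟨0, by ring⟩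
  | hadd x y hx hy => rw [map_add, map_add, map_add, hx, hy, smul_add]

theorem tmap_add_left (f f' : GrHom d M M') (g : GrHom e N N') (h : d + e = n) (z : tensor M N) :
    tmap (f + f') g h z = tmap f g h z + tmap f' g h z := by
  induction z using tensor_induction with
  | h i j x y hx hy =>
    rw [tmap_tmul _ g h x hy, tmap_tmul _ g h x hy, tmap_tmul _ g h x hy, ← smul_add,
      GrHom.add_apply, map_add, AddMonoidHom.add_apply]
  | hadd x y hx hy => rw [map_add, map_add, map_add, hx, hy]; abel

theorem tmap_add_right (f : GrHom d M M') (g g' : GrHom e N N') (h : d + e = n) (z : tensor M N) :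
    tmap f (g + g') h z = tmap f g h z + tmap f g' h z := by
  induction z using tensor_induction with
  | h i j x y hx hy =>
    rw [tmap_tmul f _ h x hy, tmap_tmul f _ h x hy, tmap_tmul f _ h x hy, ← smul_add,
      GrHom.add_apply, map_add]
  | hadd x y hx hy => rw [map_add, map_add, map_add, hx, hy]; abel

theorem tmap_zero_left (g : GrHom e N N') (h : d + e = n) (z : tensor M N) :
    tmap (0 : GrHom d M M') g h z = 0 := by
  induction z using tensor_induction with
  | h i j x y hx hy =>
    rw [tmap_tmul _ g h x hy, GrHom.zero_apply, map_zero, AddMonoidHom.zero_apply, smul_zero]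
  | hadd x y hx hy => rw [map_add, hx, hy, add_zero]

theorem tmap_zero_right (f : GrHom d M M') (h : d + e = n) (z : tensor M N) :
    tmap f (0 : GrHom e N N') h z = 0 := by
  induction z using tensor_induction with
  | h i j x y hx hy => rw [tmap_tmul f _ h x hy, GrHom.zero_apply, map_zero, smul_zero]
  | hadd x y hx hy => rw [map_add, hx, hy, add_zero]

theorem tmap_id (z : tensor M N) : tmap (.id M) (.id N) (add_zero 0) z = z := by
  induction z using tensor_induction with
  | h i j x y hx hy => rw [tmap_tmul _ _ _ x hy, zero_mul, sg_zero, one_smul]; rfl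
  | hadd x y hx hy => rw [map_add, hx, hy]

variable [GradedStronglyCommutative 𝒦]

theorem lid_natural (f : GrHom d M N) (z : tensor (unit 𝒦) M) :
    f (lid M z) = lid N (tmap (.id (unit 𝒦)) f (zero_add d) z) := by
  induction z using tensor_induction with
  | h i j a x ha hx =>
    rw [tmap_tmul _ f _ a hx, zero_mul, sg_zero, one_smul]
    exact map_smul f (show k from a) x
  | hadd x y hx hy => rw [map_add, map_add, map_add, map_add, hx, hy]

theorem rid_natural (f : GrHom d M N) (z : tensor M (unit 𝒦)) :
    f (rid M z) = rid N (tmap f (.id (unit 𝒦)) (add_zero d) z) := by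
  induction z using tensor_induction with
  | h i j x a hx ha =>
    rw [tmap_tmul f _ _ x ha, map_zsmul]
    refine (congrArg f (rid_tmul hx ha)).trans ?_
    refine Eq.trans ?_ (congrArg (sg (d * j) • ·) (rid_tmul (f.mem hx rfl) ha).symm)
    refine (map_zsmul f _ _).trans ?_
    refine (congrArg (sg (j * i) • ·) (map_smul f (show k from a) x)).trans ?_
    change _ = sg (d * j) • sg (j * (i + d)) • (show k from a) • f x
    rw [smul_smul, ← sg_add]
    congr 1
    exact sg_eq ⟨-(d * j), by ring⟩
  | hadd x y hx hy => rw [map_add, map_add, map_add, map_add, hx, hy]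

theorem lid_unit_eq_rid_unit (z : tensor (unit 𝒦) (unit 𝒦)) :
    lid (unit 𝒦) z = rid (unit 𝒦) z := by
  induction z using tensor_induction with
  | h i j a b ha hb =>
    refine Eq.trans ?_ (rid_tmul (M := unit 𝒦) ha hb).symm
    exact scalar_comm (𝒦 := 𝒦) (a := (show k from b)) (b := (show k from a)) hb ha
  | hadd x y hx hy => rw [map_add, map_add, hx, hy]

end Compat

end GrMod

/-! ### Unit-complemented curved algebras -/

open GrMod CategoryTheory

variable (𝒦) in
/-- The data of a unit-complemented curved algebra `(A, m₂, m₁, m₀, η, v)`. A `k`-linear map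
`k → A`, such as the unit `η` and the curvature `m₀`, is given by the image of `1`. -/
structure AlgData [GradedRing 𝒦] where
  /-- the underlying graded module `A` -/
  X : GrMod 𝒦
  /-- the multiplication `m₂ : A ⊗ A → A` -/
  mul : GrHom 0 (tensor X X) X
  /-- the derivation `m₁ : A → A` -/
  d : GrHom 1 X X
  /-- the curvature `m₀ ∈ A²` -/
  curv : X
  curv_mem : curv ∈ X.gr 2
  /-- the unit `1η ∈ A⁰` -/
  one : X
  one_mem : one ∈ X.gr 0
  /-- the splitting `v : A → k` of the unit -/
  v : GrHom 0 X (unit 𝒦)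
  v_one : v one = GrMod.one 𝒦

/-- The equations of a unit-complemented curved algebra. -/
structure AlgData.IsCurved [GradedRing 𝒦] (A : AlgData 𝒦) : Prop where
  mul_assoc : ∀ x y z, A.mul (tmul (A.mul (tmul x y)) z) = A.mul (tmul x (A.mul (tmul y z)))
  one_mul : ∀ x, A.mul (tmul A.one x) = x
  mul_one : ∀ x, A.mul (tmul x A.one) = x
  /-- `m₂ m₁ = (1 ⊗ m₁ + m₁ ⊗ 1) m₂` -/
  leibniz : A.mul.comp A.d (zero_add 1) =
    (tmap (.id A.X) A.d + tmap A.d (.id A.X)).comp A.mul (add_zero 1)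
  /-- `m₁² = (m₀ ⊗ 1 - 1 ⊗ m₀) m₂` -/
  d_d : ∀ x, A.d (A.d x) = A.mul (tmul A.curv x) - A.mul (tmul x A.curv)
  d_curv : A.d A.curv = 0
  d_one : A.d A.one = 0

variable (𝒦) in
/-- A unit-complemented curved algebra. -/
structure UccAlg [GradedRing 𝒦] extends AlgData 𝒦 where
  isCurved : toAlgData.IsCurved

/-- The condition for a map of degree `0` to be a homomorphism of unital graded algebras that
commutes with `m₁` and preserves `m₀`. -/
structure IsAlgHom [GradedRing 𝒦] {A B : AlgData 𝒦} (f : GrHom 0 A.X B.X) : Prop where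
  map_mul : (tmap f f).comp B.mul (add_zero 0) = A.mul.comp f (add_zero 0)
  map_one : f A.one = B.one
  map_d : f.comp B.d (zero_add 1) = A.d.comp f (add_zero 1)
  map_curv : f A.curv = B.curv

/-- Morphisms of the category of unit-complemented curved algebras. -/
@[ext] structure UccAlg.Hom [GradedRing 𝒦] (A B : UccAlg 𝒦) where
  /-- the underlying map -/
  f : GrHom 0 A.X B.X
  isAlgHom : IsAlgHom f

theorem IsAlgHom.id [GradedRing 𝒦] (A : AlgData 𝒦) : IsAlgHom (.id A.X : GrHom 0 A.X A.X) where
  map_mul := by ext z; exact congrArg A.mul (tmap_id z)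
  map_one := rfl
  map_d := rfl
  map_curv := rfl

theorem IsAlgHom.comp [GradedRing 𝒦] {A B C : AlgData 𝒦} {f : GrHom 0 A.X B.X}
    {g : GrHom 0 B.X C.X} (hf : IsAlgHom f) (hg : IsAlgHom g) :
    IsAlgHom (f.comp g (add_zero 0)) where
  map_mul := by
    ext z
    have h1 := DFunLike.congr_fun hf.map_mul z
    have h2 := DFunLike.congr_fun hg.map_mul (tmap f f (add_zero 0) z)
    simp only [GrHom.comp_apply] at h1 h2 ⊢
    rw [← h1, ← h2, tmap_tmap f f g g _ _ (add_zero 0) (add_zero 0) (by simp), zero_mul, sg_zero,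
      one_smul]
  map_one := by rw [GrHom.comp_apply, hf.map_one, hg.map_one]
  map_d := by
    ext x
    have h1 := DFunLike.congr_fun hf.map_d x
    have h2 := DFunLike.congr_fun hg.map_d (f x)
    simp only [GrHom.comp_apply] at h1 h2 ⊢
    rw [← h1, ← h2]
  map_curv := by rw [GrHom.comp_apply, hf.map_curv, hg.map_curv]

instance [GradedRing 𝒦] : Category (UccAlg 𝒦) where
  Hom := UccAlg.Hom
  id A := ⟨.id A.X, .id A.toAlgData⟩
  comp f g := ⟨f.f.comp g.f (add_zero 0), f.isAlgHom.comp g.isAlgHom⟩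

/-! ### Curved augmented coalgebras -/

variable (𝒦) in
/-- The data of a curved augmented coalgebra `(C, δ₂, δ₁, δ₀, ε, w)`; the map `w : k → C` is given
by the image of `1`. -/
structure CoalgData [GradedRing 𝒦] where
  /-- the underlying graded module `C` -/
  X : GrMod 𝒦
  /-- the comultiplication `δ₂ : C → C ⊗ C` -/
  δ₂ : GrHom 0 X (tensor X X)
  /-- the coderivation `δ₁ : C → C` -/
  δ₁ : GrHom 1 X X
  /-- the curvature `δ₀ : C → k` -/
  δ₀ : GrHom 2 X (unit 𝒦)
  /-- the counit `ε : C → k` -/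
  ε : GrHom 0 X (unit 𝒦)
  /-- the splitting `1w ∈ C⁰` of the counit -/
  w : X
  w_mem : w ∈ X.gr 0
  ε_w : ε w = GrMod.one 𝒦

namespace CoalgData

variable [GradedRing 𝒦] (C : CoalgData 𝒦)

/-- The graded module `C̄ = Ker ε`. -/
def bar : GrMod 𝒦 := ker C.ε

/-- The inclusion `C̄ → C`. -/
def inc : GrHom 0 C.bar C.X := kerInc C.ε

/-- The projection `1 - ε w : C → C̄`. -/
def pr : GrHom 0 C.X C.bar :=
  kerLift C.ε (.id C.X - C.ε.comp (ofElem C.w C.w_mem) (add_zero 0)) (fun x => by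
    have h : C.ε (ofElem C.w C.w_mem (C.ε x)) = C.ε x := by
      refine (map_smul C.ε (show k from C.ε x) C.w).trans ?_
      rw [C.ε_w]
      exact GrMod.smul_one _
    rw [GrHom.sub_apply, map_sub, GrHom.comp_apply, h]
    exact sub_self _)

/-- The reduced comultiplication `C̄ → C → C ⊗ C → C̄ ⊗ C̄`. -/
def redδ₂ : GrHom 0 C.bar (tensor C.bar C.bar) :=
  C.inc.comp (C.δ₂.comp (tmap C.pr C.pr) (n := 0))

/-- The iterated reduced comultiplication `C̄ → C̄^{⊗ (n+1)}`. -/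
def iterδ₂ : ∀ n : ℕ, GrHom 0 C.bar (tpow C.bar (n + 1))
  | 0 => ridInv C.bar
  | n + 1 => C.redδ₂.comp (tmap (.id C.bar) (iterδ₂ n))

variable [GradedStronglyCommutative 𝒦]

/-- The equations of a curved augmented coalgebra, including conilpotency. -/
structure IsCurvedAugmented : Prop where
  coassoc : C.δ₂.comp (tmap (.id C.X) C.δ₂) (add_zero 0) =
    C.δ₂.comp ((tmap C.δ₂ (.id C.X)).comp (assoc _ _ _)) (add_zero 0)
  /-- `δ₂ (1 ⊗ ε) = 1` -/
  counit_right : C.δ₂.comp ((tmap (.id C.X) C.ε).comp (rid C.X)) (add_zero 0) = .id C.X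
  /-- `δ₂ (ε ⊗ 1) = 1` -/
  counit_left : C.δ₂.comp ((tmap C.ε (.id C.X)).comp (lid C.X)) (add_zero 0) = .id C.X
  /-- `δ₁ δ₂ = δ₂ (1 ⊗ δ₁ + δ₁ ⊗ 1)` -/
  coleibniz : C.δ₁.comp C.δ₂ (add_zero 1) =
    C.δ₂.comp (tmap (.id C.X) C.δ₁ + tmap C.δ₁ (.id C.X)) (zero_add 1)
  /-- `δ₁² = δ₂ (1 ⊗ δ₀ - δ₀ ⊗ 1)` -/
  δ₁_δ₁ : C.δ₁.comp C.δ₁ (one_add_one_eq_two) =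
    C.δ₂.comp ((tmap (.id C.X) C.δ₀).comp (rid C.X) - (tmap C.δ₀ (.id C.X)).comp (lid C.X))
      (zero_add 2)
  δ₁_δ₀ : ∀ x, C.δ₀ (C.δ₁ x) = 0
  δ₁_ε : ∀ x, C.ε (C.δ₁ x) = 0
  w_δ₂ : C.δ₂ C.w = tmul C.w C.w
  /-- every element of `C̄` is killed by some iterated comultiplication `C̄ → C̄^{⊗ n}`, `n > 1` -/
  conilpotent : ∀ x : C.bar, ∃ n : ℕ, 0 < n ∧ C.iterδ₂ n x = 0

end CoalgData

variable (𝒦) in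
/-- A curved augmented coalgebra. -/
structure CaCoalg [GradedRing 𝒦] [GradedStronglyCommutative 𝒦] extends CoalgData 𝒦 where
  isCurvedAugmented : toCoalgData.IsCurvedAugmented

section

variable [GradedRing 𝒦]

/-- A pair `(g₁, g₀)` of maps `g₁ : C → D` and `g₀ : C → k` of degrees `0` and `1`. -/
@[ext] structure CoalgPair (C D : CoalgData 𝒦) where
  /-- the component `g₁ : C → D` -/
  g₁ : GrHom 0 C.X D.X
  /-- the component `g₀ : C → k` -/
  g₀ : GrHom 1 C.X (unit 𝒦)

namespace CoalgPair

/-- The identity `(id, 0)`. -/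
def id (C : CoalgData 𝒦) : CoalgPair C C := ⟨.id C.X, 0⟩

/-- The composite `h = f g` with `h₁ = f₁ g₁` and `h₀ = f₀ + f₁ g₀`. -/
def comp {C D E : CoalgData 𝒦} (f : CoalgPair C D) (g : CoalgPair D E) : CoalgPair C E :=
  ⟨f.g₁.comp g.g₁ (add_zero 0), f.g₀ + f.g₁.comp g.g₀ (zero_add 1)⟩

/-- The condition for a pair `(g₁, g₀)` to be a morphism. The map `g₀' : C̄ → k` of degree `1` is
given as a map `g₀ : C → k` that vanishes on the complement `k w` of `C̄` in `C`. -/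
structure IsHom [GradedStronglyCommutative 𝒦] {C D : CoalgData 𝒦} (g : CoalgPair C D) : Prop where
  map_δ₂ : C.δ₂.comp (tmap g.g₁ g.g₁) (add_zero 0) = g.g₁.comp D.δ₂ (add_zero 0)
  map_ε : g.g₁.comp D.ε (add_zero 0) = C.ε
  map_w : g.g₁ C.w = D.w
  /-- `δ₁ g₁ + δ₂ (g₀ ⊗ g₁ - g₁ ⊗ g₀) = g₁ δ₁` -/
  map_δ₁ : C.δ₁.comp g.g₁ (add_zero 1) +
      C.δ₂.comp ((tmap g.g₀ g.g₁).comp (lid D.X) - (tmap g.g₁ g.g₀).comp (rid D.X)) (zero_add 1) =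
    g.g₁.comp D.δ₁ (zero_add 1)
  /-- `δ₀ - δ₁ g₀ - δ₂ (g₀ ⊗ g₀) = g₁ δ₀` -/
  map_δ₀ : C.δ₀ - C.δ₁.comp g.g₀ one_add_one_eq_two -
      C.δ₂.comp ((tmap g.g₀ g.g₀).comp (lid (unit 𝒦))) (zero_add 2) = g.g₁.comp D.δ₀ (zero_add 2)
  w_g₀ : g.g₀ C.w = 0

variable [GradedStronglyCommutative 𝒦]

theorem IsHom.id (C : CoalgData 𝒦) : (CoalgPair.id C).IsHom where
  map_δ₂ := by ext x; exact tmap_id _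
  map_ε := rfl
  map_w := rfl
  map_δ₁ := by
    ext x
    simp only [CoalgPair.id, GrHom.add_apply, GrHom.sub_apply, GrHom.comp_apply]
    rw [tmap_zero_left, tmap_zero_right, map_zero, map_zero, sub_zero, add_zero]
    rfl
  map_δ₀ := by
    ext x
    simp only [CoalgPair.id, GrHom.sub_apply, GrHom.comp_apply]
    rw [tmap_zero_left, map_zero, GrHom.zero_apply, sub_zero, sub_zero]
    rfl
  w_g₀ := rfl

theorem IsHom.comp {C D E : CoalgData 𝒦} {f : CoalgPair C D} {g : CoalgPair D E}
    (hf : f.IsHom) (hg : g.IsHom) : (f.comp g).IsHom where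
  map_δ₂ := by
    ext x
    have h1 := DFunLike.congr_fun hf.map_δ₂ x
    have h2 := DFunLike.congr_fun hg.map_δ₂ (f.g₁ x)
    simp only [CoalgPair.comp, GrHom.comp_apply] at h1 h2 ⊢
    rw [← h2, ← h1, tmap_tmap f.g₁ f.g₁ g.g₁ g.g₁ _ _ (add_zero 0) (add_zero 0) (by simp),
      zero_mul, sg_zero, one_smul]
  map_ε := by
    ext x
    have h1 := DFunLike.congr_fun hf.map_ε x
    have h2 := DFunLike.congr_fun hg.map_ε (f.g₁ x)
    simp only [CoalgPair.comp, GrHom.comp_apply] at h1 h2 ⊢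
    rw [h2, h1]
  map_w := by
    simp only [CoalgPair.comp, GrHom.comp_apply]
    rw [hf.map_w, hg.map_w]
  map_δ₁ := by
    ext x
    have hδ := DFunLike.congr_fun hf.map_δ₂ x
    have h1 := DFunLike.congr_fun hf.map_δ₁ x
    have h2 := DFunLike.congr_fun hg.map_δ₁ (f.g₁ x)
    simp only [CoalgPair.comp, GrHom.add_apply, GrHom.sub_apply, GrHom.comp_apply]
      at hδ h1 h2 ⊢
    rw [← h2, ← h1, ← hδ, map_add, map_sub, tmap_add_left, tmap_add_right, map_add, map_add,
      lid_natural, rid_natural,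
      tmap_tmap f.g₁ f.g₁ g.g₀ g.g₁ _ _ (zero_add 1) (add_zero 0) (by simp),
      tmap_tmap f.g₁ f.g₁ g.g₁ g.g₀ _ _ (add_zero 0) (zero_add 1) (by simp),
      tmap_tmap f.g₀ f.g₁ (.id _) g.g₁ _ _ (add_zero 1) (add_zero 0) (by simp),
      tmap_tmap f.g₁ f.g₀ g.g₁ (.id _) _ _ (add_zero 0) (add_zero 1) (by simp)]
    simp only [zero_mul, mul_zero, sg_zero, one_smul]
    have e1 : f.g₀.comp (.id (unit 𝒦)) (add_zero 1) = f.g₀ := rfl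
    rw [e1]
    abel
  map_δ₀ := by
    ext x
    have hδ := DFunLike.congr_fun hf.map_δ₂ x
    have h1 := DFunLike.congr_fun hf.map_δ₁ x
    have h0 := DFunLike.congr_fun hf.map_δ₀ x
    have h2 := DFunLike.congr_fun hg.map_δ₀ (f.g₁ x)
    simp only [CoalgPair.comp, GrHom.add_apply, GrHom.sub_apply, GrHom.comp_apply]
      at hδ h1 h0 h2 ⊢
    rw [← h2, ← h0, ← h1, ← hδ, map_add, map_sub, tmap_add_left, tmap_add_right, tmap_add_right,
      map_add, map_add, map_add, lid_natural, rid_natural,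
      tmap_tmap f.g₁ f.g₁ g.g₀ g.g₀ _ _ (zero_add 1) (zero_add 1) (by simp),
      tmap_tmap f.g₀ f.g₁ (.id _) g.g₀ _ _ (add_zero 1) (zero_add 1) (by simp),
      tmap_tmap f.g₁ f.g₀ g.g₀ (.id _) _ _ (zero_add 1) (add_zero 1) (by simp),
      ← lid_unit_eq_rid_unit]
    simp only [mul_zero, mul_one, sg_zero, sg_one, one_smul, neg_smul]
    have e1 : f.g₀.comp (.id (unit 𝒦)) (add_zero 1) = f.g₀ := rfl
    rw [e1, map_neg]
    abel
  w_g₀ := by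
    simp only [CoalgPair.comp, GrHom.add_apply, GrHom.comp_apply]
    rw [hf.w_g₀, hf.map_w, hg.w_g₀, add_zero]

end CoalgPair

end

/-- Morphisms of the category of curved augmented coalgebras. -/
@[ext] structure CaCoalg.Hom [GradedRing 𝒦] [GradedStronglyCommutative 𝒦] (C D : CaCoalg 𝒦) where
  /-- the underlying pair of maps -/
  pair : CoalgPair C.toCoalgData D.toCoalgData
  isHom : pair.IsHom

instance [GradedRing 𝒦] [GradedStronglyCommutative 𝒦] : Category (CaCoalg 𝒦) where
  Hom := CaCoalg.Hom
  id C := ⟨.id C.toCoalgData, .id _⟩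
  comp f g := ⟨f.pair.comp g.pair, f.isHom.comp g.isHom⟩
  id_comp f := by
    apply CaCoalg.Hom.ext
    apply CoalgPair.ext
    · rfl
    · ext x; exact zero_add _
  comp_id f := by
    apply CaCoalg.Hom.ext
    apply CoalgPair.ext
    · rfl
    · ext x; exact add_zero _
  assoc f g h := by
    apply CaCoalg.Hom.ext
    apply CoalgPair.ext
    · rfl
    · ext x; exact add_assoc _ _ _

/-! ### The bar construction -/

namespace AlgData

variable [GradedRing 𝒦] (A : AlgData 𝒦)

/-- The graded module `Ā = Ker v`. -/
def bar : GrMod 𝒦 := ker A.v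

/-- The projection `1 - v η : A → Ā`. -/
def proj : GrHom 0 A.X A.bar :=
  kerLift A.v (.id A.X - A.v.comp (ofElem A.one A.one_mem) (add_zero 0)) (fun x => by
    have h : A.v (ofElem A.one A.one_mem (A.v x)) = A.v x := by
      refine (map_smul A.v (show k from A.v x) A.one).trans ?_
      rw [A.v_one]
      exact GrMod.smul_one _
    rw [GrHom.sub_apply, map_sub, GrHom.comp_apply, h]
    exact sub_self _)

/-- The shifted module `A[1]`. -/
def sX : GrMod 𝒦 := A.X.shift 1

/-- The shifted module `Ā[1]`. -/
def sbar : GrMod 𝒦 := A.bar.shift 1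

/-- `σ : A → A[1]`, of degree `-1`. -/
def σ : GrHom (-1) A.X A.sX := A.X.toShift 1

/-- `σ⁻¹ : A[1] → A`, of degree `1`. -/
def σinv : GrHom 1 A.sX A.X := A.X.ofShift 1

/-- The inclusion `Ā[1] → A[1]`. -/
def sinc : GrHom 0 A.sbar A.sX := shiftMap 1 (kerInc A.v)

/-- The projection `A[1] → Ā[1]`. -/
def spr : GrHom 0 A.sX A.sbar := shiftMap 1 A.proj

/-- `b₀ = m₀ σ : k → A[1]`. -/
def b₀ : GrHom 1 (unit 𝒦) A.sX := (ofElem A.curv A.curv_mem).comp A.σ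

/-- `b₁ = -σ⁻¹ m₁ σ : A[1] → A[1]`, so that `m₁ = -σ b₁ σ⁻¹`. -/
def b₁ : GrHom 1 A.sX A.sX := -(A.σinv.comp (A.d.comp A.σ (n := 0)))

/-- `b₂ = -(σ⁻¹ ⊗ σ⁻¹) m₂ σ : A[1] ⊗ A[1] → A[1]`, so that `m₂ = (σ ⊗ σ) b₂ σ⁻¹`. -/
def b₂ : GrHom 1 (tensor A.sX A.sX) A.sX :=
  -((tmap A.σinv A.σinv (n := 2)).comp (A.mul.comp A.σ (n := -1)))

/-- The splitting `σ⁻¹ v : A[1] → k` of the unit. -/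
def sv : GrHom 1 A.sX (unit 𝒦) := A.σinv.comp A.v

/-- `b̄₀`, that is, `b₀` followed by the projection. -/
def bbar₀ : GrHom 1 (unit 𝒦) A.sbar := A.b₀.comp A.spr

/-- `b̄₁`, that is, `b₁` restricted to `Ā[1]` and followed by the projection. -/
def bbar₁ : GrHom 1 A.sbar A.sbar := A.sinc.comp (A.b₁.comp A.spr (n := 1))

/-- `b̄₂`, that is, `b₂` restricted to `Ā[1] ⊗ Ā[1]` and followed by the projection. -/
def bbar₂ : GrHom 1 (tensor A.sbar A.sbar) A.sbar :=
  (tmap A.sinc A.sinc (n := 0)).comp (A.b₂.comp A.spr (n := 1))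

variable [GradedStronglyCommutative 𝒦]

/-- The components on `Ā[1]^{⊗ n}` of the curvature of the bar construction, `-bₙ v`. -/
def barδ₀ : ∀ n, GrHom 2 (tpow A.sbar n) (unit 𝒦)
  | 0 => -(A.b₀.comp A.sv)
  | 1 => -((rid A.sbar).comp (A.sinc.comp (A.b₁.comp A.sv (n := 2)) (n := 2)))
  | 2 => -((tmap (.id A.sbar) (rid A.sbar) (n := 0)).comp
      ((tmap A.sinc A.sinc (n := 0)).comp (A.b₂.comp A.sv (n := 2)) (n := 2)))
  | _ + 3 => 0

/-- The bar construction `Bar A = (Ā[1]T^≥, Δ, b̄, -b̌ v, pr₀, inj₀)`. -/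
def barData : CoalgData 𝒦 where
  X := T A.sbar
  δ₂ := cut A.sbar
  δ₁ := coder A.bbar₀ A.bbar₁ A.bbar₂
  δ₀ := tdesc A.barδ₀
  ε := tpr0 A.sbar
  w := tone A.sbar
  w_mem := tone_mem
  ε_w := tpr0_tone

/-- The components on `Ā[1]^{⊗ n}` of the functional `Bar₀ f`: only the one for `n = 1`, which is
`f v_B`, is not zero. -/
def barMap₀ {A B : AlgData 𝒦} (f : GrHom 0 A.X B.X) : ∀ n, GrHom 1 (tpow A.sbar n) (unit 𝒦)
  | 0 => 0
  | 1 => (rid A.sbar).comp (A.sinc.comp ((shiftMap 1 f).comp B.sv (n := 1)) (n := 1))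
  | _ + 2 => 0

/-- The bar construction on morphisms: `f̄₁T^≥`, where `f̄₁ : Ā[1] → A[1] → B[1] → B̄[1]`, and the
functional `Bar₀ f`. -/
def barMap {A B : AlgData 𝒦} (f : GrHom 0 A.X B.X) : CoalgPair A.barData B.barData where
  g₁ := tMap (A.sinc.comp ((shiftMap 1 f).comp B.spr (n := 0)))
  g₀ := tdesc (barMap₀ f)

end AlgData

/-! ### The cobar construction -/

namespace CoalgData

variable [GradedRing 𝒦] [GradedStronglyCommutative 𝒦] (C : CoalgData 𝒦)

/-- The shifted module `C[-1]`. -/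
def sX : GrMod 𝒦 := C.X.shift (-1)

/-- The shifted module `C̄[-1]`. -/
def sbar : GrMod 𝒦 := C.bar.shift (-1)

/-- `σ : C[-1] → C`, of degree `-1`. -/
def σ : GrHom (-1) C.sX C.X := C.X.ofShift (-1)

/-- `σ⁻¹ : C → C[-1]`, of degree `1`. -/
def σinv : GrHom 1 C.X C.sX := C.X.toShift (-1)

/-- The inclusion `C̄[-1] → C[-1]`. -/
def sinc : GrHom 0 C.sbar C.sX := shiftMap (-1) C.inc

/-- The projection `C[-1] → C̄[-1]`. -/
def spr : GrHom 0 C.sX C.sbar := shiftMap (-1) C.pr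

/-- `ξ₀ = σ δ₀ : C[-1] → k`. -/
def ξ₀ : GrHom 1 C.sX (unit 𝒦) := C.σ.comp C.δ₀

/-- `ξ₁ = -σ δ₁ σ⁻¹ : C[-1] → C[-1]`, so that `δ₁ = -σ⁻¹ ξ₁ σ`. -/
def ξ₁ : GrHom 1 C.sX C.sX := -(C.σ.comp (C.δ₁.comp C.σinv (n := 2)))

/-- `ξ₂ = -σ δ₂ (σ⁻¹ ⊗ σ⁻¹) : C[-1] → C[-1] ⊗ C[-1]`, so that `δ₂ = σ⁻¹ ξ₂ (σ ⊗ σ)`. -/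
def ξ₂ : GrHom 1 C.sX (tensor C.sX C.sX) :=
  -(C.σ.comp (C.δ₂.comp (tmap C.σinv C.σinv (n := 2)) (n := 2)))

/-- The map `ξ̄ : C̄[-1] → C̄[-1]T^≥` with components `ξₙ` followed by the projection. -/
def ξbar : GrHom 1 C.sbar (T C.sbar) :=
  C.sinc.comp (C.ξ₀.comp (tinj C.sbar 0) (n := 1)) +
    C.sinc.comp (C.ξ₁.comp (C.spr.comp (tinj1 C.sbar) (n := 0)) (n := 1)) +
    C.sinc.comp (C.ξ₂.comp ((tmap C.spr C.spr (n := 0)).comp (tinj2 C.sbar) (n := 0)) (n := 1))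

/-- The element `1w σ⁻¹` of `C[-1]`, of degree `1`. -/
def sw : C.sX := C.σinv C.w

theorem sw_mem : C.sw ∈ C.sX.gr 1 := C.σinv.mem C.w_mem

/-- The curvature `-w ⊗ w - ∑ₙ w ξₙ` of the cobar construction. Its component in
`C̄[-1] ⊗ C̄[-1]` vanishes because of `w δ₂ = w ⊗ w`, and `w ξ₁` lies in `C̄[-1]` because of
`δ₁ ε = 0`. -/
def cobarCurv : T C.sbar := -(tinj C.sbar 0 (C.ξ₀ C.sw)) - tinj1 C.sbar (C.spr (C.ξ₁ C.sw))

theorem cobarCurv_mem : C.cobarCurv ∈ (T C.sbar).gr 2 :=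
  sub_mem (neg_mem ((tinj C.sbar 0).mem (C.ξ₀.mem C.sw_mem rfl)))
    ((tinj1 C.sbar).mem (C.spr.mem (C.ξ₁.mem C.sw_mem rfl) rfl))

/-- The cobar construction `Cobar C = (C̄[-1]T^≥, ξ̄, inj₀, pr₀)` with the multiplication of the
tensor algebra. -/
def cobarData : AlgData 𝒦 where
  X := T C.sbar
  mul := tMul C.sbar
  d := der C.ξbar
  curv := C.cobarCurv
  curv_mem := C.cobarCurv_mem
  one := tone C.sbar
  one_mem := tone_mem
  v := tpr0 C.sbar
  v_one := tpr0_tone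

/-- The cobar construction on morphisms: the homomorphism of algebras with components
`g₁ : C̄[-1] → D̄[-1]` and `g₀ : C̄[-1] → k`. -/
def cobarMap {C D : CoalgData 𝒦} (g : CoalgPair C D) : GrHom 0 C.cobarData.X D.cobarData.X :=
  GrMod.ext (C.sinc.comp ((shiftMap (-1) g.g₁).comp (D.spr.comp (tinj1 D.sbar) (n := 0)) (n := 0)) +
    C.sinc.comp (C.σ.comp (g.g₀.comp (tinj D.sbar 0) (n := 1)) (n := 0)))

end CoalgData

/-! ### The functors -/

section Functors

variable [GradedRing 𝒦] [GradedStronglyCommutative 𝒦]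

variable (𝒦) in
/-- The assertion that the bar construction is a functor from unit-complemented curved algebras
to curved augmented coalgebras. -/
structure BarIsFunctor : Prop where
  obj : ∀ A : UccAlg 𝒦, A.barData.IsCurvedAugmented
  map : ∀ {A B : UccAlg 𝒦} (f : A ⟶ B), (AlgData.barMap f.f).IsHom
  map_id : ∀ A : UccAlg 𝒦, AlgData.barMap (UccAlg.Hom.f (𝟙 A)) = CoalgPair.id A.barData
  map_comp : ∀ {A B C : UccAlg 𝒦} (f : A ⟶ B) (g : B ⟶ C),
    AlgData.barMap (UccAlg.Hom.f (f ≫ g)) = (AlgData.barMap f.f).comp (AlgData.barMap g.f)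

variable (𝒦) in
/-- The assertion that the cobar construction is a functor from curved augmented coalgebras to
unit-complemented curved algebras. -/
structure CobarIsFunctor : Prop where
  obj : ∀ C : CaCoalg 𝒦, C.cobarData.IsCurved
  map : ∀ {C D : CaCoalg 𝒦} (g : C ⟶ D), IsAlgHom (CoalgData.cobarMap g.pair)
  map_id : ∀ C : CaCoalg 𝒦, CoalgData.cobarMap (CaCoalg.Hom.pair (𝟙 C)) = .id C.cobarData.X
  map_comp : ∀ {C D E : CaCoalg 𝒦} (f : C ⟶ D) (g : D ⟶ E),
    CoalgData.cobarMap (CaCoalg.Hom.pair (f ≫ g)) =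
      (CoalgData.cobarMap f.pair).comp (CoalgData.cobarMap g.pair) (add_zero 0)

/-- The functor `Bar`. -/
def barFunctor (h : BarIsFunctor 𝒦) : UccAlg 𝒦 ⥤ CaCoalg 𝒦 where
  obj A := ⟨A.barData, h.obj A⟩
  map f := ⟨AlgData.barMap f.f, h.map f⟩
  map_id A := CaCoalg.Hom.ext (h.map_id A)
  map_comp f g := CaCoalg.Hom.ext (h.map_comp f g)

/-- The functor `Cobar`. -/
def cobarFunctor (h : CobarIsFunctor 𝒦) : CaCoalg 𝒦 ⥤ UccAlg 𝒦 where
  obj C := ⟨C.cobarData, h.obj C⟩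
  map g := ⟨CoalgData.cobarMap g.pair, h.map g⟩
  map_id C := UccAlg.Hom.ext (h.map_id C)
  map_comp f g := UccAlg.Hom.ext (h.map_comp f g)

variable (𝒦) in
/-- Unit-complemented dg-algebras: the curvature `m₀` is zero. -/
def isDg : ObjectProperty (UccAlg 𝒦) := fun A => A.curv = 0

variable (𝒦) in
/-- Augmented curved coalgebras: `w δ₁ = 0` and `w δ₀ = 0`. -/
def isAugmented : ObjectProperty (CaCoalg 𝒦) := fun C => C.δ₁ C.w = 0 ∧ C.δ₀ C.w = 0

variable (𝒦) in
/-- The category of unit-complemented dg-algebras, a full subcategory of `UccAlg`. -/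
abbrev UcdgAlg := (isDg 𝒦).FullSubcategory

variable (𝒦) in
/-- The category of augmented curved coalgebras, a full subcategory of `CaCoalg`. -/
abbrev AcCoalg := (isAugmented 𝒦).FullSubcategory

/-- The restricted functor `Bar`. -/
def barRestr (h : BarIsFunctor 𝒦) (h' : ∀ A, isDg 𝒦 A → isAugmented 𝒦 ((barFunctor h).obj A)) :
    UcdgAlg 𝒦 ⥤ AcCoalg 𝒦 :=
  (isAugmented 𝒦).lift ((isDg 𝒦).ι ⋙ barFunctor h) (fun A => h' A.obj A.property)

/-- The restricted functor `Cobar`. -/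
def cobarRestr (h : CobarIsFunctor 𝒦)
    (h' : ∀ C, isAugmented 𝒦 C → isDg 𝒦 ((cobarFunctor h).obj C)) : AcCoalg 𝒦 ⥤ UcdgAlg 𝒦 :=
  (isDg 𝒦).lift ((isAugmented 𝒦).ι ⋙ cobarFunctor h) (fun C => h' C.obj C.property)

end Functors

end Curved

end

/-!
Both `Hom(Cobar C, A)` and `Hom(C, Bar A)` are identified with one set: the *twisting cochains*
`θ : C → A`, that is, the maps of degree `1` with `w θ = 0` that satisfy the Maurer-Cartan equation
`θ m₁ + δ₁ θ + δ₂ (θ ⊗ θ) m₂ = δ₀ η + ε m₀` (`IsTwisting`). Homomorphisms of curved algebras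
`A → B` push twisting cochains forward (`IsTwisting.comp_algHom`), and a morphism `(g₁, g₀) : C → D`
pulls them back by `θ ↦ g₁ θ + g₀ η` (`IsTwisting.pull`).

*Universal cochains.* The projection `Bar A → Ā[1] → A` and the map `C → C̄[-1] → Cobar C` satisfy
the Maurer-Cartan equation (`AlgData.isTwisting_barTwist`, `CoalgData.isTwisting_cobarTwist`):
this equation is a rewriting of the definitions of `δ₁`, `δ₀` on `Bar A` and of `m₁`, `m₀` on
`Cobar C`, and it presupposes at most that the source is a coalgebra with a coderivation and the
target an algebra with a derivation.

*Axioms.* Applying `m₁` and `δ₁` to the Maurer-Cartan equation and multiplying it by `θ` gives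
the Bianchi identity (`IsTwisting.bianchi`): the curvature axioms of the coalgebra, seen through
`θ`, fail exactly as much as those of the algebra do. For the universal cochain of `A` the side of
the algebra vanishes, and composition with `v` and with the projection to `Ā` separates the axiom
`δ₁ δ₀ = 0` from the axiom on `δ₁²`; the latter is an equality of coderivations, which are
determined by their component in `Ā[1]` (`IsCoderivation.eq_zero`). For the universal cochain of
`C` the side of the coalgebra vanishes; the value at `w` gives `m₀ m₁ = 0`, and the axiom on `m₁²`
is an equality of derivations, which are determined on generators
(`CoalgData.eq_of_derivation_cobar`).

*Universal properties.* In the same way, the failure of a pair `(g₁, g₀)` to be a morphism is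
measured by the failure of the cochain pulled back along it to be twisting
(`IsTwisting.pull_defect`). Hence a coalgebra homomorphism to `Bar A` with a functional is a
morphism once the pulled back universal cochain is twisting
(`CoalgPair.isHom_of_isTwisting_pull`), and the algebra homomorphism `Cobar C → A` extending a
twisting cochain is compatible with `m₁` and `m₀` (`CoalgData.cobarLift_isAlgHom`). The underlying
homomorphisms exist and are unique because the tensor algebra is free and the tensor coalgebra is
cofree among conilpotent coalgebras (`lift`, `cofree`, `eq_of_tpr1_comp`).

Functoriality of `Bar` and `Cobar` follows from uniqueness, as `Bar f` and `Cobar g` induce the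
cochains `τ f` and `g₁ ι + g₀ η`. The bijections with twisting cochains are natural, so `Cobar` is
left adjoint to `Bar` on all curved objects (`cobarBarAdjunction`), and the adjunction restricts
to the full subcategories.
-/

noncomputable section

set_option linter.unusedSectionVars false

namespace Curved

universe u

variable {k : Type u} [Ring k] {𝒦 : ℤ → AddSubgroup k}

open GrMod CategoryTheory

/-! ### Groups of homogeneous maps and tensor products of maps -/

namespace GrHom

variable {M N P Q : GrMod 𝒦} {d e n : ℤ}

instance : AddCommGroup (GrHom d M N) where
  add_assoc f g h := by ext x; exact add_assoc _ _ _
  zero_add f := by ext x; exact zero_add _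
  add_zero f := by ext x; exact add_zero _
  add_comm f g := by ext x; exact add_comm _ _
  neg_add_cancel f := by ext x; exact neg_add_cancel _
  sub_eq_add_neg f g := by ext x; exact sub_eq_add_neg _ _
  nsmul := nsmulRec
  zsmul := zsmulRec

@[simp] theorem zsmul_apply (m : ℤ) (f : GrHom d M N) (x : M) : (m • f) x = m • f x :=
  map_zsmul (AddMonoidHom.mk' (fun f : GrHom d M N => f x) (fun _ _ => rfl)) m f

theorem comp_add (f : GrHom d M N) (g g' : GrHom e N P) (h : d + e = n) :
    f.comp (g + g') h = f.comp g h + f.comp g' h := rfl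

theorem add_comp (f f' : GrHom d M N) (g : GrHom e N P) (h : d + e = n) :
    (f + f').comp g h = f.comp g h + f'.comp g h := by ext x; exact map_add g _ _

theorem sub_comp (f f' : GrHom d M N) (g : GrHom e N P) (h : d + e = n) :
    (f - f').comp g h = f.comp g h - f'.comp g h := by ext x; exact map_sub g _ _

theorem zero_comp (g : GrHom e N P) (h : d + e = n) :
    (0 : GrHom d M N).comp g h = 0 := by ext x; exact map_zero g

theorem comp_zero (f : GrHom d M N) (h : d + e = n) :
    f.comp (0 : GrHom e N P) h = 0 := rfl

theorem comp_assoc {d₁ d₂ d₃ d₁₂ d₂₃ : ℤ} (f : GrHom d₁ M N) (g : GrHom d₂ N P)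
    (p : GrHom d₃ P Q) (h₁ : d₁ + d₂ = d₁₂) (h₂ : d₁₂ + d₃ = n) (h₃ : d₂ + d₃ = d₂₃) :
    (f.comp g h₁).comp p h₂ = f.comp (g.comp p h₃) (by lia) := rfl

end GrHom

namespace GrMod

variable [GradedRing 𝒦] {M M' M'' N N' N'' P P' Q : GrMod 𝒦} {d e c n m l : ℤ}

/-- There is no Koszul sign if the first factor has degree `0`. -/
theorem tmap_tmul_zero (f : GrHom 0 M M') (g : GrHom e N N') (h : 0 + e = n) (x : M) (y : N) :
    tmap f g h (tmul x y) = tmul (f x) (g y) := by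
  induction y using N.induction with
  | h j y hy => rw [tmap_tmul f g h x hy, zero_mul, sg_zero, one_smul]
  | hadd y y' hy hy' => rw [map_add, map_add, hy, hy', map_add, map_add]

/-- Composites of tensor products involve no sign if the first factors have degree `0`. -/
theorem tmap_comp_zero (f : GrHom 0 M M') (g : GrHom d N N') (f' : GrHom 0 M' M'')
    (g' : GrHom e N' N'') (h : 0 + d = n) (h' : 0 + e = m) (hl : d + e = l) (z : tensor M N) :
    tmap f' g' h' (tmap f g h z) = tmap (f.comp f' (add_zero 0)) (g.comp g' hl) (zero_add l) z := by
  induction z using tensor_induction with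
  | h i j x y hx hy => rw [tmap_tmul_zero, tmap_tmul_zero, tmap_tmul_zero]; rfl
  | hadd x y hx hy => simp only [map_add, hx, hy]

theorem tmap_precomp (u : GrHom 0 M M') (v : GrHom 0 N N') (f : GrHom d M' M'')
    (g : GrHom e N' N'') (h : d + e = n) (z : tensor M N) :
    tmap f g h (tmap u v (add_zero 0) z) =
      tmap (u.comp f (zero_add d)) (v.comp g (zero_add e)) h z := by
  rw [tmap_tmap u v f g _ _ (zero_add d) (zero_add e) (by lia), zero_mul, sg_zero, one_smul]
  subst h
  rfl

theorem tmap_postcomp (f : GrHom d M M') (g : GrHom e N N') (u : GrHom 0 M' M'')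
    (v : GrHom 0 N' N'') (h : d + e = n) (z : tensor M N) :
    tmap u v (add_zero 0) (tmap f g h z) =
      tmap (f.comp u (add_zero d)) (g.comp v (add_zero e)) h z := by
  rw [tmap_tmap f g u v _ _ (add_zero d) (add_zero e) (by lia), mul_zero, sg_zero, one_smul]
  subst h
  rfl

theorem tmap_sub_left (f f' : GrHom d M M') (g : GrHom e N N') (h : d + e = n) (z : tensor M N) :
    tmap (f - f') g h z = tmap f g h z - tmap f' g h z := by
  rw [eq_sub_iff_add_eq, ← tmap_add_left, sub_add_cancel]

theorem tmap_sub_right (f : GrHom d M M') (g g' : GrHom e N N') (h : d + e = n) (z : tensor M N) :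
    tmap f (g - g') h z = tmap f g h z - tmap f g' h z := by
  rw [eq_sub_iff_add_eq, ← tmap_add_right, sub_add_cancel]

theorem assoc_natural (f : GrHom d M M') (g : GrHom e N N') (p : GrHom c P P')
    (h₁ : d + e = m) (h₂ : m + c = n) (h₃ : e + c = l) (z : tensor (tensor M N) P) :
    assoc M' N' P' (tmap (tmap f g h₁) p h₂ z) =
      tmap f (tmap g p h₃) (by lia : d + l = n) (assoc M N P z) := by
  induction z using tensor_induction with
  | h i j w z hw hz =>
    clear hw
    induction w using tensor_induction with
    | h i' j' x y hx hy =>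
      rw [tmap_tmul _ p h₂ _ hz, tmap_tmul f g h₁ x hy, assoc_tmul, tmap_tmul f _ _ x
        (tmul_mem hy hz rfl), tmap_tmul g p h₃ y hz]
      simp only [map_zsmul, AddMonoidHom.smul_apply, assoc_tmul, smul_smul, ← sg_add]
      congr 1
      exact sg_eq ⟨0, by subst h₁; ring⟩
    | hadd x y hx hy => simp only [map_add, AddMonoidHom.add_apply, hx, hy]
  | hadd x y hx hy => simp only [map_add, hx, hy]

theorem assoc_assocInv (z : tensor M (tensor N P)) : assoc M N P (assocInv M N P z) = z := by
  induction z using tensor_induction with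
  | h i j x w hx hw =>
    clear hw
    induction w using tensor_induction with
    | h i' j' y z hy hz => rfl
    | hadd x y hx hy => simp only [map_add, hx, hy]
  | hadd x y hx hy => simp only [map_add, hx, hy]

theorem assocInv_assoc (z : tensor (tensor M N) P) : assocInv M N P (assoc M N P z) = z := by
  induction z using tensor_induction with
  | h i j w z hw hz =>
    clear hw
    induction w using tensor_induction with
    | h i' j' x y hx hy => rfl
    | hadd x y hx hy => simp only [map_add, AddMonoidHom.add_apply, hx, hy]
  | hadd x y hx hy => simp only [map_add, hx, hy]

theorem assocInv_natural (f : GrHom d M M') (g : GrHom e N N') (p : GrHom c P P')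
    (h₁ : d + e = m) (h₂ : m + c = n) (h₃ : e + c = l) (h₄ : d + l = n)
    (z : tensor M (tensor N P)) :
    assocInv M' N' P' (tmap f (tmap g p h₃) h₄ z) =
      tmap (tmap f g h₁) p h₂ (assocInv M N P z) := by
  rw [← assocInv_assoc (tmap (tmap f g h₁) p h₂ _), assoc_natural f g p h₁ h₂ h₃,
    assoc_assocInv]

section Unit

theorem lid_lidInv [GradedStronglyCommutative 𝒦] (x : M) : lid M (lidInv M x) = x := by
  rw [lidInv_apply]
  exact one_smul k x

theorem rid_ridInv [GradedStronglyCommutative 𝒦] (x : M) : rid M (ridInv M x) = x := by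
  rw [ridInv_apply]
  induction x using M.induction with
  | h i x hx =>
    refine (rid_tmul hx (SetLike.one_mem_graded 𝒦)).trans ?_
    rw [zero_mul, sg_zero, one_smul, one_smul]
  | hadd x y hx hy => rw [map_add, AddMonoidHom.add_apply, map_add, hx, hy]

theorem lidInv_lid [GradedStronglyCommutative 𝒦] (z : tensor (unit 𝒦) M) :
    lidInv M (lid M z) = z := by
  induction z using tensor_induction with
  | h i j a x ha hx =>
    refine (congrArg (lidInv M) (lid_tmul (show k from a) x)).trans ?_
    rw [map_smul, lidInv_apply, ← tmul_smul_left, smul_one]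
  | hadd x y hx hy => rw [map_add, map_add, hx, hy]

theorem ridInv_rid [GradedStronglyCommutative 𝒦] (z : tensor M (unit 𝒦)) :
    ridInv M (rid M z) = z := by
  induction z using tensor_induction with
  | h i j x a hx ha =>
    refine (congrArg (ridInv M) (rid_tmul hx ha)).trans ?_
    have h := tmul_smul_right (M := M) (N := unit 𝒦) (one 𝒦) (a := (show k from a)) ha hx
    rw [smul_one] at h
    refine (map_zsmul (ridInv M) _ _).trans ?_
    refine (congrArg (sg (j * i) • ·) (map_smul (ridInv M) (show k from a) x)).trans ?_
    exact h.symm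
  | hadd x y hx hy => rw [map_add, map_add, hx, hy]

theorem unit_hom_ext {f g : GrHom d (unit 𝒦) M} (h : f (one 𝒦) = g (one 𝒦)) : f = g := by
  ext a
  have e : (show k from a) • one 𝒦 = a := smul_one (𝒦 := 𝒦) (show k from a)
  rw [← e, map_smul, map_smul, h]

/-- The triangle identity `(x ⊗ a) ⊗ y ↦ x a ⊗ y = x ⊗ a y`. -/
theorem tmap_lid_assoc [GradedStronglyCommutative 𝒦] (z : tensor (tensor M (unit 𝒦)) N) :
    tmap (.id M) (lid N) (add_zero 0) (assoc _ _ _ z) = tmap (rid M) (.id N) (add_zero 0) z := by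
  induction z using tensor_induction with
  | h i j w y hw hy =>
    obtain ⟨x, rfl⟩ : ∃ x, ridInv M x = w := ⟨_, ridInv_rid w⟩
    rw [tmap_tmul_zero, rid_ridInv, ridInv_apply, assoc_tmul, tmap_tmul_zero]
    exact congrArg (tmul x) (one_smul k y)
  | hadd x y hx hy => simp only [map_add, hx, hy]

/-- `(a ⊗ x) ⊗ y ↦ a x ⊗ y` and `(a ⊗ x) ⊗ y ↦ a (x ⊗ y)` agree. -/
theorem lid_assoc [GradedStronglyCommutative 𝒦] (z : tensor (tensor (unit 𝒦) M) N) :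
    lid _ (assoc _ _ _ z) = tmap (lid M) (.id N) (add_zero 0) z := by
  induction z using tensor_induction with
  | h i j w y hw hy =>
    clear hw
    induction w using tensor_induction with
    | h i' j' a x ha hx => rw [assoc_tmul, tmap_tmul_zero]; rfl
    | hadd x y hx hy => simp only [map_add, AddMonoidHom.add_apply, hx, hy]
  | hadd x y hx hy => simp only [map_add, hx, hy]

/-- `(x ⊗ y) ⊗ a ↦ x ⊗ y a` and `(x ⊗ y) ⊗ a ↦ (x ⊗ y) a` agree. -/
theorem rid_assoc [GradedStronglyCommutative 𝒦] (z : tensor (tensor M N) (unit 𝒦)) :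
    tmap (.id M) (rid N) (add_zero 0) (assoc _ _ _ z) = rid _ z := by
  obtain ⟨w, rfl⟩ : ∃ w, ridInv _ w = z := ⟨_, ridInv_rid z⟩
  rw [rid_ridInv, ridInv_apply]
  induction w using tensor_induction with
  | h i' j' x y hx hy =>
    rw [assoc_tmul, tmap_tmul_zero, ← ridInv_apply, rid_ridInv]
    rfl
  | hadd x y hx hy => simp only [map_add, AddMonoidHom.add_apply, hx, hy]

end Unit

end GrMod

/-! ### Convolution and twisting cochains -/

section Convolution

variable [GradedRing 𝒦]

/-- The part of the axioms of a curved algebra that does not involve the curvature: a unital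
associative algebra with a derivation. -/
structure AlgData.IsDifferential (A : AlgData 𝒦) : Prop where
  mul_assoc : ∀ x y z, A.mul (tmul (A.mul (tmul x y)) z) = A.mul (tmul x (A.mul (tmul y z)))
  one_mul : ∀ x, A.mul (tmul A.one x) = x
  mul_one : ∀ x, A.mul (tmul x A.one) = x
  leibniz : A.mul.comp A.d (zero_add 1) =
    (tmap (.id A.X) A.d + tmap A.d (.id A.X)).comp A.mul (add_zero 1)
  d_one : A.d A.one = 0

theorem AlgData.IsCurved.isDifferential {A : AlgData 𝒦} (h : A.IsCurved) : A.IsDifferential :=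
  ⟨h.mul_assoc, h.one_mul, h.mul_one, h.leibniz, h.d_one⟩

/-- The part of the axioms of a curved augmented coalgebra that involves neither the curvature nor
conilpotency: a coaugmented coassociative coalgebra with a coderivation. -/
structure CoalgData.IsDifferential [GradedStronglyCommutative 𝒦] (C : CoalgData 𝒦) : Prop where
  coassoc : C.δ₂.comp (tmap (.id C.X) C.δ₂) (add_zero 0) =
    C.δ₂.comp ((tmap C.δ₂ (.id C.X)).comp (assoc _ _ _)) (add_zero 0)
  counit_right : C.δ₂.comp ((tmap (.id C.X) C.ε).comp (rid C.X)) (add_zero 0) = .id C.X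
  counit_left : C.δ₂.comp ((tmap C.ε (.id C.X)).comp (lid C.X)) (add_zero 0) = .id C.X
  coleibniz : C.δ₁.comp C.δ₂ (add_zero 1) =
    C.δ₂.comp (tmap (.id C.X) C.δ₁ + tmap C.δ₁ (.id C.X)) (zero_add 1)
  δ₁_ε : ∀ x, C.ε (C.δ₁ x) = 0
  w_δ₂ : C.δ₂ C.w = tmul C.w C.w

theorem CoalgData.IsCurvedAugmented.isDifferential [GradedStronglyCommutative 𝒦] {C : CoalgData 𝒦}
    (h : C.IsCurvedAugmented) : C.IsDifferential :=
  ⟨h.coassoc, h.counit_right, h.counit_left, h.coleibniz, h.δ₁_ε, h.w_δ₂⟩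

/-- The unit `η : k → A`. -/
def AlgData.η (A : AlgData 𝒦) : GrHom 0 (unit 𝒦) A.X := ofElem A.one A.one_mem

/-- The curvature `m₀ : k → A`. -/
def AlgData.m₀ (A : AlgData 𝒦) : GrHom 2 (unit 𝒦) A.X := ofElem A.curv A.curv_mem

variable {C C' : CoalgData 𝒦} {A B : AlgData 𝒦} {a c d e l m n : ℤ}

/-- The convolution product `δ₂ (f ⊗ g) m₂` of maps from a coalgebra to an algebra. -/
def conv (f : GrHom d C.X A.X) (g : GrHom e C.X A.X) (h : d + e = n := by first | rfl | lia) :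
    GrHom n C.X A.X :=
  C.δ₂.comp ((tmap f g h).comp A.mul (add_zero n)) (zero_add n)

theorem conv_apply (f : GrHom d C.X A.X) (g : GrHom e C.X A.X) (h : d + e = n) (x : C.X) :
    conv f g h x = A.mul (tmap f g h (C.δ₂ x)) := rfl

theorem conv_add_left (f f' : GrHom d C.X A.X) (g : GrHom e C.X A.X) (h : d + e = n) :
    conv (f + f') g h = conv f g h + conv f' g h := by
  ext x; simp only [conv_apply, GrHom.add_apply, tmap_add_left, map_add]

theorem conv_add_right (f : GrHom d C.X A.X) (g g' : GrHom e C.X A.X) (h : d + e = n) :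
    conv f (g + g') h = conv f g h + conv f g' h := by
  ext x; simp only [conv_apply, GrHom.add_apply, tmap_add_right, map_add]

theorem conv_apply_w (hC : C.δ₂ C.w = tmul C.w C.w) (f : GrHom d C.X A.X) (g : GrHom e C.X A.X)
    (h : d + e = n) : conv f g h C.w = A.mul (tmul (f C.w) (g C.w)) := by
  rw [conv_apply, hC, tmap_tmul f g h C.w C.w_mem, mul_zero, sg_zero, one_smul]

theorem conv_assoc [GradedStronglyCommutative 𝒦] (hA : A.IsDifferential) (hC : C.IsDifferential)
    (f : GrHom d C.X A.X) (g : GrHom e C.X A.X) (p : GrHom c C.X A.X)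
    (h₁ : d + e = m) (h₂ : m + c = n) (h₃ : e + c = l) (h₄ : d + l = n) :
    conv (conv f g h₁) p h₂ = conv f (conv g p h₃) h₄ := by
  have hm : ∀ z, A.mul (tmap A.mul (.id A.X) (add_zero 0) z) =
      A.mul (tmap (.id A.X) A.mul (add_zero 0) (assoc _ _ _ z)) := by
    intro z
    induction z using tensor_induction with
    | h i j w z hw hz =>
      clear hw
      induction w using tensor_induction with
      | h i' j' x y hx hy =>
        rw [tmap_tmul_zero, assoc_tmul, tmap_tmul_zero]; exact hA.mul_assoc x y z
      | hadd x y hx hy => simp only [map_add, AddMonoidHom.add_apply, hx, hy]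
    | hadd x y hx hy => simp only [map_add, hx, hy]
  ext x
  have hx : tmap (.id C.X) C.δ₂ (add_zero 0) (C.δ₂ x) =
    assoc _ _ _ (tmap C.δ₂ (.id C.X) (add_zero 0) (C.δ₂ x)) := DFunLike.congr_fun hC.coassoc x
  have e₁ : tmap (conv f g h₁) p h₂ (C.δ₂ x) = tmap A.mul (.id A.X) (add_zero 0)
      (tmap (tmap f g h₁) p h₂ (tmap C.δ₂ (.id C.X) (add_zero 0) (C.δ₂ x))) := by
    rw [tmap_precomp, tmap_postcomp]
    rfl
  have e₂ : tmap f (conv g p h₃) h₄ (C.δ₂ x) = tmap (.id A.X) A.mul (add_zero 0)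
      (tmap f (tmap g p h₃) h₄ (tmap (.id C.X) C.δ₂ (add_zero 0) (C.δ₂ x))) := by
    rw [tmap_precomp, tmap_postcomp]
    rfl
  rw [conv_apply, conv_apply, e₁, e₂, hm, hx, assoc_natural f g p h₁ h₂ h₃]

/-- The derivation of the algebra is a derivation of the convolution product. -/
theorem conv_comp_d (hA : A.IsDifferential) (f : GrHom d C.X A.X) (g : GrHom e C.X A.X)
    (h : d + e = n) (hn : n + 1 = m) (hd : d + 1 = c) (he : e + 1 = l) :
    (conv f g h).comp A.d hn =
      conv f (g.comp A.d he) (by lia) + sg e • conv (f.comp A.d hd) g (by lia) := by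
  ext x
  have hl := DFunLike.congr_fun hA.leibniz (tmap f g h (C.δ₂ x))
  simp only [GrHom.comp_apply, GrHom.add_apply, GrHom.zsmul_apply, conv_apply] at hl ⊢
  rw [hl, tmap_tmap f g (.id A.X) A.d _ _ (add_zero d) he (by lia : d + l = n + 1),
    tmap_tmap f g A.d (.id A.X) _ _ hd (add_zero e) (by lia : c + e = n + 1)]
  simp only [mul_zero, mul_one, sg_zero, one_smul, map_add, map_zsmul]
  subst hn
  rfl

/-- The coderivation of the coalgebra induces a derivation of the convolution product. -/
theorem comp_conv_of_coderivation [GradedStronglyCommutative 𝒦] (hC : C.IsDifferential)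
    (f : GrHom d C.X A.X) (g : GrHom e C.X A.X)
    (h : d + e = n) (hn : 1 + n = m) (hd : 1 + d = c) (he : 1 + e = l) :
    C.δ₁.comp (conv f g h) hn =
      sg d • conv f (C.δ₁.comp g he) (by lia) + conv (C.δ₁.comp f hd) g (by lia) := by
  ext x
  have hl := DFunLike.congr_fun hC.coleibniz x
  simp only [GrHom.comp_apply, GrHom.add_apply, GrHom.zsmul_apply, conv_apply] at hl ⊢
  rw [hl, map_add, tmap_tmap (.id C.X) C.δ₁ f g _ _ (zero_add d) he (by lia : d + l = 1 + n),
    tmap_tmap C.δ₁ (.id C.X) f g _ _ hd (zero_add e) (by lia : c + e = 1 + n)]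
  simp only [zero_mul, one_mul, sg_zero, one_smul, map_add, map_zsmul]
  subst hn
  rfl

/-! ### The action of functionals on maps -/

/-- The action `δ₂ (a ⊗ f)` of a functional `a : C → k` on a map `f : C → M` from the left. -/
def lact [GradedStronglyCommutative 𝒦] {M : GrMod 𝒦} (a : GrHom d C.X (unit 𝒦)) (f : GrHom e C.X M)
    (h : d + e = n := by first | rfl | lia) : GrHom n C.X M :=
  C.δ₂.comp ((tmap a f h).comp (lid M) (add_zero n)) (zero_add n)

/-- The action `δ₂ (f ⊗ a)` of a functional `a : C → k` on a map `f : C → M` from the right. -/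
def ract [GradedStronglyCommutative 𝒦] {M : GrMod 𝒦} (f : GrHom e C.X M) (a : GrHom d C.X (unit 𝒦))
    (h : e + d = n := by first | rfl | lia) : GrHom n C.X M :=
  C.δ₂.comp ((tmap f a h).comp (rid M) (add_zero n)) (zero_add n)

section Action

variable [GradedStronglyCommutative 𝒦] {M N : GrMod 𝒦}

theorem lact_apply (a : GrHom d C.X (unit 𝒦)) (f : GrHom e C.X M) (h : d + e = n) (x : C.X) :
    lact a f h x = lid M (tmap a f h (C.δ₂ x)) := rfl

theorem ract_apply (f : GrHom e C.X M) (a : GrHom d C.X (unit 𝒦)) (h : e + d = n) (x : C.X) :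
    ract f a h x = rid M (tmap f a h (C.δ₂ x)) := rfl

theorem lact_comp (a : GrHom d C.X (unit 𝒦)) (f : GrHom e C.X M) (p : GrHom c M N)
    (h : d + e = n) (hn : n + c = m) (he : e + c = l) :
    (lact a f h).comp p hn = lact a (f.comp p he) (by lia) := by
  ext x
  rw [GrHom.comp_apply, lact_apply, lact_apply, lid_natural,
    tmap_tmap a f (.id _) p _ _ (add_zero d) he (by lia : d + l = n + c), mul_zero, sg_zero,
    one_smul]
  subst hn
  rfl

theorem ract_comp (f : GrHom e C.X M) (a : GrHom d C.X (unit 𝒦)) (p : GrHom c M N)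
    (h : e + d = n) (hn : n + c = m) (he : e + c = l) :
    (ract f a h).comp p hn = sg (d * c) • ract (f.comp p he) a (by lia) := by
  ext x
  rw [GrHom.comp_apply, GrHom.zsmul_apply, ract_apply, ract_apply, rid_natural,
    tmap_tmap f a p (.id _) _ _ he (add_zero d) (by lia : l + d = n + c), map_zsmul]
  subst hn
  rfl

theorem lact_eq_conv (hA : A.IsDifferential) (a : GrHom d C.X (unit 𝒦)) (f : GrHom e C.X A.X)
    (h : d + e = n) : lact a f h = conv (a.comp A.η (add_zero d)) f h := by
  have key : ∀ z, A.mul (tmap A.η (.id A.X) (add_zero 0) z) = lid A.X z := by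
    intro z
    obtain ⟨x, rfl⟩ : ∃ x, lidInv A.X x = z := ⟨_, lidInv_lid z⟩
    rw [lid_lidInv, lidInv_apply, tmap_tmul_zero]
    refine Eq.trans ?_ (hA.one_mul x)
    exact congrArg (fun y => A.mul (tmul y x)) (one_smul k A.one)
  ext x
  rw [lact_apply, conv_apply, ← key, tmap_postcomp]
  rfl

theorem ract_eq_conv (hA : A.IsDifferential) (f : GrHom e C.X A.X) (a : GrHom d C.X (unit 𝒦))
    (h : e + d = n) : ract f a h = conv f (a.comp A.η (add_zero d)) h := by
  have key : ∀ z, A.mul (tmap (.id A.X) A.η (add_zero 0) z) = rid A.X z := by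
    intro z
    obtain ⟨x, rfl⟩ : ∃ x, ridInv A.X x = z := ⟨_, ridInv_rid z⟩
    rw [rid_ridInv, ridInv_apply, tmap_tmul_zero]
    refine Eq.trans ?_ (hA.mul_one x)
    exact congrArg (fun y => A.mul (tmul x y)) (one_smul k A.one)
  ext x
  rw [ract_apply, conv_apply, ← key, tmap_postcomp]
  rfl

theorem lact_ε (hC : C.IsDifferential) (f : GrHom e C.X M) : lact C.ε f (zero_add e) = f := by
  ext x
  have h := congrArg f (DFunLike.congr_fun hC.counit_left x)
  simp only [GrHom.comp_apply, lid_natural] at h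
  rw [tmap_comp_zero _ _ _ _ _ _ (zero_add e)] at h
  exact h

theorem ract_ε (hC : C.IsDifferential) (f : GrHom e C.X M) : ract f C.ε (add_zero e) = f := by
  ext x
  have h := congrArg f (DFunLike.congr_fun hC.counit_right x)
  simp only [GrHom.comp_apply, rid_natural] at h
  rw [tmap_precomp] at h
  exact h

theorem conv_ε_m₀ (hC : C.IsDifferential) (f : GrHom e C.X A.X) (h : 2 + e = n) (x : C.X) :
    conv (C.ε.comp A.m₀ (zero_add 2)) f h x = A.mul (tmul A.curv (f x)) := by
  have key : ∀ z : tensor (unit 𝒦) C.X, tmap A.m₀ f h z = tmul A.curv (f (lid _ z)) := by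
    intro z
    obtain ⟨y, rfl⟩ : ∃ y, lidInv C.X y = z := ⟨_, lidInv_lid z⟩
    rw [lid_lidInv, lidInv_apply]
    induction y using C.X.induction with
    | h j y hy =>
      rw [tmap_tmul _ f h _ hy, sg_eq (n := 0) ⟨j, by ring⟩, sg_zero, one_smul]
      exact congrArg (fun z => tmul z (f y)) (one_smul k A.curv)
    | hadd x y hx hy => simp only [map_add, hx, hy]
  have hx := DFunLike.congr_fun hC.counit_left x
  simp only [GrHom.comp_apply] at hx
  have e₁ : tmap (C.ε.comp A.m₀ (zero_add 2)) f h (C.δ₂ x) =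
      tmap A.m₀ f h (tmap C.ε (.id C.X) (add_zero 0) (C.δ₂ x)) := by
    rw [tmap_precomp]; rfl
  rw [conv_apply, e₁, key, hx]
  rfl

theorem conv_m₀_ε (hC : C.IsDifferential) (f : GrHom e C.X A.X) (h : e + 2 = n) (x : C.X) :
    conv f (C.ε.comp A.m₀ (zero_add 2)) h x = A.mul (tmul (f x) A.curv) := by
  have key : ∀ z : tensor C.X (unit 𝒦), tmap f A.m₀ h z = tmul (f (rid _ z)) A.curv := by
    intro z
    obtain ⟨y, rfl⟩ : ∃ y, ridInv C.X y = z := ⟨_, ridInv_rid z⟩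
    rw [rid_ridInv, ridInv_apply, tmap_tmul f _ h _ one_mem, mul_zero, sg_zero, one_smul]
    exact congrArg (tmul (f y)) (one_smul k A.curv)
  have hx := DFunLike.congr_fun hC.counit_right x
  simp only [GrHom.comp_apply] at hx
  have e₁ : tmap f (C.ε.comp A.m₀ (zero_add 2)) h (C.δ₂ x) =
      tmap f A.m₀ h (tmap (.id C.X) C.ε (add_zero 0) (C.δ₂ x)) := by
    rw [tmap_precomp]; rfl
  rw [conv_apply, e₁, key, hx]
  rfl

end Action

/-- Twisting cochains: the Maurer-Cartan equation `θ m₁ + δ₁ θ + δ₂ (θ ⊗ θ) m₂ = δ₀ η + ε m₀` for a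
map `θ : C → A` of degree `1`. The condition `w θ = 0` is stated separately. -/
def IsTwisting (θ : GrHom 1 C.X A.X) : Prop :=
  θ.comp A.d one_add_one_eq_two + C.δ₁.comp θ one_add_one_eq_two + conv θ θ one_add_one_eq_two =
    C.δ₀.comp A.η (add_zero 2) + C.ε.comp A.m₀ (zero_add 2)

/-- The Bianchi identity: for a twisting cochain `θ`, the failure of `δ₁² = δ₂ (1 ⊗ δ₀ - δ₀ ⊗ 1)`
and of `δ₁ δ₀ = 0`, seen through `θ`, equals the failure of `m₁² = (m₀ ⊗ 1 - 1 ⊗ m₀) m₂` and of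
`m₀ m₁ = 0`. -/
theorem IsTwisting.bianchi [GradedStronglyCommutative 𝒦] (hC : C.IsDifferential)
    (hA : A.IsDifferential) {θ : GrHom 1 C.X A.X} (hθ : IsTwisting θ) :
    (C.δ₁.comp C.δ₁ (n := 2)).comp θ (n := 3) - (ract θ C.δ₀ - lact C.δ₀ θ) -
        (C.δ₁.comp C.δ₀ (n := 3)).comp A.η (n := 3) =
      θ.comp (A.d.comp A.d (n := 2)) (n := 3) -
        (conv (C.ε.comp A.m₀) θ - conv θ (C.ε.comp A.m₀)) -
        C.ε.comp (A.m₀.comp A.d (n := 3)) (n := 3) := by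
  rw [lact_eq_conv hA, ract_eq_conv hA]
  -- The four equations that the Maurer-Cartan equation implies after composition with `m₁`, after
  -- precomposition with `δ₁`, and after convolution with `θ` on either side. In their alternating
  -- sum the terms quadratic and cubic in `θ` cancel.
  have h₁ := congrArg (fun f => f.comp A.d (n := 3) rfl) hθ
  have h₂ := congrArg (fun f => C.δ₁.comp f (n := 3) rfl) hθ
  have h₃ := congrArg (fun f => conv θ f (n := 3) rfl) hθ
  have h₄ := congrArg (fun f => conv f θ (n := 3) rfl) hθ
  have hη : A.η.comp A.d (zero_add 1) = 0 := by
    apply unit_hom_ext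
    rw [GrHom.comp_apply]
    refine (congrArg A.d (one_smul k A.one)).trans hA.d_one
  have hε : C.δ₁.comp C.ε (add_zero 1) = 0 := by ext x; exact hC.δ₁_ε x
  have e₁ : (C.δ₀.comp A.η (add_zero 2)).comp A.d (n := 3) rfl = 0 := by
    rw [GrHom.comp_assoc C.δ₀ A.η A.d _ _ (zero_add 1), hη, GrHom.comp_zero]
  have e₂ : C.δ₁.comp (C.ε.comp A.m₀ (zero_add 2)) (n := 3) rfl = 0 := by
    rw [← GrHom.comp_assoc C.δ₁ C.ε A.m₀ (add_zero 1) rfl, hε, GrHom.zero_comp]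
  simp only [GrHom.comp_add, GrHom.add_comp, conv_add_left, conv_add_right, e₁, e₂, zero_add,
    add_zero] at h₁ h₂ h₃ h₄
  rw [conv_comp_d hA θ θ _ _ one_add_one_eq_two one_add_one_eq_two,
    GrHom.comp_assoc C.δ₁ θ A.d _ _ one_add_one_eq_two] at h₁
  rw [comp_conv_of_coderivation hC θ θ _ _ one_add_one_eq_two one_add_one_eq_two] at h₂
  rw [conv_assoc hA hC θ θ θ _ _ one_add_one_eq_two rfl] at h₄
  simp only [sg_one, neg_smul, one_smul] at h₁ h₂
  change C.δ₁.comp (C.δ₁.comp θ one_add_one_eq_two) (n := 3) rfl - _ -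
      C.δ₁.comp (C.δ₀.comp A.η (add_zero 2)) (n := 3) rfl =
    (θ.comp A.d one_add_one_eq_two).comp A.d (n := 3) rfl - _ -
      (C.ε.comp A.m₀ (zero_add 2)).comp A.d (n := 3) rfl
  linear_combination (norm := abel) h₂ - h₁ + h₃ - h₄

/-- Homomorphisms of algebras with derivations and curvatures preserve twisting cochains. -/
theorem IsTwisting.comp_algHom {θ : GrHom 1 C.X A.X} (hθ : IsTwisting θ) {f : GrHom 0 A.X B.X}
    (hf : IsAlgHom f) : IsTwisting (θ.comp f (add_zero 1)) := by
  have h := congrArg (fun p => p.comp f (add_zero 2)) hθ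
  have hη : A.η.comp f (add_zero 0) = B.η := unit_hom_ext <| by
    rw [GrHom.comp_apply]
    refine (congrArg f (one_smul k A.one)).trans (hf.map_one.trans (one_smul k B.one).symm)
  have hm : A.m₀.comp f (add_zero 2) = B.m₀ := unit_hom_ext <| by
    rw [GrHom.comp_apply]
    refine (congrArg f (one_smul k A.curv)).trans (hf.map_curv.trans (one_smul k B.curv).symm)
  have hc : (conv θ θ one_add_one_eq_two).comp f (add_zero 2) =
      conv (θ.comp f (add_zero 1)) (θ.comp f (add_zero 1)) one_add_one_eq_two := by
    ext x
    have hx := DFunLike.congr_fun hf.map_mul (tmap θ θ one_add_one_eq_two (C.δ₂ x))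
    simp only [GrHom.comp_apply, conv_apply] at hx ⊢
    rw [← hx, tmap_postcomp]
  simp only [GrHom.add_comp, hc] at h
  rw [GrHom.comp_assoc C.δ₀ A.η f _ _ (add_zero 0), hη, GrHom.comp_assoc C.ε A.m₀ f _ _ (add_zero 2),
    hm, GrHom.comp_assoc θ A.d f _ _ (add_zero 1), ← hf.map_d] at h
  exact h

variable [GradedStronglyCommutative 𝒦] {D : CoalgData 𝒦}

/-- The failure of a pair `(g₁, g₀)` to satisfy `δ₁ g₁ + δ₂ (g₀ ⊗ g₁ - g₁ ⊗ g₀) = g₁ δ₁`. -/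
def CoalgPair.defect₁ (g : CoalgPair C D) : GrHom 1 C.X D.X :=
  g.g₁.comp D.δ₁ (zero_add 1) - C.δ₁.comp g.g₁ (add_zero 1) -
    (lact g.g₀ g.g₁ (add_zero 1) - ract g.g₁ g.g₀ (zero_add 1))

/-- The failure of a pair `(g₁, g₀)` to satisfy `δ₀ - δ₁ g₀ - δ₂ (g₀ ⊗ g₀) = g₁ δ₀`. -/
def CoalgPair.defect₀ (g : CoalgPair C D) : GrHom 2 C.X (unit 𝒦) :=
  g.g₁.comp D.δ₀ (zero_add 2) - C.δ₀ + C.δ₁.comp g.g₀ one_add_one_eq_two +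
    lact g.g₀ g.g₀ one_add_one_eq_two

theorem CoalgPair.IsHom.defect₁_eq_zero {g : CoalgPair C D} (hg : g.IsHom) : g.defect₁ = 0 := by
  have h := hg.map_δ₁
  rw [CoalgPair.defect₁, ← h]
  change _ + (lact g.g₀ g.g₁ (add_zero 1) - ract g.g₁ g.g₀ (zero_add 1)) - _ - _ = _
  abel

theorem CoalgPair.IsHom.defect₀_eq_zero {g : CoalgPair C D} (hg : g.IsHom) : g.defect₀ = 0 := by
  have h := hg.map_δ₀
  rw [CoalgPair.defect₀, ← h]
  change C.δ₀ - _ - lact g.g₀ g.g₀ one_add_one_eq_two - _ + _ + _ = _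
  abel

theorem CoalgPair.isHom_of_defect {g : CoalgPair C D}
    (map_δ₂ : C.δ₂.comp (tmap g.g₁ g.g₁) (add_zero 0) = g.g₁.comp D.δ₂ (add_zero 0))
    (map_ε : g.g₁.comp D.ε (add_zero 0) = C.ε) (map_w : g.g₁ C.w = D.w) (w_g₀ : g.g₀ C.w = 0)
    (h₁ : g.defect₁ = 0) (h₀ : g.defect₀ = 0) : g.IsHom where
  map_δ₂ := map_δ₂
  map_ε := map_ε
  map_w := map_w
  w_g₀ := w_g₀
  map_δ₁ := by
    rw [← sub_eq_zero, ← neg_eq_zero, ← h₁]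
    change -(_ + (lact g.g₀ g.g₁ (add_zero 1) - ract g.g₁ g.g₀ (zero_add 1)) - _) = _
    rw [CoalgPair.defect₁]
    abel
  map_δ₀ := by
    rw [← sub_eq_zero, ← neg_eq_zero, ← h₀]
    change -(C.δ₀ - _ - lact g.g₀ g.g₀ one_add_one_eq_two - _) = _
    rw [CoalgPair.defect₀]
    abel

/-- The cochain `g₁ θ + g₀ η` obtained from a cochain `θ` by pulling back along a pair `(g₁, g₀)`. -/
def CoalgPair.pull (g : CoalgPair C D) (θ : GrHom 1 D.X A.X) : GrHom 1 C.X A.X :=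
  g.g₁.comp θ (zero_add 1) + g.g₀.comp A.η (add_zero 1)

/-- The Maurer-Cartan defect of the cochain pulled back from a twisting cochain along a
homomorphism of coalgebras `g₁` and a functional `g₀` is a combination of the two defects of the
pair `(g₁, g₀)`. -/
theorem IsTwisting.pull_defect (hA : A.IsDifferential) {g : CoalgPair C D} {θ : GrHom 1 D.X A.X}
    (hθ : IsTwisting θ)
    (map_δ₂ : C.δ₂.comp (tmap g.g₁ g.g₁) (add_zero 0) = g.g₁.comp D.δ₂ (add_zero 0))
    (map_ε : g.g₁.comp D.ε (add_zero 0) = C.ε) :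
    (g.pull θ).comp A.d one_add_one_eq_two + C.δ₁.comp (g.pull θ) one_add_one_eq_two +
        conv (g.pull θ) (g.pull θ) one_add_one_eq_two -
        (C.δ₀.comp A.η (add_zero 2) + C.ε.comp A.m₀ (zero_add 2)) =
      g.defect₀.comp A.η (add_zero 2) - g.defect₁.comp θ one_add_one_eq_two := by
  have h := congrArg (fun p => g.g₁.comp p (zero_add 2)) hθ
  have hc : g.g₁.comp (conv θ θ one_add_one_eq_two) (zero_add 2) =
      conv (g.g₁.comp θ (zero_add 1)) (g.g₁.comp θ (zero_add 1)) one_add_one_eq_two := by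
    ext x
    have hx := DFunLike.congr_fun map_δ₂ x
    simp only [GrHom.comp_apply, conv_apply] at hx ⊢
    rw [← hx, tmap_precomp]
  have hη : A.η.comp A.d (zero_add 1) = 0 := by
    apply unit_hom_ext
    rw [GrHom.comp_apply]
    refine (congrArg A.d (one_smul k A.one)).trans hA.d_one
  simp only [GrHom.comp_add, hc] at h
  rw [← GrHom.comp_assoc g.g₁ D.ε A.m₀ (add_zero 0) (zero_add 2), map_ε] at h
  simp only [CoalgPair.pull, CoalgPair.defect₀, CoalgPair.defect₁, GrHom.comp_add, GrHom.add_comp,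
    GrHom.sub_comp, conv_add_left, conv_add_right]
  rw [GrHom.comp_assoc g.g₀ A.η A.d _ _ (zero_add 1), hη, GrHom.comp_zero,
    lact_comp g.g₀ g.g₁ θ _ _ (zero_add 1), ract_comp g.g₁ g.g₀ θ _ _ (zero_add 1),
    lact_comp g.g₀ g.g₀ A.η _ _ (add_zero 1), lact_eq_conv hA, lact_eq_conv hA, ract_eq_conv hA,
    mul_one, sg_one, neg_smul, one_smul,
    GrHom.comp_assoc g.g₁ D.δ₁ θ _ _ one_add_one_eq_two,
    GrHom.comp_assoc C.δ₁ g.g₁ θ _ _ (zero_add 1),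
    GrHom.comp_assoc C.δ₁ g.g₀ A.η _ _ (add_zero 1),
    GrHom.comp_assoc g.g₁ D.δ₀ A.η _ _ (add_zero 2),
    GrHom.comp_assoc g.g₁ θ A.d _ _ one_add_one_eq_two]
  linear_combination (norm := abel) h

/-- Morphisms of curved augmented coalgebras pull twisting cochains back. -/
theorem IsTwisting.pull (hA : A.IsDifferential) {g : CoalgPair C D} (hg : g.IsHom)
    {θ : GrHom 1 D.X A.X} (hθ : IsTwisting θ) : IsTwisting (g.pull θ) := by
  rw [IsTwisting, ← sub_eq_zero, hθ.pull_defect hA hg.map_δ₂ hg.map_ε, hg.defect₀_eq_zero,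
    hg.defect₁_eq_zero, GrHom.zero_comp, GrHom.zero_comp, sub_zero]

end Convolution

/-! ### The tensor algebra -/

namespace GrMod

variable [GradedRing 𝒦] {X Y P : GrMod 𝒦} {d e n : ℤ}

variable (X) in
/-- The inclusion of `k = X^{⊗ 0}`. -/
def tinjZero : GrHom 0 (unit 𝒦) (T X) := tinj X 0

variable (X) in
/-- The inclusion of `X ⊗ X^{⊗ n} = X^{⊗ (n+1)}`. -/
def tinjSucc (n : ℕ) : GrHom 0 (tensor X (tpow X n)) (T X) := tinj X (n + 1)

theorem tcons_tinj (x : X) (n : ℕ) (t : tpow X n) :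
    tcons X (tmul x (tinj X n t)) = tinjSucc X n (tmul x t) := tcons_tmul x n t

theorem tone_eq : tone X = tinjZero X (one 𝒦) := rfl

theorem tinjZero_apply (a : unit 𝒦) : tinjZero X a = (show k from a) • tone X := by
  rw [tone_eq, ← map_smul]
  exact congrArg (tinjZero X) (smul_one (𝒦 := 𝒦) (show k from a)).symm

theorem T_tinj_induction {p : T X → Prop} (z : T X) (h : ∀ n t, p (tinj X n t))
    (hadd : ∀ s t, p s → p t → p (s + t)) : p z :=
  dsum_induction z h hadd

theorem T_gr_induction {i : ℤ} {p : ∀ z : T X, z ∈ (T X).gr i → Prop} {z : T X}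
    (hz : z ∈ (T X).gr i)
    (h : ∀ n t (ht : t ∈ (tpow X n).gr i), p (tinj X n t) ((tinj X n).mem ht (add_zero i)))
    (hadd : ∀ s t hs ht, p s hs → p t ht → p (s + t) (add_mem hs ht)) : p z hz :=
  dsum_gr_induction hz h hadd

theorem T_induction {p : T X → Prop} (z : T X) (hone : ∀ a : k, p (a • tone X))
    (hcons : ∀ i j x t, x ∈ X.gr i → t ∈ (T X).gr j → p t → p (tcons X (tmul x t)))
    (hadd : ∀ s t, p s → p t → p (s + t)) : p z := by
  refine T_tinj_induction z (fun n => ?_) hadd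
  induction n with
  | zero => exact fun t => (tinjZero_apply t).symm ▸ hone (show k from t)
  | succ n ih =>
    intro t
    change p (tinjSucc X n t)
    change tensor X (tpow X n) at t
    induction t using tensor_induction with
    | h i j x t hx ht =>
      rw [← tcons_tinj]
      exact hcons i j x _ hx ((tinj X n).mem ht (add_zero j)) (ih t)
    | hadd s t hs ht => rw [map_add]; exact hadd _ _ hs ht

theorem T_hom_ext {f g : GrHom d (T X) P} (hone : f (tone X) = g (tone X))
    (hcons : ∀ i j x t, x ∈ X.gr i → t ∈ (T X).gr j → f t = g t →
      f (tcons X (tmul x t)) = g (tcons X (tmul x t))) : f = g := by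
  ext z
  induction z using T_induction with
  | hone a => rw [map_smul, map_smul, hone]
  | hcons i j x t hx ht h => exact hcons i j x t hx ht h
  | hadd s t hs ht => rw [map_add, map_add, hs, ht]

theorem tinj1_apply (x : X) : tinj1 X x = tcons X (tmul x (tone X)) :=
  (tcons_tmul x 0 (one 𝒦)).symm

theorem tinj2_tmul (x y : X) : tinj2 X (tmul x y) = tcons X (tmul x (tinj1 X y)) := by
  refine Eq.trans ?_ (tcons_tmul x 1 (tmul y (one 𝒦))).symm
  exact congrArg (tinjSucc X 1) (tmap_tmul_zero (.id X) (ridInv X) _ x y)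

theorem tcons_mem {i j : ℤ} {x : X} {t : T X} (hx : x ∈ X.gr i) (ht : t ∈ (T X).gr j)
    (h : i + j = n := by first | rfl | lia) : tcons X (tmul x t) ∈ (T X).gr n :=
  (tcons X).mem (tmul_mem hx ht rfl) (by lia)

variable [GradedStronglyCommutative 𝒦]

theorem tMul_tinj (n : ℕ) (t : tpow X n) (z : T X) :
    tMul X (tmul (tinj X n t) z) = tmulPow X n (tmul t z) :=
  tensorDsumDesc_tmul (tmulPow X) n t z

theorem tMul_one_left (z : T X) : tMul X (tmul (tone X) z) = z := by
  refine (tMul_tinj 0 (one 𝒦) z).trans ?_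
  exact one_smul k z

theorem tMul_tcons (x : X) (t z : T X) :
    tMul X (tmul (tcons X (tmul x t)) z) = tcons X (tmul x (tMul X (tmul t z))) := by
  induction t using T_tinj_induction with
  | h n t =>
    rw [tcons_tinj, tMul_tinj]
    refine (tMul_tinj (n + 1) _ z).trans ?_
    exact congrArg (tcons X) (tmap_tmul_zero (.id X) (tmulPow X n) (add_zero 0) x (tmul t z))
  | hadd s t hs ht => simp only [map_add, AddMonoidHom.add_apply, hs, ht]

theorem tMul_tinj1 (x : X) (t : T X) : tMul X (tmul (tinj1 X x) t) = tcons X (tmul x t) := by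
  rw [tinj1_apply, tMul_tcons, tMul_one_left]

theorem tMul_assoc (s t z : T X) :
    tMul X (tmul (tMul X (tmul s t)) z) = tMul X (tmul s (tMul X (tmul t z))) := by
  induction s using T_induction with
  | hone a =>
    rw [tmul_smul_left, map_smul, tmul_smul_left, map_smul, tmul_smul_left, map_smul,
      tMul_one_left, tMul_one_left]
  | hcons i j x s hx hs h => rw [tMul_tcons, tMul_tcons, tMul_tcons, h]
  | hadd s s' hs hs' => simp only [map_add, AddMonoidHom.add_apply, hs, hs']

theorem tMul_one_right (z : T X) : tMul X (tmul z (tone X)) = z := by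
  induction z using T_induction with
  | hone a => rw [tmul_smul_left, map_smul, tMul_one_left]
  | hcons i j x s hx hs h => rw [tMul_tcons, h]
  | hadd s s' hs hs' => simp only [map_add, AddMonoidHom.add_apply, hs, hs']

theorem tMul_mem {i j : ℤ} {s t : T X} (hs : s ∈ (T X).gr i) (ht : t ∈ (T X).gr j)
    (h : i + j = n := by first | rfl | lia) : tMul X (tmul s t) ∈ (T X).gr n :=
  (tMul X).mem (tmul_mem hs ht rfl) (by lia)

theorem der_tone (ξ : GrHom 1 X (T X)) : der ξ (tone X) = 0 := tdesc_tinj _ 0 _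

theorem der_tcons (ξ : GrHom 1 X (T X)) (x : X) {j : ℤ} {t : T X} (ht : t ∈ (T X).gr j) :
    der ξ (tcons X (tmul x t)) =
      tcons X (tmul x (der ξ t)) + sg j • tMul X (tmul (ξ x) t) := by
  induction ht using T_gr_induction with
  | h n t ht =>
    rw [tcons_tinj]
    refine (tdesc_tinj _ (n + 1) _).trans ?_
    rw [der, tdesc_tinj]
    refine congrArg₂ (· + ·)
      (congrArg (tcons X) (tmap_tmul_zero (.id X) (derPow ξ n) (zero_add 1) x t)) ?_
    refine (congrArg (tMul X) (tmap_tmul ξ (tinj X n) (add_zero 1) x ht)).trans ?_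
    rw [one_mul, map_zsmul]
  | hadd s t hs ht h h' =>
    simp only [map_add, h, h', smul_add]
    abel

theorem der_tinj1 (ξ : GrHom 1 X (T X)) (x : X) : der ξ (tinj1 X x) = ξ x := by
  rw [tinj1_apply, der_tcons ξ x tone_mem, der_tone, map_zero, map_zero, zero_add, sg_zero,
    one_smul, tMul_one_right]

/-- The map `der ξ` satisfies the Leibniz rule. -/
theorem der_tMul (ξ : GrHom 1 X (T X)) (s : T X) {j : ℤ} {t : T X} (ht : t ∈ (T X).gr j) :
    der ξ (tMul X (tmul s t)) =
      tMul X (tmul s (der ξ t)) + sg j • tMul X (tmul (der ξ s) t) := by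
  induction s using T_induction with
  | hone a =>
    simp only [tmul_smul_left, map_smul, tMul_one_left, der_tone, map_zero, smul_zero,
      AddMonoidHom.zero_apply, add_zero]
  | hcons i l x s hx hs h =>
    rw [tMul_tcons, der_tcons ξ x (tMul_mem hs ht rfl), h, tMul_tcons, der_tcons ξ x hs]
    simp only [map_add, AddMonoidHom.add_apply, map_zsmul, AddMonoidHom.smul_apply, tMul_tcons,
      smul_add, smul_smul, sg_add, tMul_assoc]
    rw [mul_comm (sg l), add_assoc]
  | hadd s s' hs hs' =>
    simp only [map_add, AddMonoidHom.add_apply, hs, hs', smul_add]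
    abel

theorem der_leibniz (ξ : GrHom 1 X (T X)) : (tMul X).comp (der ξ) (zero_add 1) =
    (tmap (.id (T X)) (der ξ) + tmap (der ξ) (.id (T X))).comp (tMul X) (add_zero 1) := by
  refine tensor_hom_ext fun i j s t hs ht => ?_
  rw [GrHom.comp_apply, GrHom.comp_apply, der_tMul ξ s ht, GrHom.add_apply, tmap_tmul_zero,
    tmap_tmul _ _ _ s ht, one_mul, map_add, map_zsmul]
  rfl

end GrMod

/-- Derivations along a homomorphism from the tensor algebra are determined by their values on
generators. -/
theorem eq_of_derivation [GradedRing 𝒦] {X : GrMod 𝒦} {A : AlgData 𝒦} {d : ℤ}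
    (f : GrHom 0 (T X) A.X) {F G : GrHom d (T X) A.X} (hone : F (tone X) = G (tone X))
    (hF : ∀ (x : X) (j : ℤ) (t : T X), t ∈ (T X).gr j → F (tcons X (tmul x t)) =
      A.mul (tmul (f (tinj1 X x)) (F t)) + sg (d * j) • A.mul (tmul (F (tinj1 X x)) (f t)))
    (hG : ∀ (x : X) (j : ℤ) (t : T X), t ∈ (T X).gr j → G (tcons X (tmul x t)) =
      A.mul (tmul (f (tinj1 X x)) (G t)) + sg (d * j) • A.mul (tmul (G (tinj1 X x)) (f t)))
    (hgen : ∀ x, F (tinj1 X x) = G (tinj1 X x)) : F = G :=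
  T_hom_ext hone fun i j x t _ ht h => by rw [hF x j t ht, hG x j t ht, h, hgen]

/-! ### Freeness of the tensor algebra -/

section Extension

variable [GradedRing 𝒦] {X : GrMod 𝒦} {A : AlgData 𝒦}

/-- The homomorphism of algebras `XT^≥ → A` that is `φ` on generators, on `X^{⊗ n}`. -/
def liftPow (φ : GrHom 0 X A.X) : ∀ n, GrHom 0 (tpow X n) A.X
  | 0 => A.η
  | n + 1 => (tmap φ (liftPow φ n)).comp A.mul

/-- The homomorphism of algebras `XT^≥ → A` that is `φ` on generators. -/
def lift (φ : GrHom 0 X A.X) : GrHom 0 (T X) A.X := tdesc (liftPow φ)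

theorem lift_tone (φ : GrHom 0 X A.X) : lift φ (tone X) = A.one :=
  (tdesc_tinj _ 0 _).trans (one_smul k A.one)

theorem lift_tcons (φ : GrHom 0 X A.X) (x : X) (t : T X) :
    lift φ (tcons X (tmul x t)) = A.mul (tmul (φ x) (lift φ t)) := by
  induction t using T_tinj_induction with
  | h n t =>
    rw [tcons_tinj]
    refine (tdesc_tinj _ (n + 1) _).trans ?_
    rw [lift, tdesc_tinj]
    exact congrArg A.mul (tmap_tmul_zero φ (liftPow φ n) (add_zero 0) x t)
  | hadd s t hs ht => simp only [map_add, hs, ht]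

theorem lift_tinj1 (hA : A.IsDifferential) (φ : GrHom 0 X A.X) (x : X) :
    lift φ (tinj1 X x) = φ x := by
  rw [tinj1_apply, lift_tcons, lift_tone, hA.mul_one]

variable [GradedStronglyCommutative 𝒦]

theorem lift_tMul (hA : A.IsDifferential) (φ : GrHom 0 X A.X) (s t : T X) :
    lift φ (tMul X (tmul s t)) = A.mul (tmul (lift φ s) (lift φ t)) := by
  induction s using T_induction with
  | hone a =>
    simp only [tmul_smul_left, map_smul, tMul_one_left, lift_tone, hA.one_mul]
  | hcons i j x s hx hs h => rw [tMul_tcons, lift_tcons, lift_tcons, h, hA.mul_assoc]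
  | hadd s s' hs hs' => simp only [map_add, AddMonoidHom.add_apply, hs, hs']

end Extension

/-! ### The tensor coalgebra -/

namespace GrMod

variable [GradedRing 𝒦] {X Y N P : GrMod 𝒦} {d e : ℤ}

variable (X) in
/-- The map `XT^≥ → X ⊗ XT^≥` that splits off the first letter, `1 ↦ 0` and `x t ↦ x ⊗ t`. -/
def uncons : GrHom 0 (T X) (tensor X (T X)) :=
  tdesc fun
    | 0 => 0
    | n + 1 => tmap (.id X) (tinj X n)

theorem uncons_tinjZero (a : unit 𝒦) : uncons X (tinjZero X a) = 0 := tdesc_tinj _ 0 a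

theorem uncons_tone : uncons X (tone X) = 0 := uncons_tinjZero _

theorem uncons_tcons (z : tensor X (T X)) : uncons X (tcons X z) = z := by
  induction z using tensor_induction with
  | h i j x t hx ht =>
    clear ht
    induction t using T_tinj_induction with
    | h n t =>
      rw [tcons_tinj]
      refine (tdesc_tinj _ (n + 1) _).trans ?_
      exact tmap_tmul_zero (.id X) (tinj X n) _ x t
    | hadd s t hs ht => simp only [map_add, hs, ht]
  | hadd s t hs ht => simp only [map_add, hs, ht]

theorem tpr0_tinjZero (a : unit 𝒦) : tpr0 X (tinjZero X a) = a := tdesc_tinj _ 0 a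

theorem tpr0_tinjSucc (n : ℕ) (t : tensor X (tpow X n)) : tpr0 X (tinjSucc X n t) = 0 :=
  tdesc_tinj _ (n + 1) t

theorem tpr0_tcons (z : tensor X (T X)) : tpr0 X (tcons X z) = 0 := by
  induction z using tensor_induction with
  | h i j x t hx ht =>
    clear ht
    induction t using T_tinj_induction with
    | h n t => rw [tcons_tinj, tpr0_tinjSucc]
    | hadd s t hs ht => simp only [map_add, hs, ht, add_zero]
  | hadd s t hs ht => simp only [map_add, hs, ht, add_zero]

variable (X) in
/-- The projection `XT^≥ → X^{⊗ n}`. -/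
def tpr : ∀ n, GrHom 0 (T X) (tpow X n)
  | 0 => tpr0 X
  | n + 1 => (uncons X).comp (tmap (.id X) (tpr n))

theorem tpr_tcons (n : ℕ) (z : tensor X (T X)) :
    tpr X (n + 1) (tcons X z) = tmap (.id X) (tpr X n) (add_zero 0) z :=
  congrArg (tmap (.id X) (tpr X n) (add_zero 0)) (uncons_tcons z)

theorem tpr_tinj (n : ℕ) (t : tpow X n) : tpr X n (tinj X n t) = t := by
  induction n with
  | zero => exact tpr0_tinjZero t
  | succ n ih =>
    change (tinjSucc X n).comp (show GrHom 0 (T X) (tensor X (tpow X n)) from tpr X (n + 1))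
      (add_zero 0) t = GrHom.id (tensor X (tpow X n)) t
    congr 1
    refine tensor_hom_ext fun i j x t hx ht => ?_
    rw [GrHom.comp_apply, ← tcons_tinj]
    refine (tpr_tcons n _).trans ?_
    rw [tmap_tmul_zero, ih]
    rfl

theorem tpr_tinj_of_ne {m n : ℕ} (h : m ≠ n) (t : tpow X n) : tpr X m (tinj X n t) = 0 := by
  induction n generalizing m with
  | zero =>
    obtain ⟨m, rfl⟩ := Nat.exists_eq_succ_of_ne_zero h
    exact (congrArg (tmap (.id X) (tpr X m) (add_zero 0)) (uncons_tinjZero t)).trans (map_zero _)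
  | succ n ih =>
    cases m with
    | zero => exact tpr0_tinjSucc n t
    | succ m =>
      change (tinjSucc X n).comp (show GrHom 0 (T X) (tensor X (tpow X m)) from tpr X (m + 1))
        (add_zero 0) t = (0 : GrHom 0 (tensor X (tpow X n)) (tensor X (tpow X m))) t
      congr 1
      refine tensor_hom_ext fun i j x t hx ht => ?_
      rw [GrHom.comp_apply, ← tcons_tinj]
      refine (tpr_tcons m _).trans ?_
      rw [tmap_tmul_zero, ih (by lia), map_zero]
      rfl

theorem exists_eq_sum_tinj (z : T X) :
    ∃ N, ∀ N' ≥ N, z = ∑ n ∈ Finset.range N', tinj X n (tpr X n z) := by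
  induction z using T_tinj_induction with
  | h n t =>
    refine ⟨n + 1, fun N' hN => ?_⟩
    rw [Finset.sum_eq_single n, tpr_tinj]
    · intro m _ hm
      rw [tpr_tinj_of_ne hm, map_zero]
    · intro h
      exact absurd (Finset.mem_range.2 (by lia)) h
  | hadd s t hs ht =>
    obtain ⟨N, hN⟩ := hs
    obtain ⟨N', hN'⟩ := ht
    refine ⟨max N N', fun m hm => ?_⟩
    simp only [map_add, Finset.sum_add_distrib]
    rw [← hN m (le_trans (le_max_left _ _) hm), ← hN' m (le_trans (le_max_right _ _) hm)]

theorem eq_of_tpr {s t : T X} (h : ∀ n, tpr X n s = tpr X n t) : s = t := by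
  obtain ⟨N, hN⟩ := exists_eq_sum_tinj (s - t)
  rw [← sub_eq_zero, hN N le_rfl]
  refine Finset.sum_eq_zero fun n _ => ?_
  rw [map_sub, h, sub_self, map_zero]

/-- Elements of `XT^≥ ⊗ N` are determined by their components in `X^{⊗ n} ⊗ N`, as the tensor
product preserves direct sums. -/
theorem tensor_T_eq_of_tpr {s t : tensor (T X) N}
    (h : ∀ n, tmap (tpr X n) (.id N) (add_zero 0) s = tmap (tpr X n) (.id N) (add_zero 0) t) :
    s = t := by
  have key : ∀ z : tensor (T X) N, ∃ N₀, ∀ N' ≥ N₀, z = ∑ n ∈ Finset.range N',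
      tmap (tinj X n) (.id N) (add_zero 0) (tmap (tpr X n) (.id N) (add_zero 0) z) := by
    intro z
    induction z using tensor_induction with
    | h i j x y hx hy =>
      obtain ⟨N₀, hN⟩ := exists_eq_sum_tinj x
      refine ⟨N₀, fun N' h => ?_⟩
      conv_lhs => rw [hN N' h, map_sum, AddMonoidHom.finsetSum_apply]
      refine Finset.sum_congr rfl fun n _ => ?_
      rw [tmap_tmul_zero, tmap_tmul_zero]
      rfl
    | hadd s t hs ht =>
      obtain ⟨N, hN⟩ := hs
      obtain ⟨N', hN'⟩ := ht
      refine ⟨max N N', fun m hm => ?_⟩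
      simp only [map_add, Finset.sum_add_distrib]
      rw [← hN m (le_trans (le_max_left _ _) hm), ← hN' m (le_trans (le_max_right _ _) hm)]
  obtain ⟨N₀, hN⟩ := key (s - t)
  rw [← sub_eq_zero, hN N₀ le_rfl]
  refine Finset.sum_eq_zero fun n _ => ?_
  rw [map_sub, h, sub_self, map_zero]

theorem tensor_eq_of_tpr {s t : tensor X (T X)}
    (h : ∀ n, tmap (.id X) (tpr X n) (add_zero 0) s = tmap (.id X) (tpr X n) (add_zero 0) t) :
    s = t := by
  rw [← uncons_tcons s, ← uncons_tcons t]
  congr 1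
  refine eq_of_tpr fun n => ?_
  cases n with
  | zero => exact (tpr0_tcons s).trans (tpr0_tcons t).symm
  | succ n => exact (tpr_tcons n s).trans ((h n).trans (tpr_tcons n t).symm)

end GrMod

namespace GrMod

variable [GradedRing 𝒦] {X Y Z N N' P : GrMod 𝒦} {d e n : ℤ}

variable (X N) in
/-- The map `X ⊗ (XT^≥ ⊗ N) → XT^≥ ⊗ N`, `x ⊗ (t ⊗ y) ↦ x t ⊗ y`. -/
def consLeft : GrHom 0 (tensor X (tensor (T X) N)) (tensor (T X) N) :=
  (assocInv _ _ _).comp (tmap (tcons X) (.id N)) (add_zero 0)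

theorem consLeft_apply (z : tensor X (tensor (T X) N)) :
    consLeft X N z = tmap (tcons X) (.id N) (add_zero 0) (assocInv _ _ _ z) := rfl

theorem consLeft_tmul (x : X) (t : T X) (y : N) :
    consLeft X N (tmul x (tmul t y)) = tmul (tcons X (tmul x t)) y :=
  tmap_tmul_zero (tcons X) (.id N) (add_zero 0) (tmul x t) y

theorem cut_tone : cut X (tone X) = tmul (tone X) (tone X) := by
  refine (tdesc_tinj _ 0 _).trans ?_
  exact tmap_tmul_zero (tinj X 0) (tinj X 0) (add_zero 0) (one 𝒦) (one 𝒦)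

theorem cut_tcons (x : X) (t : T X) : cut X (tcons X (tmul x t)) =
    tmul (tone X) (tcons X (tmul x t)) + consLeft X (T X) (tmul x (cut X t)) := by
  induction t using T_tinj_induction with
  | h n t =>
    rw [tcons_tinj]
    refine (tdesc_tinj _ (n + 1) _).trans ?_
    refine Eq.trans (GrHom.add_apply _ _ _)
      (congrArg₂ (fun z w : tensor (T X) (T X) => z + w) ?_ ?_)
    · exact tmap_tmul_zero (tinj X 0) (tinj X (n + 1)) (add_zero 0) (one 𝒦) (tmul x t)
    · rw [cut, tdesc_tinj]
      exact congrArg (consLeft X (T X)) (tmap_tmul_zero (.id X) (cutPow X n) (add_zero 0) x t)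
  | hadd s t hs ht =>
    simp only [map_add, hs, ht]
    abel

/-- The extension of a map on the first factor commutes with `consLeft`. -/
theorem tmap_consLeft_right (g : GrHom e N N') (z : tensor X (tensor (T X) N)) :
    tmap (.id (T X)) g (zero_add e) (consLeft X N z) =
      consLeft X N' (tmap (.id X) (tmap (.id (T X)) g (zero_add e)) (zero_add e) z) := by
  rw [consLeft_apply, consLeft_apply, assocInv_natural (.id X) (.id (T X)) g (add_zero 0)
    (zero_add e), tmap_precomp, tmap_postcomp]
  congr 2
  ext z
  exact (tcons X).comp_apply (.id _) (add_zero 0) z |>.trans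
    (congrArg (tcons X) (tmap_id z).symm)

section Counit

variable [GradedStronglyCommutative 𝒦]

theorem cut_counit_left (z : T X) :
    lid (T X) (tmap (tpr0 X) (.id (T X)) (add_zero 0) (cut X z)) = z := by
  induction z using T_induction with
  | hone a =>
    rw [map_smul, map_smul, map_smul, cut_tone, tmap_tmul_zero, tpr0_tone]
    exact congrArg (a • ·) (one_smul k (tone X))
  | hcons i j x t hx ht h =>
    have e : ∀ w, tmap (tpr0 X) (.id (T X)) (add_zero 0) (consLeft X (T X) (tmul x w)) = 0 := by
      intro w
      induction w using tensor_induction with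
      | h i j u v hu hv =>
        rw [consLeft_tmul, tmap_tmul_zero, tpr0_tcons, map_zero, AddMonoidHom.zero_apply]
      | hadd u v hu hv => simp only [map_add, hu, hv, add_zero]
    rw [cut_tcons, map_add, e, add_zero, tmap_tmul_zero, tpr0_tone]
    exact one_smul k _
  | hadd s t hs ht => simp only [map_add, hs, ht]

theorem cut_counit_right (z : T X) :
    rid (T X) (tmap (.id (T X)) (tpr0 X) (add_zero 0) (cut X z)) = z := by
  induction z using T_induction with
  | hone a =>
    rw [map_smul, map_smul, map_smul, cut_tone, tmap_tmul_zero, tpr0_tone]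
    exact congrArg (a • ·) (rid_ridInv (tone X))
  | hcons i j x t hx ht h =>
    have e : ∀ w, rid (T X) (tmap (.id (T X)) (tpr0 X) (add_zero 0) (consLeft X (T X) (tmul x w))) =
        tcons X (tmul x (rid (T X) (tmap (.id (T X)) (tpr0 X) (add_zero 0) w))) := by
      intro w
      induction w using tensor_induction with
      | h i j u v hu hv =>
        have h' := rid_natural (tcons X) (tmul (tmul x u) (tpr0 X v))
        rw [tmap_tmul_zero, ← rid_assoc, assoc_tmul, tmap_tmul_zero, GrHom.id_apply,
          GrHom.id_apply] at h'
        rw [consLeft_tmul, tmap_tmul_zero, tmap_tmul_zero, GrHom.id_apply, GrHom.id_apply, h']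
      | hadd u v hu hv => simp only [map_add, hu, hv]
    rw [cut_tcons, map_add, map_add, e, h, tmap_tmul_zero, tpr0_tcons, map_zero, map_zero, zero_add]
  | hadd s t hs ht => simp only [map_add, hs, ht]

end Counit

theorem cut_coassoc (z : T X) : tmap (.id (T X)) (cut X) (add_zero 0) (cut X z) =
    assoc _ _ _ (tmap (cut X) (.id (T X)) (add_zero 0) (cut X z)) := by
  have e : ∀ x w, assoc _ _ _ (tmap (cut X) (.id (T X)) (add_zero 0)
        (consLeft X (T X) (tmul x w))) = tmul (tone X) (consLeft X (T X) (tmul x w)) +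
      consLeft X _ (tmul x (assoc _ _ _ (tmap (cut X) (.id (T X)) (add_zero 0) w))) := by
    intro x w
    induction w using tensor_induction with
    | h i j u v hu hv =>
      have e' : ∀ z, assoc _ _ _ (tmul (consLeft X (T X) (tmul x z)) v) =
          consLeft X _ (tmul x (assoc _ _ _ (tmul z v))) := by
        intro z
        induction z using tensor_induction with
        | h i j s t hs ht => rw [consLeft_tmul, assoc_tmul, assoc_tmul, consLeft_tmul]
        | hadd s t hs ht => simp only [map_add, AddMonoidHom.add_apply, hs, ht]
      rw [consLeft_tmul, tmap_tmul_zero, tmap_tmul_zero, cut_tcons, map_add, AddMonoidHom.add_apply,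
        map_add, assoc_tmul, GrHom.id_apply, e']
    | hadd u v hu hv =>
      simp only [map_add, hu, hv]
      abel
  induction z using T_induction with
  | hone a =>
    simp only [map_smul]
    rw [cut_tone, tmap_tmul_zero, tmap_tmul_zero, cut_tone]
    rfl
  | hcons i j x t hx ht h =>
    rw [cut_tcons, map_add, map_add, map_add, e, tmap_consLeft_right, tmap_tmul_zero,
      tmap_tmul_zero, tmap_tmul_zero, cut_tone, h, GrHom.id_apply, GrHom.id_apply, GrHom.id_apply,
      assoc_tmul, cut_tcons, map_add, add_assoc]
  | hadd s t hs ht => simp only [map_add, hs, ht]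

/-- Splitting off the first letter is a map of right comodules. -/
theorem uncons_cut (z : T X) : assocInv _ _ _ (tmap (.id X) (cut X) (add_zero 0) (uncons X z)) =
    tmap (uncons X) (.id (T X)) (add_zero 0) (cut X z) := by
  induction z using T_induction with
  | hone a =>
    simp only [map_smul]
    rw [cut_tone, tmap_tmul_zero, uncons_tone, map_zero, map_zero, map_zero,
      AddMonoidHom.zero_apply]
  | hcons i j x t hx ht h =>
    rw [uncons_tcons, cut_tcons, map_add, tmap_tmul_zero, tmap_tmul_zero, uncons_tone, map_zero,
      AddMonoidHom.zero_apply, zero_add, consLeft_apply, tmap_postcomp]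
    have hc : (tcons X).comp (uncons X) (add_zero 0) = .id _ := by
      ext z; exact uncons_tcons z
    rw [hc]
    exact (tmap_id _).symm
  | hadd s t hs ht => simp only [map_add, hs, ht]

variable [GradedStronglyCommutative 𝒦]

variable (X) in
/-- The projection `XT^≥ → X`. -/
def tpr1 : GrHom 0 (T X) X := (uncons X).comp ((tmap (.id X) (tpr0 X)).comp (rid X))

theorem tpr1_tone : tpr1 X (tone X) = 0 := by
  rw [tpr1, GrHom.comp_apply, uncons_tone, map_zero]

theorem tpr1_tcons (x : X) (t : T X) :
    tpr1 X (tcons X (tmul x t)) = rid X (tmul x (tpr0 X t)) := by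
  rw [tpr1, GrHom.comp_apply, uncons_tcons, GrHom.comp_apply, tmap_tmul_zero]
  rfl

theorem tpr1_tinj1 (x : X) : tpr1 X (tinj1 X x) = x := by
  rw [tinj1_apply, tpr1_tcons, tpr0_tone]
  exact rid_ridInv x

theorem tpr1_tcons_tcons (x : X) (z : tensor X (T X)) :
    tpr1 X (tcons X (tmul x (tcons X z))) = 0 := by
  rw [tpr1_tcons, tpr0_tcons, map_zero, map_zero]

/-- Splitting off the first letter is the cut coproduct followed by the projection to `X`. -/
theorem tmap_tpr1_cut (z : T X) :
    tmap (tpr1 X) (.id (T X)) (add_zero 0) (cut X z) = uncons X z := by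
  have e : tmap (tpr1 X) (.id (T X)) (add_zero 0) (cut X z) =
      tmap ((tmap (.id X) (tpr0 X)).comp (rid X)) (.id (T X)) (add_zero 0)
        (tmap (uncons X) (.id (T X)) (add_zero 0) (cut X z)) := by
    rw [tmap_precomp]; rfl
  rw [e, ← uncons_cut]
  generalize uncons X z = w
  induction w using tensor_induction with
  | h i j x t hx ht =>
    rw [tmap_tmul_zero]
    conv_rhs => rw [← cut_counit_left t]
    generalize cut X t = w
    induction w using tensor_induction with
    | h i j u v hu hv =>
      rw [assocInv_tmul, tmap_tmul_zero, tmap_tmul_zero, GrHom.comp_apply, tmap_tmul_zero]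
      have h := tmap_lid_assoc (tmul (tmul x (tpr0 X u)) v)
      rw [assoc_tmul, tmap_tmul_zero, tmap_tmul_zero] at h
      exact h.symm
    | hadd u v hu hv => simp only [map_add, hu, hv]
  | hadd s t hs ht => simp only [map_add, hs, ht]

/-! ### Coderivations of the tensor coalgebra -/

section Coder

variable {b₀ : GrHom 1 (unit 𝒦) X} {b₁ : GrHom 1 X X} {b₂ : GrHom 1 (tensor X X) X}

/-- Replacing the first factor by a letter, `Z ⊗ XT^≥ → XT^≥`. -/
def insertHead (b : GrHom 1 Z X) : GrHom 1 (tensor Z (T X)) (T X) :=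
  (tmap b (.id (T X)) (add_zero 1)).comp (tcons X) (add_zero 1)

theorem uncons_tinjSucc (n : ℕ) (t : tensor X (tpow X n)) :
    uncons X (tinjSucc X n t) = tmap (.id X) (tinj X n) (add_zero 0) t :=
  tdesc_tinj _ (n + 1) t

theorem insertHead_tinj (b : GrHom 1 Z X) (n : ℕ) (z : tensor Z (tpow X n)) :
    insertHead b (tmap (.id Z) (tinj X n) (add_zero 0) z) =
      tinjSucc X n (tmap b (.id (tpow X n)) (add_zero 1) z) := by
  induction z using tensor_induction with
  | h i j x t hx ht =>
    rw [tmap_tmul_zero, insertHead, GrHom.comp_apply,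
      tmap_tmul _ _ _ _ ((tinj X n).mem ht (add_zero j)), tmap_tmul _ _ _ _ ht, map_zsmul,
      map_zsmul, GrHom.id_apply, GrHom.id_apply, GrHom.id_apply, tcons_tinj]
  | hadd s t hs ht => simp only [map_add, hs, ht]

theorem cut_insertHead (b : GrHom 1 Z X) (z : tensor Z (T X)) :
    cut X (insertHead b z) = tmul (tone X) (insertHead b z) +
      tmap (insertHead b) (.id (T X)) (add_zero 1)
        (assocInv _ _ _ (tmap (.id Z) (cut X) (add_zero 0) z)) := by
  have e : ∀ w : tensor Z (tensor (T X) (T X)),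
      tmap (insertHead b) (.id (T X)) (add_zero 1) (assocInv _ _ _ w) =
        consLeft X (T X) (tmap b (.id _) (add_zero 1) w) := by
    intro w
    have h : tmap b (.id (tensor (T X) (T X))) (add_zero 1) w =
        tmap b (tmap (.id (T X)) (.id (T X)) (add_zero 0)) (add_zero 1) w := by
      congr 2
      ext z
      exact (tmap_id z).symm
    rw [h, consLeft_apply, assocInv_natural b (.id (T X)) (.id (T X)) (add_zero 1) (add_zero 1),
      tmap_postcomp]
    rfl
  rw [e]
  induction z using tensor_induction with
  | h i j x t hx ht =>
    rw [insertHead, GrHom.comp_apply, tmap_tmul b _ _ x ht, map_zsmul, map_zsmul, GrHom.id_apply,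
      cut_tcons, tmap_tmul_zero, tmap_tmul b _ _ _ ((cut X).mem ht (add_zero j)), map_zsmul,
      map_zsmul, smul_add]
    rfl
  | hadd s t hs ht =>
    simp only [map_add, hs, ht]
    abel

theorem tpr0_insertHead (b : GrHom 1 Z X) (z : tensor Z (T X)) : tpr0 X (insertHead b z) = 0 :=
  tpr0_tcons _

variable (b₀ b₁ b₂) in
/-- The sum of the maps `b₀ ⊗ 1`, `b₁ ⊗ 1`, `b₂ ⊗ 1` applied at the beginning of a word. -/
def head : GrHom 1 (T X) (T X) :=
  (lidInv (T X)).comp (insertHead b₀) (zero_add 1) +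
    (uncons X).comp (insertHead b₁) (zero_add 1) +
    (uncons X).comp ((tmap (.id X) (uncons X)).comp ((assocInv _ _ _).comp (insertHead b₂)
      (zero_add 1)) (zero_add 1)) (zero_add 1)

theorem cut_head (z : T X) : cut X (head b₀ b₁ b₂ z) = tmul (tone X) (head b₀ b₁ b₂ z) +
    tmap (head b₀ b₁ b₂) (.id (T X)) (add_zero 1) (cut X z) := by
  have e₀ : assocInv _ _ _ (tmap (.id (unit 𝒦)) (cut X) (add_zero 0) (lidInv (T X) z)) =
      tmap (lidInv (T X)) (.id (T X)) (add_zero 0) (cut X z) := by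
    rw [lidInv_apply, tmap_tmul_zero, GrHom.id_apply]
    generalize cut X z = w
    induction w using tensor_induction with
    | h i j u v hu hv => rw [assocInv_tmul, tmap_tmul_zero]; rfl
    | hadd u v hu hv => simp only [map_add, hu, hv]
  have e₂ : assocInv _ _ _ (tmap (.id (tensor X X)) (cut X) (add_zero 0)
      (assocInv _ _ _ (tmap (.id X) (uncons X) (add_zero 0) (uncons X z)))) =
      tmap (assocInv _ _ _) (.id (T X)) (add_zero 0) (tmap (tmap (.id X) (uncons X) (add_zero 0))
        (.id (T X)) (add_zero 0) (tmap (uncons X) (.id (T X)) (add_zero 0) (cut X z))) := by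
    rw [← uncons_cut, ← assocInv_natural (.id X) (uncons X) (.id (T X)) (add_zero 0) (add_zero 0)
      (add_zero 0) (add_zero 0)]
    generalize uncons X z = w
    induction w using tensor_induction with
    | h i j x t hx ht =>
      rw [tmap_tmul_zero, tmap_tmul_zero, tmap_tmul_zero, ← uncons_cut]
      generalize uncons X t = w
      induction w using tensor_induction with
      | h i j y s hy hs =>
        rw [assocInv_tmul, tmap_tmul_zero, tmap_tmul_zero]
        generalize cut X s = w
        induction w using tensor_induction with
        | h i j u v hu hv =>
          rw [assocInv_tmul, assocInv_tmul, assocInv_tmul, tmap_tmul_zero]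
          rfl
        | hadd u v hu hv => simp only [map_add, hu, hv]
      | hadd u v hu hv => simp only [map_add, hu, hv]
    | hadd u v hu hv => simp only [map_add, hu, hv]
  simp only [head, GrHom.add_apply, tmap_add_left, map_add, GrHom.comp_apply, cut_insertHead]
  rw [e₀, e₂, uncons_cut]
  simp only [tmap_precomp]
  have h : ∀ x₀ y₀ x₁ y₁ x₂ y₂ : tensor (T X) (T X),
      x₀ + y₀ + (x₁ + y₁) + (x₂ + y₂) = x₀ + x₁ + x₂ + (y₀ + y₁ + y₂) := by intros; abel
  exact h _ _ _ _ _ _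

theorem lidInv_insertHead (b : GrHom 1 (unit 𝒦) X) (n : ℕ) (t : tpow X n) :
    insertHead b (lidInv (T X) (tinj X n t)) =
      tinjSucc X n (tmap b (.id (tpow X n)) (add_zero 1) (lidInv (tpow X n) t)) := by
  rw [lidInv_apply, lidInv_apply, ← insertHead_tinj, tmap_tmul_zero]
  rfl

theorem coder_tone : coder b₀ b₁ b₂ (tone X) = head b₀ b₁ b₂ (tone X) := by
  refine (tdesc_tinj _ 0 _).trans ?_
  simp only [head, GrHom.add_apply, GrHom.comp_apply, uncons_tone, map_zero, add_zero]
  exact (lidInv_insertHead b₀ 0 (one 𝒦)).symm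

theorem headPow_succ (n : ℕ) (t : tensor X (tpow X n)) :
    headPow b₀ b₁ b₂ (n + 1) t = head b₀ b₁ b₂ (tinjSucc X n t) := by
  simp only [head, GrHom.add_apply, GrHom.comp_apply, uncons_tinjSucc]
  have h₀ : insertHead b₀ (lidInv (T X) (tinjSucc X n t)) = _ := lidInv_insertHead b₀ (n + 1) t
  rw [h₀, insertHead_tinj]
  cases n with
  | zero =>
    have h₂ : tmap (.id X) (uncons X) (add_zero 0) (tmap (.id X) (tinj X 0) (add_zero 0) t) = 0 := by
      rw [tmap_precomp]
      have e : (tinj X 0).comp (uncons X) (add_zero 0) = 0 := by ext a; exact uncons_tinjZero a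
      rw [e, tmap_zero_right]
    rw [h₂, map_zero, map_zero, add_zero]
    rfl
  | succ n =>
    have h₂ : tmap (.id X) (uncons X) (add_zero 0)
        (tmap (.id X) (tinj X (n + 1)) (add_zero 0) t) =
        tmap (.id X) (tmap (.id X) (tinj X n) (add_zero 0)) (add_zero 0) t := by
      rw [tmap_precomp]
      congr 2
      ext z; exact uncons_tinjSucc n z
    have h₃ := assocInv_natural (.id X) (.id X) (tinj X n) (add_zero 0) (add_zero 0) (add_zero 0)
      (add_zero 0) t
    have h₄ : tmap (.id X) (.id X) (add_zero 0) = GrHom.id (tensor X X) := by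
      ext z; exact tmap_id z
    rw [h₂, h₃, h₄, insertHead_tinj]
    rfl

theorem coder_tcons (x : X) (t : T X) : coder b₀ b₁ b₂ (tcons X (tmul x t)) =
    head b₀ b₁ b₂ (tcons X (tmul x t)) + tcons X (tmul x (coder b₀ b₁ b₂ t)) := by
  induction t using T_tinj_induction with
  | h n t =>
    rw [tcons_tinj]
    refine (tdesc_tinj _ (n + 1) _).trans ?_
    refine congrArg₂ (fun z w : T X => z + w) (headPow_succ n _) ?_
    rw [coder, tdesc_tinj]
    exact congrArg (tcons X)
      (tmap_tmul_zero (.id X) (coderPow b₀ b₁ b₂ n) (zero_add 1) x t)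
  | hadd s t hs ht =>
    simp only [map_add, hs, ht]
    abel

theorem tpr0_head (z : T X) : tpr0 X (head b₀ b₁ b₂ z) = 0 := by
  simp only [head, GrHom.add_apply, GrHom.comp_apply, map_add, tpr0_insertHead, add_zero]

theorem tpr0_coder (z : T X) : tpr0 X (coder b₀ b₁ b₂ z) = 0 := by
  induction z using T_induction with
  | hone a => rw [map_smul, map_smul, coder_tone, tpr0_head, smul_zero]
  | hcons i j x t hx ht h => rw [coder_tcons, map_add, tpr0_head, tpr0_tcons, add_zero]
  | hadd s t hs ht => rw [map_add, map_add, hs, ht, add_zero]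

theorem tpr1_coder (z : T X) : tpr1 X (coder b₀ b₁ b₂ z) = tpr1 X (head b₀ b₁ b₂ z) := by
  induction z using T_induction with
  | hone a => rw [map_smul, map_smul, map_smul, map_smul, coder_tone]
  | hcons i j x t hx ht h =>
    rw [coder_tcons, map_add, tpr1_tcons, tpr0_coder, map_zero, map_zero, add_zero]
  | hadd s t hs ht => rw [map_add, map_add, map_add, map_add, hs, ht]

/-- The map `coder` is a coderivation: by `coder_tcons` it inserts `b₀ + b₁ + b₂` at each position
of a word. -/
theorem coder_coleibniz : (coder b₀ b₁ b₂).comp (cut X) (add_zero 1) =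
    (cut X).comp (tmap (.id (T X)) (coder b₀ b₁ b₂) + tmap (coder b₀ b₁ b₂) (.id (T X)))
      (zero_add 1) := by
  have e : ∀ x w, tmap (coder b₀ b₁ b₂) (.id (T X)) (add_zero 1) (consLeft X (T X) (tmul x w)) =
      tmap (head b₀ b₁ b₂) (.id (T X)) (add_zero 1) (consLeft X (T X) (tmul x w)) +
      consLeft X (T X) (tmul x (tmap (coder b₀ b₁ b₂) (.id (T X)) (add_zero 1) w)) := by
    intro x w
    induction w using tensor_induction with
    | h i j u v hu hv =>
      rw [consLeft_tmul, tmap_tmul _ _ _ _ hv, tmap_tmul _ _ _ _ hv, tmap_tmul _ _ _ _ hv,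
        map_zsmul, map_zsmul, ← smul_add, GrHom.id_apply, consLeft_tmul, coder_tcons, map_add,
        AddMonoidHom.add_apply]
    | hadd u v hu hv =>
      simp only [map_add, hu, hv]
      abel
  refine T_hom_ext ?_ fun i j x t hx ht h => ?_
  · rw [GrHom.comp_apply, GrHom.comp_apply, GrHom.add_apply, coder_tone, cut_head, cut_tone,
      tmap_tmul_zero, tmap_tmul _ _ _ _ tone_mem, tmap_tmul _ _ _ _ tone_mem, coder_tone]
    rfl
  · rw [GrHom.comp_apply, GrHom.comp_apply, GrHom.add_apply] at h
    rw [GrHom.comp_apply, GrHom.comp_apply, GrHom.add_apply, coder_tcons, map_add, cut_head,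
      cut_tcons, cut_tcons, h]
    simp only [map_add, e, tmap_consLeft_right]
    rw [tmap_tmul_zero, tmap_tmul_zero, tmap_tmul _ _ _ _ (tcons_mem hx ht rfl),
      tmap_tmul _ _ _ _ (tcons_mem hx ht rfl), coder_tone, coder_tcons, map_add]
    simp only [GrHom.id_apply]
    abel

end Coder

end GrMod

/-! ### Homomorphisms and coderivations into the tensor coalgebra -/

section Coalgebra

variable [GradedRing 𝒦] [GradedStronglyCommutative 𝒦] {C : CoalgData 𝒦} {X N : GrMod 𝒦} {d e n : ℤ}

theorem tmap_ε_left (hC : C.IsDifferential) (f : GrHom e C.X N) (c : C.X) :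
    tmap C.ε f (zero_add e) (C.δ₂ c) = lidInv N (f c) := by
  rw [← lidInv_lid (tmap C.ε f (zero_add e) (C.δ₂ c))]
  exact congrArg (lidInv N) (DFunLike.congr_fun (lact_ε hC f) c)

theorem tmap_ε_right (hC : C.IsDifferential) (f : GrHom e C.X N) (c : C.X) :
    tmap f C.ε (add_zero e) (C.δ₂ c) = ridInv N (f c) := by
  rw [← ridInv_rid (tmap f C.ε (add_zero e) (C.δ₂ c))]
  exact congrArg (ridInv N) (DFunLike.congr_fun (ract_ε hC f) c)

/-- A map `f : C → XT^≥` that is compatible with the counits and satisfies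
`f(c) = ψ(c₁) f(c₂)` after splitting off the first letter is a homomorphism of coalgebras. -/
theorem isCoalgHom_of_uncons (hC : C.IsDifferential) {f : GrHom 0 C.X (T X)} {ψ : GrHom 0 C.X X}
    (hε : f.comp (tpr0 X) (add_zero 0) = C.ε)
    (hu : f.comp (uncons X) (add_zero 0) = C.δ₂.comp (tmap ψ f) (add_zero 0)) :
    C.δ₂.comp (tmap f f) (add_zero 0) = f.comp (cut X) (add_zero 0) := by
  have hcut : ∀ n (z : T X), tmap ((uncons X).comp (tmap (.id X) (tpr X n)) (add_zero 0)) (.id (T X))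
      (add_zero 0) (cut X z) = assocInv _ _ _ (tmap (.id X)
        ((cut X).comp (tmap (tpr X n) (.id (T X))) (add_zero 0)) (add_zero 0) (uncons X z)) := by
    intro n z
    have h₁ := assocInv_natural (.id X) (tpr X n) (.id (T X)) (add_zero 0) (add_zero 0)
      (add_zero 0) (add_zero 0) (tmap (.id X) (cut X) (add_zero 0) (uncons X z))
    rw [uncons_cut, tmap_precomp, tmap_precomp] at h₁
    exact h₁.symm
  have key : ∀ n, f.comp ((cut X).comp (tmap (tpr X n) (.id (T X))) (add_zero 0)) (add_zero 0) =
      C.δ₂.comp (tmap (f.comp (tpr X n) (add_zero 0)) f) (add_zero 0) := by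
    intro n
    induction n with
    | zero =>
      ext c
      have h : tmap (tpr0 X) (.id (T X)) (add_zero 0) (cut X (f c)) = lidInv (T X) (f c) := by
        rw [← cut_counit_left (f c), lidInv_lid, cut_counit_left]
      have h' := tmap_ε_left hC f c
      rw [← hε] at h'
      exact h.trans h'.symm
    | succ n ih =>
      ext c
      refine (hcut n (f c)).trans ?_
      have huc : uncons X (f c) = tmap ψ f (add_zero 0) (C.δ₂ c) := DFunLike.congr_fun hu c
      have hco : tmap (.id C.X) C.δ₂ (add_zero 0) (C.δ₂ c) =
        assoc _ _ _ (tmap C.δ₂ (.id C.X) (add_zero 0) (C.δ₂ c)) := DFunLike.congr_fun hC.coassoc c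
      have h₁ : tmap ψ (C.δ₂.comp (tmap (f.comp (tpr X n) (add_zero 0)) f) (add_zero 0)) (add_zero 0)
          (C.δ₂ c) = tmap ψ (tmap (f.comp (tpr X n) (add_zero 0)) f (add_zero 0)) (add_zero 0)
            (tmap (.id C.X) C.δ₂ (add_zero 0) (C.δ₂ c)) := by
        rw [tmap_precomp]; rfl
      have h₂ : f.comp ((uncons X).comp (tmap (.id X) (tpr X n)) (add_zero 0)) (add_zero 0) =
          C.δ₂.comp (tmap ψ (f.comp (tpr X n) (add_zero 0)) (add_zero 0)) (add_zero 0) := by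
        ext c
        refine (congrArg (tmap (.id X) (tpr X n) (add_zero 0)) (DFunLike.congr_fun hu c)).trans ?_
        rw [GrHom.comp_apply, tmap_postcomp]
        rfl
      rw [huc, tmap_postcomp, ih]
      refine (congrArg (assocInv _ _ _) h₁).trans ?_
      rw [hco, assocInv_natural ψ (f.comp (tpr X n) (add_zero 0)) f (add_zero 0) (add_zero 0)
        (add_zero 0) (add_zero 0), assocInv_assoc, tmap_precomp]
      change _ = tmap (f.comp ((uncons X).comp (tmap (.id X) (tpr X n)) (add_zero 0)) (add_zero 0)) f
        (add_zero 0) (C.δ₂ c)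
      rw [h₂]
      rfl
  ext c
  refine tensor_T_eq_of_tpr fun n => ?_
  have h := DFunLike.congr_fun (key n) c
  rw [GrHom.comp_apply, GrHom.comp_apply, tmap_postcomp]
  exact h.symm

/-- The condition `F Δ = δ₂ (g ⊗ F + F ⊗ g)` for a map `F : C → XT^≥` to be a coderivation along
a map `g : C → XT^≥`. -/
def IsCoderivation (g : GrHom 0 C.X (T X)) (F : GrHom d C.X (T X)) : Prop :=
  F.comp (cut X) (add_zero d) =
    C.δ₂.comp (tmap g F (zero_add d) + tmap F g (add_zero d)) (zero_add d)

theorem IsCoderivation.sub {g : GrHom 0 C.X (T X)} {F G : GrHom d C.X (T X)}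
    (hF : IsCoderivation g F) (hG : IsCoderivation g G) : IsCoderivation g (F - G) := by
  rw [IsCoderivation] at hF hG ⊢
  rw [GrHom.sub_comp, hF, hG]
  ext c
  simp only [GrHom.sub_apply, GrHom.comp_apply, GrHom.add_apply, tmap_sub_left, tmap_sub_right]
  abel

theorem IsCoderivation.add {g : GrHom 0 C.X (T X)} {F G : GrHom d C.X (T X)}
    (hF : IsCoderivation g F) (hG : IsCoderivation g G) : IsCoderivation g (F + G) := by
  rw [IsCoderivation] at hF hG ⊢
  rw [GrHom.add_comp, hF, hG]
  ext c
  simp only [GrHom.comp_apply, GrHom.add_apply, tmap_add_left, tmap_add_right]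
  abel

/-- A coderivation into the tensor coalgebra is determined by its component `C → X`. -/
theorem IsCoderivation.eq_zero (hC : C.IsDifferential) {g : GrHom 0 C.X (T X)}
    (hg : g.comp (tpr0 X) (add_zero 0) = C.ε) {F : GrHom d C.X (T X)} (hF : IsCoderivation g F)
    (h₁ : ∀ c, tpr1 X (F c) = 0) : F = 0 := by
  have hc : ∀ c, cut X (F c) = tmap g F (zero_add d) (C.δ₂ c) + tmap F g (add_zero d) (C.δ₂ c) :=
    DFunLike.congr_fun hF
  have hF₁ : F.comp (tpr1 X) (add_zero d) = 0 := by ext c; exact h₁ c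
  have h₀ : ∀ c, tpr0 X (F c) = 0 := by
    intro c
    have h := congrArg (tpr0 X) (cut_counit_left (F c))
    rw [lid_natural, tmap_comp_zero _ _ _ _ _ _ (zero_add 0), hc, map_add, tmap_postcomp,
      tmap_postcomp, map_add] at h
    change lid _ (tmap (g.comp (tpr0 X) (add_zero 0)) (F.comp (tpr0 X) (add_zero d)) _ _) +
      lid _ (tmap (F.comp (tpr0 X) (add_zero d)) (g.comp (tpr0 X) (add_zero 0)) _ _) = _ at h
    rw [hg, lid_unit_eq_rid_unit (tmap (F.comp (tpr0 X) (add_zero d)) _ _ _), tmap_ε_left hC,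
      tmap_ε_right hC, lid_lidInv, rid_ridInv] at h
    exact add_eq_left.1 h
  have hu : ∀ c, uncons X (F c) = tmap (g.comp (tpr1 X) (add_zero 0)) F (zero_add d) (C.δ₂ c) := by
    intro c
    rw [← tmap_tpr1_cut, hc, map_add, tmap_postcomp, tmap_postcomp, hF₁, tmap_zero_left, add_zero]
    rfl
  have key : ∀ n, F.comp (tpr X n) (add_zero d) = 0 := by
    intro n
    induction n with
    | zero => ext c; exact h₀ c
    | succ n ih =>
      ext c
      refine (congrArg (tmap (.id X) (tpr X n) (add_zero 0)) (hu c)).trans ?_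
      rw [tmap_postcomp, ih, tmap_zero_right]
      rfl
  ext c
  exact eq_of_tpr fun n => (DFunLike.congr_fun (key n) c).trans (map_zero (tpr X n)).symm

/-- The commutator of a functional with a homomorphism of coalgebras is a coderivation. -/
theorem isCoderivation_commutator (hC : C.IsDifferential) {g : GrHom 0 C.X (T X)}
    (hg : C.δ₂.comp (tmap g g) (add_zero 0) = g.comp (cut X) (add_zero 0))
    (a : GrHom d C.X (unit 𝒦)) :
    IsCoderivation g (lact a g (add_zero d) - ract g a (zero_add d)) := by
  have hg' : ∀ c, tmap g g (add_zero 0) (C.δ₂ c) = cut X (g c) := DFunLike.congr_fun hg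
  have hco : ∀ c, tmap (.id C.X) C.δ₂ (add_zero 0) (C.δ₂ c) =
        assoc _ _ _ (tmap C.δ₂ (.id C.X) (add_zero 0) (C.δ₂ c)) := DFunLike.congr_fun hC.coassoc
  have hgc : g.comp (cut X) (add_zero 0) = C.δ₂.comp (tmap g g (add_zero 0)) (add_zero 0) := hg.symm
  -- The three positions of `a` in the triple coproduct.
  have h₁ : ∀ c, cut X (lact a g (add_zero d) c) =
      tmap (lact a g (add_zero d)) g (add_zero d) (C.δ₂ c) := by
    intro c
    rw [lact_apply, lid_natural, tmap_tmap a g (.id _) (cut X) _ _ (add_zero d) (add_zero 0) (by lia),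
      mul_zero, sg_zero, one_smul, hgc]
    have e : tmap (a.comp (.id _) (add_zero d)) (C.δ₂.comp (tmap g g (add_zero 0)) (add_zero 0))
        (add_zero d) (C.δ₂ c) = tmap a (tmap g g (add_zero 0)) (add_zero d)
          (tmap (.id C.X) C.δ₂ (add_zero 0) (C.δ₂ c)) := by rw [tmap_precomp]; rfl
    refine (congrArg (lid _) e).trans ?_
    rw [hco, ← assoc_natural a g g (add_zero d) (add_zero d) (add_zero 0), lid_assoc,
      tmap_precomp, tmap_postcomp]
    rfl
  have h₂ : ∀ c, cut X (ract g a (zero_add d) c) =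
      tmap g (ract g a (zero_add d)) (zero_add d) (C.δ₂ c) := by
    intro c
    rw [ract_apply, rid_natural, tmap_tmap g a (cut X) (.id _) _ _ (add_zero 0) (add_zero d) (by lia),
      mul_zero, sg_zero, one_smul, hgc]
    have e : tmap (C.δ₂.comp (tmap g g (add_zero 0)) (add_zero 0)) (a.comp (.id _) (add_zero d))
        (zero_add d) (C.δ₂ c) = tmap (tmap g g (add_zero 0)) a (zero_add d)
          (tmap C.δ₂ (.id C.X) (add_zero 0) (C.δ₂ c)) := by rw [tmap_precomp]; rfl
    refine (congrArg (rid _) e).trans ?_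
    rw [← rid_assoc, assoc_natural g g a (add_zero 0) (zero_add d) (zero_add d), ← hco,
      tmap_precomp, tmap_postcomp]
    rfl
  have h₃ : ∀ c, tmap g (lact a g (add_zero d)) (zero_add d) (C.δ₂ c) =
      tmap (ract g a (zero_add d)) g (add_zero d) (C.δ₂ c) := by
    intro c
    have e₁ : tmap g (lact a g (add_zero d)) (zero_add d) (C.δ₂ c) =
        tmap (.id _) (lid _) (add_zero 0) (tmap g (tmap a g (add_zero d)) (zero_add d)
          (tmap (.id C.X) C.δ₂ (add_zero 0) (C.δ₂ c))) := by
      rw [tmap_precomp, tmap_postcomp]; rfl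
    have e₂ : tmap (ract g a (zero_add d)) g (add_zero d) (C.δ₂ c) =
        tmap (rid _) (.id _) (add_zero 0) (tmap (tmap g a (zero_add d)) g (add_zero d)
          (tmap C.δ₂ (.id C.X) (add_zero 0) (C.δ₂ c))) := by
      rw [tmap_precomp, tmap_postcomp]; rfl
    rw [e₁, e₂, hco, ← assoc_natural g a g (zero_add d) (add_zero d) (add_zero d), tmap_lid_assoc]
  ext c
  simp only [GrHom.comp_apply, GrHom.sub_apply, GrHom.add_apply, map_sub, tmap_sub_left,
    tmap_sub_right]
  rw [h₁, h₂, h₃]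
  abel

theorem isCoderivation_δ₁_comp (hC : C.IsDifferential) {g : GrHom 0 C.X (T X)}
    (hg : C.δ₂.comp (tmap g g) (add_zero 0) = g.comp (cut X) (add_zero 0)) :
    IsCoderivation g (C.δ₁.comp g (add_zero 1)) := by
  ext c
  have h₁ : tmap g g (add_zero 0) (C.δ₂ (C.δ₁ c)) = cut X (g (C.δ₁ c)) :=
    DFunLike.congr_fun hg (C.δ₁ c)
  have h₂ : C.δ₂ (C.δ₁ c) = _ := DFunLike.congr_fun hC.coleibniz c
  rw [h₂, GrHom.comp_apply, GrHom.add_apply, map_add, tmap_postcomp, tmap_postcomp] at h₁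
  exact h₁.symm

theorem isCoderivation_comp {D : GrHom 1 (T X) (T X)}
    (hD : D.comp (cut X) (add_zero 1) =
      (cut X).comp (tmap (.id (T X)) D + tmap D (.id (T X))) (zero_add 1))
    {g : GrHom 0 C.X (T X)}
    (hg : C.δ₂.comp (tmap g g) (add_zero 0) = g.comp (cut X) (add_zero 0)) :
    IsCoderivation g (g.comp D (zero_add 1)) := by
  ext c
  have h₁ : tmap g g (add_zero 0) (C.δ₂ c) = cut X (g c) := DFunLike.congr_fun hg c
  have h₂ : cut X (D (g c)) = _ := DFunLike.congr_fun hD (g c)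
  rw [GrHom.comp_apply, ← h₁, GrHom.add_apply, tmap_precomp, tmap_precomp] at h₂
  exact h₂

end Coalgebra

/-! ### Cofreeness of the tensor coalgebra -/

namespace CoalgData

variable [GradedRing 𝒦] (C : CoalgData 𝒦)

theorem pr_inc (x : C.bar) : C.pr (C.inc x) = x := by
  refine Subtype.ext ?_
  change C.inc x - (show k from C.ε (C.inc x)) • C.w = C.inc x
  have h : C.ε (C.inc x) = 0 := x.2
  rw [h]
  exact (congrArg (C.inc x - ·) (zero_smul k C.w)).trans (sub_zero _)

theorem inc_pr (c : C.X) : C.inc (C.pr c) = c - (show k from C.ε c) • C.w := rfl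

theorem pr_w : C.pr C.w = 0 := by
  refine Subtype.ext ?_
  change C.w - (show k from C.ε C.w) • C.w = 0
  rw [C.ε_w]
  exact (congrArg (C.w - ·) (one_smul k C.w)).trans (sub_self _)

end CoalgData

section Cofree

variable [GradedRing 𝒦] [GradedStronglyCommutative 𝒦] {C : CoalgData 𝒦} {X P : GrMod 𝒦}

/-- The composite `C → C^{⊗ n} → X^{⊗ n}` of the iterated comultiplication with the power of
`ψ : C → X`. -/
def cofreePow (ψ : GrHom 0 C.X X) : ∀ n, GrHom 0 C.X (tpow X n)
  | 0 => C.ε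
  | n + 1 => C.δ₂.comp (tmap ψ (cofreePow ψ n)) (add_zero 0)

theorem redδ₂_pr (hC : C.IsDifferential) (c : C.X) :
    C.redδ₂ (C.pr c) = tmap C.pr C.pr (add_zero 0) (C.δ₂ c) := by
  change tmap C.pr C.pr (add_zero 0) (C.δ₂ (C.inc (C.pr c))) = _
  rw [C.inc_pr, map_sub, map_sub, map_smul, map_smul, hC.w_δ₂, tmap_tmul_zero, C.pr_w, map_zero,
    smul_zero, sub_zero]

/-- The map `cofreePow` factors through the iterated reduced comultiplication, so that it vanishes
for large `n` on each element of a conilpotent coalgebra. -/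
theorem cofreePow_eq (hC : C.IsDifferential) {ψ : GrHom 0 C.X X} (hψ : ψ C.w = 0) (n : ℕ)
    (c : C.X) : cofreePow ψ (n + 1) c =
      tpowMap (C.inc.comp ψ (add_zero 0)) (n + 1) (C.iterδ₂ n (C.pr c)) := by
  have hpr : C.pr.comp (C.inc.comp ψ (add_zero 0)) (add_zero 0) = ψ := by
    ext c
    change ψ (C.inc (C.pr c)) = ψ c
    rw [C.inc_pr, map_sub, map_smul, hψ, smul_zero, sub_zero]
  induction n generalizing c with
  | zero =>
    refine (tmap_ε_right hC ψ c).trans ?_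
    refine Eq.trans ?_ (tmap_tmul_zero (C.inc.comp ψ (add_zero 0)) (.id (unit 𝒦)) (add_zero 0)
      (C.pr c) (one 𝒦)).symm
    rw [ridInv_apply]
    exact congrArg (fun y => tmul y (one 𝒦)) (DFunLike.congr_fun hpr c).symm
  | succ n ih =>
    have ih' : cofreePow ψ (n + 1) = C.pr.comp ((C.iterδ₂ n).comp
        (tpowMap (C.inc.comp ψ (add_zero 0)) (n + 1)) (add_zero 0)) (add_zero 0) := by
      ext c; exact ih c
    change tmap ψ (cofreePow ψ (n + 1)) (add_zero 0) (C.δ₂ c) =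
      tmap (C.inc.comp ψ (add_zero 0)) (tpowMap (C.inc.comp ψ (add_zero 0)) (n + 1)) (add_zero 0)
        (tmap (.id C.bar) (C.iterδ₂ n) (add_zero 0) (C.redδ₂ (C.pr c)))
    rw [ih', redδ₂_pr hC, tmap_precomp, tmap_precomp]
    exact congrArg (fun f => tmap f _ (add_zero 0) (C.δ₂ c)) hpr.symm

/-- Each iterated reduced comultiplication factors through the preceding one. -/
theorem iterδ₂_eq_zero_of_le {x : C.bar} {m n : ℕ} (h : C.iterδ₂ n x = 0) (hmn : n ≤ m) :
    C.iterδ₂ m x = 0 := by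
  have key : ∀ n, ∃ L : GrHom 0 (tpow C.bar (n + 1)) (tpow C.bar (n + 2)),
      C.iterδ₂ (n + 1) = (C.iterδ₂ n).comp L (add_zero 0) := by
    intro n
    induction n with
    | zero =>
      refine ⟨(rid C.bar).comp (C.iterδ₂ 1) (add_zero 0), ?_⟩
      ext x
      exact (congrArg (C.iterδ₂ 1) (rid_ridInv x)).symm
    | succ n ih =>
      obtain ⟨L, hL⟩ := ih
      refine ⟨tmap (.id C.bar) L (add_zero 0), ?_⟩
      ext x
      change tmap (.id C.bar) (C.iterδ₂ (n + 1)) (add_zero 0) (C.redδ₂ x) =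
        tmap (.id C.bar) L (add_zero 0) (tmap (.id C.bar) (C.iterδ₂ n) (add_zero 0) (C.redδ₂ x))
      rw [hL, tmap_precomp]
      rfl
  induction m, hmn using Nat.le_induction with
  | base => exact h
  | succ m _ ih =>
    obtain ⟨L, hL⟩ := key m
    rw [hL, GrHom.comp_apply, ih, map_zero]

theorem exists_cofreePow_eq_zero (hC : C.IsCurvedAugmented) {ψ : GrHom 0 C.X X} (hψ : ψ C.w = 0)
    (c : C.X) : ∃ N, ∀ n ≥ N, cofreePow ψ n c = 0 := by
  obtain ⟨N, _, hN⟩ := hC.conilpotent (C.pr c)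
  refine ⟨N + 1, fun n hn => ?_⟩
  obtain ⟨m, rfl⟩ : ∃ m, n = m + 1 := ⟨n - 1, by lia⟩
  rw [cofreePow_eq hC.isDifferential hψ, iterδ₂_eq_zero_of_le hN (by lia), map_zero]

/-- The map `C → XT^≥` with components `cofreePow ψ n`, provided that on each element only
finitely many of them do not vanish. -/
def cofree (ψ : GrHom 0 C.X X) (h : ∀ c, ∃ N, ∀ n ≥ N, cofreePow ψ n c = 0) :
    GrHom 0 C.X (T X) :=
  -- The range is chosen for each element; the map is linear because its components do not depend on
  -- the choice.
  have key : ∀ c n, tpr X n (∑ m ∈ Finset.range (h c).choose, tinj X m (cofreePow ψ m c)) =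
      cofreePow ψ n c := by
    intro c n
    rw [map_sum]
    by_cases hn : n < (h c).choose
    · rw [Finset.sum_eq_single n (fun m _ hm => tpr_tinj_of_ne hm.symm _)
        (fun h => absurd (Finset.mem_range.2 hn) h), tpr_tinj]
    · rw [(h c).choose_spec n (not_lt.1 hn)]
      exact Finset.sum_eq_zero fun m hm =>
        tpr_tinj_of_ne (by have := Finset.mem_range.1 hm; lia) _
  { lin :=
      { toFun := fun c => ∑ n ∈ Finset.range (h c).choose, tinj X n (cofreePow ψ n c)
        map_add' := fun c c' => eq_of_tpr fun n => by rw [map_add, key, key, key, map_add]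
        map_smul' := fun a c => eq_of_tpr fun n => by
          rw [RingHom.id_apply, map_smul, key, key, map_smul] }
    mem' := fun {i c} hc => sum_mem fun n _ =>
      (tinj X n).mem ((cofreePow ψ n).mem hc (add_zero i)) rfl }

theorem tpr_cofree (ψ : GrHom 0 C.X X) (h) (n : ℕ) (c : C.X) :
    tpr X n (cofree ψ h c) = cofreePow ψ n c := by
  change tpr X n (∑ m ∈ Finset.range (h c).choose, tinj X m (cofreePow ψ m c)) = _
  rw [map_sum]
  by_cases hn : n < (h c).choose
  · rw [Finset.sum_eq_single n (fun m _ hm => tpr_tinj_of_ne hm.symm _)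
      (fun h => absurd (Finset.mem_range.2 hn) h), tpr_tinj]
  · rw [(h c).choose_spec n (not_lt.1 hn)]
    exact Finset.sum_eq_zero fun m hm => tpr_tinj_of_ne (by have := Finset.mem_range.1 hm; lia) _

theorem cofree_tpr0 (ψ : GrHom 0 C.X X) (h) : (cofree ψ h).comp (tpr0 X) (add_zero 0) = C.ε := by
  ext c; exact tpr_cofree ψ h 0 c

theorem cofree_uncons (ψ : GrHom 0 C.X X) (h) : (cofree ψ h).comp (uncons X) (add_zero 0) =
    C.δ₂.comp (tmap ψ (cofree ψ h)) (add_zero 0) := by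
  ext c
  refine tensor_eq_of_tpr fun n => ?_
  refine (tpr_cofree ψ h (n + 1) c).trans ?_
  rw [GrHom.comp_apply, tmap_postcomp]
  have e : (cofree ψ h).comp (tpr X n) (add_zero 0) = cofreePow ψ n := by
    ext c; exact tpr_cofree ψ h n c
  rw [e]
  rfl

theorem cofree_isCoalgHom (hC : C.IsDifferential) (ψ : GrHom 0 C.X X) (h) :
    C.δ₂.comp (tmap (cofree ψ h) (cofree ψ h)) (add_zero 0) =
      (cofree ψ h).comp (cut X) (add_zero 0) :=
  isCoalgHom_of_uncons hC (cofree_tpr0 ψ h) (cofree_uncons ψ h)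

theorem tpr1_cofree (hC : C.IsDifferential) (ψ : GrHom 0 C.X X) (h) (c : C.X) :
    tpr1 X (cofree ψ h c) = ψ c := by
  have e := DFunLike.congr_fun (cofree_uncons ψ h) c
  rw [GrHom.comp_apply, GrHom.comp_apply] at e
  rw [tpr1, GrHom.comp_apply, GrHom.comp_apply, e, tmap_postcomp, cofree_tpr0, tmap_ε_right hC,
    rid_ridInv]
  rfl

theorem cofree_w (hC : C.IsDifferential) {ψ : GrHom 0 C.X X} (hψ : ψ C.w = 0) (h) :
    cofree ψ h C.w = tone X := by
  refine eq_of_tpr fun n => ?_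
  rw [tpr_cofree]
  cases n with
  | zero => exact C.ε_w.trans (tpr0_tone).symm
  | succ n =>
    refine Eq.trans ?_ (tpr_tinj_of_ne (Nat.succ_ne_zero n) (one 𝒦)).symm
    change tmap ψ (cofreePow ψ n) (add_zero 0) (C.δ₂ C.w) = 0
    rw [hC.w_δ₂, tmap_tmul_zero, hψ, map_zero, AddMonoidHom.zero_apply]

/-- A homomorphism of coalgebras to the tensor coalgebra is determined by its component
`C → X`. -/
theorem eq_of_tpr1_comp {f g : GrHom 0 C.X (T X)}
    (hf : C.δ₂.comp (tmap f f) (add_zero 0) = f.comp (cut X) (add_zero 0))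
    (hg : C.δ₂.comp (tmap g g) (add_zero 0) = g.comp (cut X) (add_zero 0))
    (hfε : f.comp (tpr0 X) (add_zero 0) = C.ε) (hgε : g.comp (tpr0 X) (add_zero 0) = C.ε)
    (h : f.comp (tpr1 X) (add_zero 0) = g.comp (tpr1 X) (add_zero 0)) : f = g := by
  have key : ∀ {f : GrHom 0 C.X (T X)},
      C.δ₂.comp (tmap f f) (add_zero 0) = f.comp (cut X) (add_zero 0) →
      f.comp (tpr0 X) (add_zero 0) = C.ε → ∀ n c, tpr X n (f c) =
        cofreePow (f.comp (tpr1 X) (add_zero 0)) n c := by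
    intro f hf hfε n
    induction n with
    | zero => exact DFunLike.congr_fun hfε
    | succ n ih =>
      intro c
      have e : f.comp (tpr X n) (add_zero 0) = cofreePow (f.comp (tpr1 X) (add_zero 0)) n := by
        ext c; exact ih c
      have hfc : tmap f f (add_zero 0) (C.δ₂ c) = cut X (f c) := DFunLike.congr_fun hf c
      change tmap (.id X) (tpr X n) (add_zero 0) (uncons X (f c)) =
        tmap (f.comp (tpr1 X) (add_zero 0)) (cofreePow (f.comp (tpr1 X) (add_zero 0)) n) (add_zero 0)
          (C.δ₂ c)
      rw [← tmap_tpr1_cut, ← hfc, tmap_postcomp, tmap_postcomp, ← e]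
      rfl
  ext c
  exact eq_of_tpr fun n => by rw [key hf hfε, key hg hgε, h]

end Cofree

section TensorCoalgebra

variable [GradedRing 𝒦] [GradedStronglyCommutative 𝒦] {X Y P : GrMod 𝒦}

/-- The tensor coalgebra `XT^≥` with the cut comultiplication, the coderivation with components
`b₀`, `b₁`, `b₂`, and a functional as curvature. -/
def tensorCoalg (b₀ : GrHom 1 (unit 𝒦) X) (b₁ : GrHom 1 X X) (b₂ : GrHom 1 (tensor X X) X)
    (δ₀ : GrHom 2 (T X) (unit 𝒦)) : CoalgData 𝒦 where
  X := T X
  δ₂ := cut X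
  δ₁ := coder b₀ b₁ b₂
  δ₀ := δ₀
  ε := tpr0 X
  w := tone X
  w_mem := tone_mem
  ε_w := tpr0_tone

variable (b₀ : GrHom 1 (unit 𝒦) X) (b₁ : GrHom 1 X X) (b₂ : GrHom 1 (tensor X X) X)
    (δ₀ : GrHom 2 (T X) (unit 𝒦))

theorem tensorCoalg_isDifferential : (tensorCoalg b₀ b₁ b₂ δ₀).IsDifferential where
  coassoc := by ext z; exact cut_coassoc z
  counit_right := by ext z; exact cut_counit_right z
  counit_left := by ext z; exact cut_counit_left z
  coleibniz := coder_coleibniz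
  δ₁_ε := tpr0_coder
  w_δ₂ := cut_tone

/-- A map applied to the last part of the deconcatenations of a word gives zero if it vanishes on all
words that are at most as long. -/
theorem tmap_id_cut_eq_zero {F : GrHom 0 (T X) P} {m : ℕ}
    (hF : ∀ j ≤ m, ∀ t, F (tinj X j t) = 0) (t : tpow X m) :
    tmap (.id (T X)) F (add_zero 0) (cut X (tinj X m t)) = 0 := by
  induction m with
  | zero =>
    change unit 𝒦 at t
    change tmap (.id (T X)) F (add_zero 0) (cut X (tinjZero X t)) = 0
    have h : F (tone X) = 0 := hF 0 le_rfl (one 𝒦)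
    rw [tinjZero_apply, map_smul, map_smul, cut_tone, tmap_tmul_zero, h, map_zero, smul_zero]
  | succ m ih =>
    change ((tinjSucc X m).comp (cut X) (add_zero 0)).comp (tmap (.id (T X)) F (add_zero 0))
      (add_zero 0) t = (0 : GrHom 0 (tensor X (tpow X m)) _) t
    congr 1
    refine tensor_hom_ext fun i j x t hx ht => ?_
    rw [GrHom.comp_apply, GrHom.comp_apply, ← tcons_tinj, cut_tcons, map_add, tmap_tmul_zero,
      tmap_consLeft_right, tmap_tmul_zero, ih (fun j hj => hF j (by lia)), map_zero, map_zero,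
      add_zero]
    have h : F (tcons X (tmul x (tinj X m t))) = 0 := by
      rw [tcons_tinj]; exact hF (m + 1) le_rfl _
    rw [h, map_zero]
    rfl

/-- A word of length `m < n` has no deconcatenation into `n` nonempty parts. -/
theorem cofreePow_tinj_eq_zero {ψ : GrHom 0 (T X) P} (hψ : ψ (tone X) = 0) {m n : ℕ} (h : m < n)
    (t : tpow X m) : cofreePow (C := tensorCoalg b₀ b₁ b₂ δ₀) ψ n (tinj X m t) = 0 := by
  induction n generalizing m with
  | zero => lia
  | succ n ih =>
    let F : GrHom 0 (T X) (tpow P n) := cofreePow (C := tensorCoalg b₀ b₁ b₂ δ₀) ψ n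
    change tmap ψ F (add_zero 0) (cut X (tinj X m t)) = 0
    cases m with
    | zero =>
      change unit 𝒦 at t
      change tmap ψ F (add_zero 0) (cut X (tinjZero X t)) = 0
      rw [tinjZero_apply, map_smul, map_smul, cut_tone, tmap_tmul_zero, hψ, map_zero,
        AddMonoidHom.zero_apply, smul_zero]
    | succ m =>
      change ((tinjSucc X m).comp (cut X) (add_zero 0)).comp (tmap ψ F (add_zero 0))
        (add_zero 0) t = (0 : GrHom 0 (tensor X (tpow X m)) _) t
      congr 1
      refine tensor_hom_ext fun i j x t hx ht => ?_
      have e : tmap ψ F (add_zero 0) (consLeft X (T X) (tmul x (cut X (tinj X m t)))) =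
          tmap ψ (.id _) (add_zero 0) (tmap (.id (T X)) F (add_zero 0)
            (consLeft X (T X) (tmul x (cut X (tinj X m t))))) := by
        rw [tmap_precomp]; rfl
      rw [GrHom.comp_apply, GrHom.comp_apply, ← tcons_tinj, cut_tcons, map_add, e, tmap_tmul_zero,
        hψ, map_zero, AddMonoidHom.zero_apply, zero_add, tmap_consLeft_right, tmap_tmul_zero,
        tmap_id_cut_eq_zero (fun j hj => ih (by lia)), map_zero, map_zero, map_zero]
      rfl

theorem tpowMap_id (n : ℕ) (t : tpow X n) : tpowMap (.id X) n t = t := by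
  induction n with
  | zero => rfl
  | succ n ih =>
    have e : tpowMap (.id X) n = .id (tpow X n) := by ext t; exact ih t
    change tmap (.id X) (tpowMap (.id X) n) (add_zero 0) t = _
    rw [e]
    exact tmap_id t

theorem tensorCoalg_conilpotent (x : (tensorCoalg b₀ b₁ b₂ δ₀).bar) :
    ∃ n : ℕ, 0 < n ∧ (tensorCoalg b₀ b₁ b₂ δ₀).iterδ₂ n x = 0 := by
  let C := tensorCoalg b₀ b₁ b₂ δ₀
  obtain ⟨N, hN⟩ := exists_eq_sum_tinj (X := X) (C.inc x)
  refine ⟨N + 1, Nat.succ_pos N, ?_⟩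
  have h := cofreePow_eq (tensorCoalg_isDifferential b₀ b₁ b₂ δ₀) C.pr_w (N + 1) (C.inc x)
  have e : C.inc.comp C.pr (add_zero 0) = .id _ := by ext x; exact C.pr_inc x
  rw [e, tpowMap_id, C.pr_inc] at h
  refine h.symm.trans ?_
  refine (congrArg (cofreePow C.pr (N + 1 + 1)) (hN N le_rfl)).trans ?_
  refine (map_sum (cofreePow C.pr (N + 1 + 1)) _ _).trans (Finset.sum_eq_zero fun n hn => ?_)
  exact cofreePow_tinj_eq_zero b₀ b₁ b₂ δ₀ C.pr_w (by have := Finset.mem_range.1 hn; lia) _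

/-- The square of a coderivation of degree `1` is a coderivation. -/
theorem isCoderivation_coder_coder : IsCoderivation (C := tensorCoalg b₀ b₁ b₂ δ₀) (.id (T X))
    ((coder b₀ b₁ b₂).comp (coder b₀ b₁ b₂) one_add_one_eq_two) := by
  have hD : ∀ z, cut X (coder b₀ b₁ b₂ z) = _ :=
    DFunLike.congr_fun (coder_coleibniz (b₀ := b₀) (b₁ := b₁) (b₂ := b₂))
  refine GrHom.ext fun (z : T X) => ?_
  change cut X (coder b₀ b₁ b₂ (coder b₀ b₁ b₂ z)) =
    tmap (.id (T X)) ((coder b₀ b₁ b₂).comp (coder b₀ b₁ b₂) one_add_one_eq_two) (zero_add 2)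
      (cut X z) +
    tmap ((coder b₀ b₁ b₂).comp (coder b₀ b₁ b₂) one_add_one_eq_two) (.id (T X)) (add_zero 2)
      (cut X z)
  rw [hD]
  simp only [GrHom.comp_apply, GrHom.add_apply]
  rw [hD]
  simp only [GrHom.comp_apply, GrHom.add_apply, map_add]
  rw [tmap_tmap _ _ _ _ (zero_add 1) (zero_add 1) (zero_add 0) one_add_one_eq_two (by lia),
    tmap_tmap _ _ _ _ (zero_add 1) (add_zero 1) (zero_add 1) (add_zero 1) (by lia),
    tmap_tmap _ _ _ _ (add_zero 1) (zero_add 1) (add_zero 1) (zero_add 1) (by lia),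
    tmap_tmap _ _ _ _ (add_zero 1) (add_zero 1) one_add_one_eq_two (add_zero 0) (by lia)]
  simp only [mul_zero, mul_one, sg_zero, sg_one, one_smul, neg_smul]
  have h : ∀ a b c : tensor (T X) (T X), a + b + (-b + c) = a + c := by intros; abel
  exact h _ _ _

theorem tMap_tone (f : GrHom 0 X Y) : tMap f (tone X) = tone Y := tdesc_tinj _ 0 _

theorem tMap_tcons (f : GrHom 0 X Y) (x : X) (t : T X) :
    tMap f (tcons X (tmul x t)) = tcons Y (tmul (f x) (tMap f t)) := by
  induction t using T_tinj_induction with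
  | h n t =>
    rw [tcons_tinj]
    refine (tdesc_tinj _ (n + 1) _).trans ?_
    rw [tMap, tdesc_tinj, GrHom.comp_apply (tpowMap f n), tcons_tinj]
    exact congrArg (tinjSucc Y n) (tmap_tmul_zero f (tpowMap f n) (add_zero 0) x t)
  | hadd s t hs ht => simp only [map_add, hs, ht]

theorem tpr0_tMap (f : GrHom 0 X Y) : (tMap f).comp (tpr0 Y) (add_zero 0) = tpr0 X := by
  refine T_hom_ext ?_ fun i j x t hx ht h => ?_
  · rw [GrHom.comp_apply, tMap_tone, tpr0_tone, tpr0_tone]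
  · rw [GrHom.comp_apply, tMap_tcons, tpr0_tcons, tpr0_tcons]

theorem tpr1_tMap (f : GrHom 0 X Y) (z : T X) : tpr1 Y (tMap f z) = f (tpr1 X z) := by
  induction z using T_induction with
  | hone a => rw [map_smul, map_smul, map_smul, map_smul, tMap_tone, tpr1_tone, tpr1_tone, map_zero]
  | hcons i j x t hx ht h =>
    rw [tMap_tcons, tpr1_tcons, tpr1_tcons, rid_natural, tmap_tmul_zero]
    exact congrArg (fun a => rid Y (tmul (f x) a)) (DFunLike.congr_fun (tpr0_tMap f) t)
  | hadd s t hs ht => simp only [map_add, hs, ht]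

theorem tMap_isCoalgHom (f : GrHom 0 X Y) : (cut X).comp (tmap (tMap f) (tMap f)) (add_zero 0) =
    (tMap f).comp (cut Y) (add_zero 0) := by
  refine isCoalgHom_of_uncons (C := tensorCoalg 0 0 0 0) (ψ := (tpr1 X).comp f (add_zero 0))
    (tensorCoalg_isDifferential 0 0 0 0) (tpr0_tMap f) ?_
  refine T_hom_ext ?_ fun i j x t hx ht h => ?_
  · change uncons Y (tMap f (tone X)) = tmap ((tpr1 X).comp f (add_zero 0)) (tMap f) (add_zero 0)
      (cut X (tone X))
    rw [tMap_tone, uncons_tone, cut_tone, tmap_tmul_zero, GrHom.comp_apply, tpr1_tone, map_zero,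
      map_zero, AddMonoidHom.zero_apply]
  · change uncons Y (tMap f (tcons X (tmul x t))) =
      tmap ((tpr1 X).comp f (add_zero 0)) (tMap f) (add_zero 0) (cut X (tcons X (tmul x t)))
    have e : tmap ((tpr1 X).comp f (add_zero 0)) (tMap f) (add_zero 0)
        (cut X (tcons X (tmul x t))) = tmap f (tMap f) (add_zero 0)
          (tmap (tpr1 X) (.id (T X)) (add_zero 0) (cut X (tcons X (tmul x t)))) := by
      rw [tmap_precomp]; rfl
    rw [e, tmap_tpr1_cut, tMap_tcons, uncons_tcons, uncons_tcons, tmap_tmul_zero]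

end TensorCoalgebra

/-! ### The bar construction and its universal twisting cochain -/

namespace GrMod

variable [GradedRing 𝒦] {X Z P : GrMod 𝒦} {d : ℤ}

theorem tensor_T_hom_ext {f g : GrHom d (tensor Z (T X)) P}
    (hone : ∀ i x, x ∈ Z.gr i → f (tmul x (tone X)) = g (tmul x (tone X)))
    (hcons : ∀ i x, x ∈ Z.gr i → ∀ z, f (tmul x (tcons X z)) = g (tmul x (tcons X z))) : f = g := by
  refine tensor_hom_ext fun i j x t hx ht => ?_
  clear ht
  induction t using T_induction with
  | hone a =>
    induction a using ring_induction 𝒦 with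
    | h l a ha =>
      rw [tmul_smul_right _ ha hx, map_zsmul, map_zsmul, map_smul, map_smul, hone i x hx]
    | hadd a b ha hb => simp only [add_smul, map_add, ha, hb]
  | hcons i' j' y t hy ht h => exact hcons i x hx _
  | hadd s t hs ht => simp only [map_add, hs, ht]

/-- Maps on `XT^≥` agree if they agree on words of length `0`, `1`, `2` and on all words of length
at least `3`. -/
theorem T_hom_ext_words {f g : GrHom d (T X) P} (h₀ : f (tone X) = g (tone X))
    (h₁ : ∀ x, f (tinj1 X x) = g (tinj1 X x))
    (h₂ : ∀ x y, f (tcons X (tmul x (tinj1 X y))) = g (tcons X (tmul x (tinj1 X y))))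
    (h₃ : ∀ x y z, f (tcons X (tmul x (tcons X (tmul y (tcons X z))))) =
      g (tcons X (tmul x (tcons X (tmul y (tcons X z)))))) : f = g := by
  have e : (tcons X).comp f (zero_add d) = (tcons X).comp g (zero_add d) := by
    refine tensor_T_hom_ext (fun i x _ => ?_) fun i x hx z => ?_
    · rw [GrHom.comp_apply, GrHom.comp_apply, ← tinj1_apply, h₁]
    · obtain ⟨p, hp⟩ : ∃ p : GrHom 0 (tensor (tensor X X) (T X)) (T X),
          ∀ x y t, p (tmul (tmul x y) t) = tcons X (tmul x (tcons X (tmul y t))) :=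
        ⟨(assoc _ _ _).comp
          ((tmap (.id X) (tcons X) (add_zero 0)).comp (tcons X) (add_zero 0)) (add_zero 0),
          fun x y t => congrArg (tcons X)
            (tmap_tmul_zero (.id X) (tcons X) (add_zero 0) x (tmul y t))⟩
      have e' : p.comp f (zero_add d) = p.comp g (zero_add d) := by
        refine tensor_T_hom_ext (fun i w hw => ?_) fun i w hw z => ?_
        all_goals clear hw
        · induction w using tensor_induction with
          | h i j x y hx hy =>
            rw [GrHom.comp_apply, GrHom.comp_apply, hp, ← tinj1_apply, h₂]
          | hadd v w hv hw => simp only [map_add, AddMonoidHom.add_apply, hv, hw]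
        · induction w using tensor_induction with
          | h i j x y hx hy => rw [GrHom.comp_apply, GrHom.comp_apply, hp, h₃]
          | hadd v w hv hw => simp only [map_add, AddMonoidHom.add_apply, hv, hw]
      induction z using tensor_induction with
      | h i j y t hy ht =>
        have h := DFunLike.congr_fun e' (tmul (tmul x y) t)
        rw [GrHom.comp_apply, GrHom.comp_apply, hp] at h
        exact h
      | hadd v w hv hw => simp only [map_add, hv, hw]
  exact T_hom_ext h₀ fun i j x t _ _ _ => DFunLike.congr_fun e (tmul x t)

variable [GradedStronglyCommutative 𝒦]

theorem tpr1_insertHead (b : GrHom 1 Z X) (z : tensor Z (T X)) :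
    tpr1 X (insertHead b z) = rid X (tmap b (tpr0 X) (add_zero 1) z) := by
  change rid X (tmap (.id X) (tpr0 X) (add_zero 0) (uncons X (tcons X
    (tmap b (.id (T X)) (add_zero 1) z)))) = _
  rw [uncons_tcons, tmap_postcomp]
  rfl

variable (b₀ : GrHom 1 (unit 𝒦) X) (b₁ : GrHom 1 X X) (b₂ : GrHom 1 (tensor X X) X)

theorem rid_tmap_tmul_one (b : GrHom d Z X) (x : Z) :
    rid X (tmap b (tpr0 X) (add_zero d) (tmul x (tone X))) = b x := by
  rw [tmap_tmul _ _ _ _ tone_mem, mul_zero, sg_zero, one_smul, tpr0_tone]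
  exact rid_ridInv (b x)

theorem tmap_tpr0_tcons (b : GrHom d Z P) (x : Z) (z : tensor X (T X)) :
    tmap b (tpr0 X) (add_zero d) (tmul x (tcons X z)) = 0 := by
  have h : tmap b (tpr0 X) (add_zero d) (tmul x (tcons X z)) =
      tmap b ((tcons X).comp (tpr0 X) (add_zero 0)) (add_zero d) (tmul x z) := by
    refine (congrArg (tmap b (tpr0 X) (add_zero d))
      (tmap_tmul_zero (.id Z) (tcons X) (add_zero 0) x z).symm).trans ?_
    exact tmap_precomp _ _ _ _ _ _
  have e : (tcons X).comp (tpr0 X) (add_zero 0) = 0 := by ext z; exact tpr0_tcons z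
  rw [h, e, tmap_zero_right]

theorem tpr1_coder_tone : tpr1 X (coder b₀ b₁ b₂ (tone X)) = b₀ (one 𝒦) := by
  rw [tpr1_coder, head]
  simp only [GrHom.add_apply, GrHom.comp_apply, uncons_tone, map_zero, add_zero]
  rw [tpr1_insertHead, lidInv_apply, rid_tmap_tmul_one]

theorem tpr1_coder_tcons (x : X) (t : T X) : tpr1 X (coder b₀ b₁ b₂ (tcons X (tmul x t))) =
    rid X (tmap b₁ (tpr0 X) (add_zero 1) (tmul x t)) +
      rid X (tmap b₂ (tpr0 X) (add_zero 1) (assocInv _ _ _ (tmul x (uncons X t)))) := by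
  rw [tpr1_coder, head]
  simp only [GrHom.add_apply, GrHom.comp_apply, map_add]
  rw [tpr1_insertHead, tpr1_insertHead, tpr1_insertHead, lidInv_apply, tmap_tpr0_tcons, map_zero,
    zero_add, uncons_tcons, tmap_tmul_zero]
  rfl

theorem tpr1_coder_tinj1 (x : X) : tpr1 X (coder b₀ b₁ b₂ (tinj1 X x)) = b₁ x := by
  rw [tinj1_apply, tpr1_coder_tcons, rid_tmap_tmul_one, uncons_tone, map_zero, map_zero, map_zero,
    map_zero, add_zero]

theorem tpr1_coder_tcons_tinj1 (x y : X) :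
    tpr1 X (coder b₀ b₁ b₂ (tcons X (tmul x (tinj1 X y)))) = b₂ (tmul x y) := by
  rw [tinj1_apply, tpr1_coder_tcons, tmap_tpr0_tcons, map_zero, zero_add, uncons_tcons,
    assocInv_tmul, rid_tmap_tmul_one]

theorem tpr1_coder_tcons_tcons_tcons (x y : X) (z : tensor X (T X)) :
    tpr1 X (coder b₀ b₁ b₂ (tcons X (tmul x (tcons X (tmul y (tcons X z)))))) = 0 := by
  rw [tpr1_coder_tcons, tmap_tpr0_tcons, map_zero, zero_add, uncons_tcons,
    assocInv_tmul, tmap_tpr0_tcons, map_zero]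

end GrMod

namespace AlgData

variable [GradedRing 𝒦] (A : AlgData 𝒦)

/-- The inclusion `Ā[1] → A`, of degree `1`. -/
def desusp : GrHom 1 A.sbar A.X := A.sinc.comp A.σinv (zero_add 1)

/-- The projection `A → Ā[1]`, of degree `-1`. -/
def susp : GrHom (-1) A.X A.sbar := A.σ.comp A.spr (add_zero (-1))

theorem desusp_susp (a : A.X) : A.desusp (A.susp a) = a - (show k from A.v a) • A.one := rfl

theorem desusp_susp_of_v {a : A.X} (h : A.v a = 0) : A.desusp (A.susp a) = a := by
  rw [desusp_susp, h]
  exact (congrArg (a - ·) (zero_smul k A.one)).trans (sub_zero a)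

theorem v_desusp (x : A.sbar) : A.v (A.desusp x) = 0 := x.2

theorem desusp_injective {x y : A.sbar} (h : A.desusp x = A.desusp y) : x = y := Subtype.ext h

theorem susp_desusp (x : A.sbar) : A.susp (A.desusp x) = x :=
  A.desusp_injective (A.desusp_susp_of_v (A.v_desusp x))

theorem v_η (a : unit 𝒦) : A.v (A.η a) = a := by
  refine (map_smul A.v (show k from a) A.one).trans ?_
  rw [A.v_one]
  exact GrMod.smul_one _

theorem susp_η (a : unit 𝒦) : A.susp (A.η a) = 0 := by
  refine A.desusp_injective ?_
  rw [desusp_susp, v_η, map_zero]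
  exact sub_self _

theorem desusp_bbar₀ :
    A.desusp (A.bbar₀ (GrMod.one 𝒦)) = A.curv - (show k from A.v A.curv) • A.one := by
  refine Eq.trans ?_ (A.desusp_susp A.curv)
  exact congrArg (fun a => A.desusp (A.susp a)) (one_smul k A.curv)

theorem desusp_bbar₁ (x : A.sbar) : A.desusp (A.bbar₁ x) =
    -(A.d (A.desusp x) - (show k from A.v (A.d (A.desusp x))) • A.one) := by
  rw [← desusp_susp, ← map_neg A.desusp, ← map_neg A.susp]
  rfl

theorem desusp_bbar₂ (x y : A.sbar) : A.desusp (A.bbar₂ (tmul x y)) =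
    -(A.mul (tmap A.desusp A.desusp one_add_one_eq_two (tmul x y)) -
      (show k from A.v (A.mul (tmap A.desusp A.desusp one_add_one_eq_two (tmul x y)))) • A.one) := by
  have h : tmap A.desusp A.desusp one_add_one_eq_two (tmul x y) =
      tmap A.σinv A.σinv one_add_one_eq_two (tmap A.sinc A.sinc (add_zero 0) (tmul x y)) := by
    rw [tmap_precomp]; rfl
  rw [h, ← desusp_susp, ← map_neg A.desusp, ← map_neg A.susp]
  rfl

variable [GradedStronglyCommutative 𝒦]

/-- The curvature of `Bar A`, as a functional on `Ā[1]T^≥`. -/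
def barCurv : GrHom 2 (T A.sbar) (unit 𝒦) := tdesc A.barδ₀

theorem barCurv_tone : A.barCurv (tone A.sbar) = -A.v A.curv := by
  refine (tdesc_tinj A.barδ₀ 0 _).trans ?_
  exact congrArg (fun a => -A.v a) (one_smul k A.curv)

theorem barCurv_tinj1 (x : A.sbar) : A.barCurv (tinj1 A.sbar x) = A.v (A.d (A.desusp x)) := by
  refine (tdesc_tinj A.barδ₀ 1 _).trans ?_
  change -A.v (A.σinv (A.b₁ (A.sinc (rid A.sbar (ridInv A.sbar x))))) = _
  rw [rid_ridInv, ← map_neg A.v, ← map_neg A.σinv]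
  exact congrArg A.v (neg_neg _)

theorem barCurv_tcons_tinj1 (x y : A.sbar) : A.barCurv (tcons A.sbar (tmul x (tinj1 A.sbar y))) =
    A.v (A.mul (tmap A.desusp A.desusp one_add_one_eq_two (tmul x y))) := by
  rw [← tinj2_tmul]
  refine (tdesc_tinj A.barδ₀ 2 _).trans ?_
  change -A.v (A.σinv (A.b₂ (tmap A.sinc A.sinc (add_zero 0) (tmap (.id A.sbar) (rid A.sbar)
    (add_zero 0) (tmap (.id A.sbar) (ridInv A.sbar) (add_zero 0) (tmul x y)))))) = _
  have h : tmap A.desusp A.desusp one_add_one_eq_two (tmul x y) =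
      tmap A.σinv A.σinv one_add_one_eq_two (tmap A.sinc A.sinc (add_zero 0) (tmul x y)) := by
    rw [tmap_precomp]; rfl
  rw [tmap_tmul_zero (.id A.sbar), tmap_tmul_zero (.id A.sbar), rid_ridInv, ← map_neg A.v,
    ← map_neg A.σinv, h]
  exact congrArg A.v (neg_neg _)

theorem barCurv_tcons_tcons_tcons (x y : A.sbar) (z : tensor A.sbar (T A.sbar)) :
    A.barCurv (tcons A.sbar (tmul x (tcons A.sbar (tmul y (tcons A.sbar z))))) = 0 := by
  induction z using tensor_induction with
  | h i j z t hz ht =>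
    clear ht
    induction t using T_tinj_induction with
    | h n t =>
      rw [tcons_tinj]
      have e₁ : tcons A.sbar (tmul y (tinjSucc A.sbar n (tmul z t))) =
          tinjSucc A.sbar (n + 1) (tmul y (tmul z t)) := tcons_tinj y (n + 1) _
      rw [e₁]
      exact (congrArg A.barCurv (tcons_tinj x (n + 2) _)).trans (tdesc_tinj A.barδ₀ (n + 3) _)
    | hadd s t hs ht => rw [map_add, map_add, map_add, map_add, map_add, map_add, map_add, hs, ht,
        add_zero]
  | hadd s t hs ht => rw [map_add, map_add, map_add, map_add, map_add, map_add, hs, ht, add_zero]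

/-- The universal twisting cochain `Bar A → Ā[1] → A`. -/
def barτ : GrHom 1 (T A.sbar) A.X := (tpr1 A.sbar).comp A.desusp (zero_add 1)

theorem barτ_apply (z : T A.sbar) : A.barτ z = A.desusp (tpr1 A.sbar z) := rfl

theorem barτ_tone : A.barτ (tone A.sbar) = 0 := by rw [barτ_apply, tpr1_tone, map_zero]

theorem barτ_tinj1 (x : A.sbar) : A.barτ (tinj1 A.sbar x) = A.desusp x := by
  rw [barτ_apply, tpr1_tinj1]

theorem barτ_tcons_tcons (x : A.sbar) (z : tensor A.sbar (T A.sbar)) :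
    A.barτ (tcons A.sbar (tmul x (tcons A.sbar z))) = 0 := by
  rw [barτ_apply, tpr1_tcons_tcons, map_zero]

theorem v_barτ (z : T A.sbar) : A.v (A.barτ z) = 0 := A.v_desusp _

/-- The convolution square of the universal twisting cochain. -/
def barτSq : GrHom 2 (T A.sbar) A.X :=
  (cut A.sbar).comp ((tmap A.barτ A.barτ one_add_one_eq_two).comp A.mul (add_zero 2)) (zero_add 2)

theorem barτSq_tone : A.barτSq (tone A.sbar) = 0 := by
  change A.mul (tmap A.barτ A.barτ one_add_one_eq_two (cut A.sbar (tone A.sbar))) = 0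
  rw [cut_tone, tmap_tmul _ _ _ _ tone_mem, barτ_tone, map_zero, smul_zero, map_zero]

theorem barτSq_tcons (z : tensor A.sbar (T A.sbar)) :
    A.barτSq (tcons A.sbar z) = A.mul (tmap A.desusp A.barτ one_add_one_eq_two z) := by
  have h : tmap A.desusp A.barτ one_add_one_eq_two z =
      tmap A.desusp A.barτ one_add_one_eq_two (tmap (tpr1 A.sbar) (.id (T A.sbar)) (add_zero 0)
        (cut A.sbar (tcons A.sbar z))) := by rw [tmap_tpr1_cut, uncons_tcons]
  rw [h, tmap_precomp]
  rfl

theorem barτSq_tinj1 (x : A.sbar) : A.barτSq (tinj1 A.sbar x) = 0 := by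
  rw [tinj1_apply, barτSq_tcons, tmap_tmul _ _ _ _ tone_mem, barτ_tone, map_zero, smul_zero,
    map_zero]

theorem barτSq_tcons_tinj1 (x y : A.sbar) :
    A.barτSq (tcons A.sbar (tmul x (tinj1 A.sbar y))) =
      A.mul (tmap A.desusp A.desusp one_add_one_eq_two (tmul x y)) := by
  have e : (tinj1 A.sbar).comp A.barτ (zero_add 1) = A.desusp := by
    ext x; exact A.barτ_tinj1 x
  have h := tmap_tmul_zero (.id A.sbar) (tinj1 A.sbar) (add_zero 0) x y
  rw [barτSq_tcons]
  refine (congrArg (fun z => A.mul (tmap A.desusp A.barτ one_add_one_eq_two z)) h.symm).trans ?_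
  rw [tmap_precomp, e]
  rfl

theorem barτSq_tcons_tcons_tcons (x y : A.sbar) (z : tensor A.sbar (T A.sbar)) :
    A.barτSq (tcons A.sbar (tmul x (tcons A.sbar (tmul y (tcons A.sbar z))))) = 0 := by
  induction z using tensor_induction with
  | h i j z t hz ht =>
    induction y using A.sbar.induction with
    | h l y hy =>
      rw [barτSq_tcons, tmap_tmul _ _ _ _ (tcons_mem hy (tcons_mem hz ht rfl) rfl),
        barτ_tcons_tcons, map_zero, smul_zero, map_zero]
    | hadd s t hs ht => rw [map_add, AddMonoidHom.add_apply, map_add, map_add, map_add, map_add,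
        hs, ht, add_zero]
  | hadd s t hs ht => rw [map_add, map_add, map_add, map_add, map_add, map_add, hs, ht, add_zero]

/-- On words of length `0`, `1`, `2` the Maurer-Cartan equation for the universal cochain is the
decomposition of `m₀`, `m₁`, `m₂` into their components in `Ā` and in `k η`. On longer words all its
terms vanish. -/
theorem isTwisting_barτ : IsTwisting (C := A.barData) A.barτ := by
  have hη : ∀ a, A.η a = (show k from a) • A.one := fun a => rfl
  have h : A.m₀ (GrMod.one 𝒦) = A.curv := one_smul k A.curv
  change A.barτ.comp A.d one_add_one_eq_two +
      (coder A.bbar₀ A.bbar₁ A.bbar₂).comp A.barτ one_add_one_eq_two + A.barτSq =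
    A.barCurv.comp A.η (add_zero 2) + (tpr0 A.sbar).comp A.m₀ (zero_add 2)
  refine T_hom_ext_words ?_ (fun x => ?_) (fun x y => ?_) (fun x y z => ?_)
  · simp only [GrHom.add_apply, GrHom.comp_apply]
    rw [A.barτ_apply (coder _ _ _ _), tpr1_coder_tone, desusp_bbar₀, barτSq_tone, barτ_tone,
      barCurv_tone, tpr0_tone, h, map_neg, map_zero, hη]
    abel
  · simp only [GrHom.add_apply, GrHom.comp_apply]
    rw [A.barτ_apply (coder _ _ _ _), tpr1_coder_tinj1, barτSq_tinj1, desusp_bbar₁, barτ_tinj1,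
      barCurv_tinj1, hη, tinj1_apply, tpr0_tcons, map_zero]
    abel
  · simp only [GrHom.add_apply, GrHom.comp_apply]
    rw [A.barτ_apply (coder _ _ _ _), tpr1_coder_tcons_tinj1, barτSq_tcons_tinj1, desusp_bbar₂,
      barCurv_tcons_tinj1, hη, tpr0_tcons, map_zero, tinj1_apply, barτ_tcons_tcons, map_zero]
    abel
  · simp only [GrHom.add_apply, GrHom.comp_apply]
    rw [A.barτ_apply (coder _ _ _ _), tpr1_coder_tcons_tcons_tcons, barτSq_tcons_tcons_tcons,
      barCurv_tcons_tcons_tcons, tpr0_tcons, barτ_tcons_tcons, map_zero, map_zero, map_zero,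
      map_zero, add_zero]

end AlgData

/-! ### The bar functor -/

section Bar

variable [GradedRing 𝒦] [GradedStronglyCommutative 𝒦] {C D : CoalgData 𝒦} {A B : AlgData 𝒦} {d : ℤ}

/-- For a curved algebra the right-hand side of the Bianchi identity vanishes. -/
theorem IsTwisting.δ₁_δ₁_comp (hC : C.IsDifferential) (hA : A.IsCurved) {θ : GrHom 1 C.X A.X}
    (hθ : IsTwisting θ) :
    (C.δ₁.comp C.δ₁ one_add_one_eq_two).comp θ (n := 3) rfl - (ract θ C.δ₀ - lact C.δ₀ θ) =
      (C.δ₁.comp C.δ₀ (n := 3) rfl).comp A.η (add_zero 3) := by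
  rw [← sub_eq_zero]
  refine (hθ.bianchi hC hA.isDifferential).trans ?_
  have hm : A.m₀.comp A.d (n := 3) rfl = 0 := unit_hom_ext <|
    (congrArg A.d (one_smul k A.curv)).trans hA.d_curv
  rw [hm, GrHom.comp_zero, sub_zero]
  ext c
  rw [GrHom.sub_apply, GrHom.sub_apply, conv_ε_m₀ hC, conv_m₀_ε hC, GrHom.comp_apply,
    GrHom.comp_apply, hA.d_d, sub_self]
  rfl

namespace AlgData

theorem η_comp_v : A.η.comp A.v (add_zero 0) = .id (unit 𝒦) := by ext a; exact A.v_η a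

variable (A) in
/-- The universal twisting cochain, as a map on the underlying module of `Bar A`. -/
def barTwist : GrHom 1 A.barData.X A.X := A.barτ

variable (A) in
theorem isTwisting_barTwist : IsTwisting A.barTwist := A.isTwisting_barτ

variable (A) in
theorem v_barTwist (z : A.barData.X) : A.v (A.barTwist z) = 0 := A.v_barτ z

theorem barTwist_comp_v : A.barTwist.comp A.v (add_zero 1) = 0 := by ext z; exact A.v_barTwist z

variable (A) in
theorem barData_isDifferential : A.barData.IsDifferential := tensorCoalg_isDifferential _ _ _ _

theorem eq_zero_of_isCoderivation (hD : D.IsDifferential) {g : GrHom 0 D.X A.barData.X}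
    (hg : g.comp A.barData.ε (add_zero 0) = D.ε) {F : GrHom d D.X A.barData.X}
    (hF : IsCoderivation (X := A.sbar) g F) (h : F.comp A.barTwist rfl = 0) : F = 0 :=
  IsCoderivation.eq_zero (X := A.sbar) hD hg hF fun c =>
    A.desusp_injective ((DFunLike.congr_fun h c).trans (map_zero A.desusp).symm)

/-- The composite with `v` of the Bianchi identity for the universal cochain: `v` annihilates the
universal cochain and splits `η`. -/
theorem IsCurved.barData_δ₁_δ₀ (hA : A.IsCurved) :
    A.barData.δ₁.comp A.barData.δ₀ (n := 3) rfl = 0 := by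
  have h := A.isTwisting_barTwist.δ₁_δ₁_comp A.barData_isDifferential hA
  have h' := congrArg (fun f => f.comp A.v (add_zero 3)) h
  simp only [GrHom.sub_comp] at h'
  rw [ract_comp _ _ A.v _ _ (add_zero 1), lact_comp _ _ A.v _ _ (add_zero 1),
    GrHom.comp_assoc _ A.barTwist A.v _ _ (add_zero 1), barTwist_comp_v,
    GrHom.comp_assoc _ A.η A.v _ _ (add_zero 0), η_comp_v] at h'
  refine h'.symm.trans ?_
  ext z
  simp only [GrHom.sub_apply, GrHom.comp_apply, GrHom.zsmul_apply, ract_apply, lact_apply]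
  rw [tmap_zero_left, tmap_zero_right, map_zero, map_zero, smul_zero, sub_zero, sub_zero]
  rfl

/-- Both sides are coderivations, and the Bianchi identity says that their components in `Ā[1]`
agree. -/
theorem IsCurved.barData_δ₁_δ₁ (hA : A.IsCurved) : A.barData.δ₁.comp A.barData.δ₁ one_add_one_eq_two =
    ract (.id A.barData.X) A.barData.δ₀ (zero_add 2) -
      lact A.barData.δ₀ (.id A.barData.X) (add_zero 2) := by
  have h := A.isTwisting_barTwist.δ₁_δ₁_comp A.barData_isDifferential hA
  rw [hA.barData_δ₁_δ₀, GrHom.zero_comp] at h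
  have hg : A.barData.δ₂.comp (tmap (.id A.barData.X) (.id A.barData.X)) (add_zero 0) =
      (GrHom.id A.barData.X).comp A.barData.δ₂ (add_zero 0) := by ext z; exact tmap_id _
  have hF : IsCoderivation (C := A.barData) (X := A.sbar) (.id A.barData.X)
      (A.barData.δ₁.comp A.barData.δ₁ one_add_one_eq_two +
        (lact A.barData.δ₀ (.id A.barData.X) (add_zero 2) -
          ract (.id A.barData.X) A.barData.δ₀ (zero_add 2))) :=
    (isCoderivation_coder_coder A.bbar₀ A.bbar₁ A.bbar₂ A.barCurv).add
      (isCoderivation_commutator A.barData_isDifferential hg A.barCurv)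
  have h₀ := eq_zero_of_isCoderivation A.barData_isDifferential rfl hF (by
    refine Eq.trans ?_ h
    rw [GrHom.add_comp, GrHom.sub_comp, lact_comp _ _ A.barTwist _ _ (zero_add 1),
      ract_comp _ _ A.barTwist _ _ (zero_add 1), sg_eq (n := 0) ⟨1, rfl⟩, sg_zero, one_smul,
      sub_eq_add_neg _ (ract _ _ _ - _), neg_sub]
    rfl)
  rw [← sub_eq_zero, ← h₀, sub_eq_add_neg, neg_sub]

theorem IsCurved.barData_isCurvedAugmented (hA : A.IsCurved) : A.barData.IsCurvedAugmented where
  coassoc := A.barData_isDifferential.coassoc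
  counit_right := A.barData_isDifferential.counit_right
  counit_left := A.barData_isDifferential.counit_left
  coleibniz := A.barData_isDifferential.coleibniz
  δ₁_δ₁ := hA.barData_δ₁_δ₁
  δ₁_δ₀ := DFunLike.congr_fun hA.barData_δ₁_δ₀
  δ₁_ε := A.barData_isDifferential.δ₁_ε
  w_δ₂ := A.barData_isDifferential.w_δ₂
  conilpotent := tensorCoalg_conilpotent _ _ _ _

end AlgData

namespace CoalgPair

theorem pull_apply (g : CoalgPair C D) (θ : GrHom 1 D.X A.X) (c : C.X) :
    g.pull θ c = θ (g.g₁ c) + A.η (g.g₀ c) := rfl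

theorem comp_pull {E : CoalgData 𝒦} (f : CoalgPair C D) (g : CoalgPair D E) (θ : GrHom 1 E.X A.X) :
    (f.comp g).pull θ = f.pull (g.pull θ) := by
  ext c
  simp only [pull_apply]
  change θ (g.g₁ (f.g₁ c)) + A.η (f.g₀ c + g.g₀ (f.g₁ c)) = _
  rw [map_add]
  abel

theorem pull_comp (g : CoalgPair C D) (θ : GrHom 1 D.X A.X) {f : GrHom 0 A.X B.X}
    (hf : f A.one = B.one) :
    g.pull (θ.comp f (add_zero 1)) = (g.pull θ).comp f (add_zero 1) := by
  ext c
  simp only [pull_apply, GrHom.comp_apply, map_add]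
  congr 1
  refine Eq.trans ?_ (map_smul f (show k from g.g₀ c) A.one).symm
  rw [hf]
  rfl

theorem v_pull_barTwist (g : CoalgPair C A.barData) (c : C.X) :
    A.v (g.pull A.barTwist c) = g.g₀ c := by
  rw [pull_apply, map_add, A.v_η, A.v_barTwist, zero_add]

theorem susp_pull_barTwist (g : CoalgPair C A.barData) (c : C.X) :
    A.susp (g.pull A.barTwist c) = tpr1 A.sbar (g.g₁ c) := by
  rw [pull_apply, map_add, A.susp_η, add_zero]
  exact A.susp_desusp _

/-- A morphism to the bar construction is determined by the twisting cochain that it induces. -/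
theorem eq_of_pull_barTwist {g g' : CoalgPair C A.barData}
    (hg : C.δ₂.comp (tmap g.g₁ g.g₁) (add_zero 0) = g.g₁.comp A.barData.δ₂ (add_zero 0))
    (hg' : C.δ₂.comp (tmap g'.g₁ g'.g₁) (add_zero 0) = g'.g₁.comp A.barData.δ₂ (add_zero 0))
    (hε : g.g₁.comp A.barData.ε (add_zero 0) = C.ε)
    (hε' : g'.g₁.comp A.barData.ε (add_zero 0) = C.ε)
    (h : g.pull A.barTwist = g'.pull A.barTwist) : g = g' := by
  refine CoalgPair.ext (eq_of_tpr1_comp hg hg' hε hε' ?_) ?_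
  · ext c
    exact (g.susp_pull_barTwist c).symm.trans ((congrArg (fun f => A.susp (f c)) h).trans
      (g'.susp_pull_barTwist c))
  · ext c
    rw [← v_pull_barTwist, h, v_pull_barTwist]

/-- A homomorphism of coalgebras and a functional form a morphism to the bar construction if the
cochain induced by the universal one is twisting. -/
theorem isHom_of_isTwisting_pull (hC : C.IsDifferential) (hA : A.IsDifferential)
    {g : CoalgPair C A.barData}
    (map_δ₂ : C.δ₂.comp (tmap g.g₁ g.g₁) (add_zero 0) = g.g₁.comp A.barData.δ₂ (add_zero 0))
    (map_ε : g.g₁.comp A.barData.ε (add_zero 0) = C.ε) (map_w : g.g₁ C.w = A.barData.w)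
    (w_g₀ : g.g₀ C.w = 0) (h : IsTwisting (g.pull A.barTwist)) : g.IsHom := by
  have hd := A.isTwisting_barTwist.pull_defect hA map_δ₂ map_ε
  rw [sub_eq_zero.2 h] at hd
  have h₀ : g.defect₀ = 0 := by
    ext c
    have hc := congrArg A.v (DFunLike.congr_fun hd c)
    rw [GrHom.sub_apply, map_sub, GrHom.comp_apply, A.v_η, GrHom.zero_apply, map_zero] at hc
    have e : A.v (g.defect₁.comp A.barTwist one_add_one_eq_two c) = 0 := A.v_barTwist _
    rw [e, sub_zero] at hc
    exact hc.symm
  rw [h₀, GrHom.zero_comp, zero_sub] at hd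
  refine isHom_of_defect map_δ₂ map_ε map_w w_g₀ ?_ h₀
  have hF : IsCoderivation g.g₁ g.defect₁ :=
    ((isCoderivation_comp coder_coleibniz map_δ₂).sub (isCoderivation_δ₁_comp hC map_δ₂)).sub
      (isCoderivation_commutator hC map_δ₂ g.g₀)
  exact AlgData.eq_zero_of_isCoderivation hC map_ε hF (neg_eq_zero.1 hd.symm)

end CoalgPair

namespace AlgData

theorem barMap_g₀ (f : GrHom 0 A.X B.X) (z : T A.sbar) :
    (barMap f).g₀ z = B.v (f (A.barτ z)) := by
  suffices h : tdesc (barMap₀ f) = A.barτ.comp (f.comp B.v (add_zero 0)) (add_zero 1) from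
    DFunLike.congr_fun h z
  ext z
  induction z using T_tinj_induction with
  | h n t =>
    rw [tdesc_tinj]
    match n with
    | 0 =>
      change unit 𝒦 at t
      change 0 = B.v (f (A.barτ (tinjZero A.sbar t)))
      rw [tinjZero_apply, map_smul, barτ_tone, smul_zero, map_zero, map_zero]
    | 1 =>
      change tensor A.sbar (unit 𝒦) at t
      obtain ⟨x, rfl⟩ : ∃ x, ridInv A.sbar x = t := ⟨_, ridInv_rid t⟩
      change B.v (f (A.desusp (rid A.sbar (ridInv A.sbar x)))) = B.v (f (A.barτ (tinj1 A.sbar x)))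
      rw [rid_ridInv, barτ_tinj1]
    | n + 2 =>
      have h : (tinjSucc A.sbar (n + 1)).comp (tpr1 A.sbar) (add_zero 0) = 0 := by
        refine tensor_hom_ext fun i j x t _ _ => ?_
        rw [GrHom.comp_apply, ← tcons_tinj, tpr1_tcons]
        have e : tpr0 A.sbar (tinj A.sbar (n + 1) t) = 0 := tdesc_tinj _ (n + 1) t
        rw [e, map_zero, map_zero]
        rfl
      have h' : tpr1 A.sbar (tinj A.sbar (n + 2) t) = 0 := DFunLike.congr_fun h t
      change 0 = B.v (f (A.desusp (tpr1 A.sbar (tinj A.sbar (n + 2) t))))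
      rw [h', map_zero, map_zero, map_zero]
  | hadd s t hs ht => rw [map_add, map_add, hs, ht]

theorem desusp_spr (f : GrHom 0 A.X B.X) (x : A.sbar) :
    A.sinc.comp ((shiftMap 1 f).comp B.spr (add_zero 0)) (add_zero 0) x = B.susp (f (A.desusp x)) :=
  rfl

/-- The twisting cochain induced by the morphism `Bar f` is the composite of the universal twisting
cochain with `f`. -/
theorem barMap_pull (f : GrHom 0 A.X B.X) :
    (barMap f).pull B.barTwist = A.barTwist.comp f (add_zero 1) := by
  refine GrHom.ext fun (z : T A.sbar) => (CoalgPair.pull_apply _ _ _).trans ?_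
  refine (congrArg₂ (· + ·) (congrArg B.desusp (tpr1_tMap _ z))
    (congrArg B.η (barMap_g₀ f z))).trans ?_
  rw [desusp_spr, desusp_susp]
  exact sub_add_cancel _ _

theorem barMap_map_δ₂ (f : GrHom 0 A.X B.X) :
    A.barData.δ₂.comp (tmap (barMap f).g₁ (barMap f).g₁) (add_zero 0) =
      (barMap f).g₁.comp B.barData.δ₂ (add_zero 0) := tMap_isCoalgHom _

theorem barMap_map_ε (f : GrHom 0 A.X B.X) :
    (barMap f).g₁.comp B.barData.ε (add_zero 0) = A.barData.ε := tpr0_tMap _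

theorem barMap_isHom (hB : B.IsDifferential) {f : GrHom 0 A.X B.X} (hf : IsAlgHom f) :
    (barMap f).IsHom := by
  refine CoalgPair.isHom_of_isTwisting_pull A.barData_isDifferential hB (barMap_map_δ₂ f)
    (barMap_map_ε f) (tMap_tone _) ?_ ?_
  · refine (barMap_g₀ f _).trans ?_
    change B.v (f (A.barτ (tone A.sbar))) = 0
    rw [barτ_tone, map_zero, map_zero]
  · rw [barMap_pull]
    exact A.isTwisting_barTwist.comp_algHom hf

end AlgData

variable (𝒦) in
theorem barIsFunctor : BarIsFunctor 𝒦 where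
  obj A := A.isCurved.barData_isCurvedAugmented
  map {A B} f := AlgData.barMap_isHom B.isCurved.isDifferential f.isAlgHom
  map_id A := by
    have h := CoalgPair.IsHom.id A.barData
    refine CoalgPair.eq_of_pull_barTwist (AlgData.barMap_map_δ₂ _) h.map_δ₂ (AlgData.barMap_map_ε _)
      h.map_ε ?_
    rw [AlgData.barMap_pull]
    ext z
    refine Eq.trans ?_ (CoalgPair.pull_apply _ _ _).symm
    change A.barTwist z = A.barTwist z + A.η 0
    rw [map_zero, add_zero]
  map_comp {A B C} f g := by
    have h := (AlgData.barMap_isHom B.isCurved.isDifferential f.isAlgHom).comp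
      (AlgData.barMap_isHom C.isCurved.isDifferential g.isAlgHom)
    refine CoalgPair.eq_of_pull_barTwist (AlgData.barMap_map_δ₂ _) h.map_δ₂ (AlgData.barMap_map_ε _)
      h.map_ε ?_
    rw [AlgData.barMap_pull, CoalgPair.comp_pull, AlgData.barMap_pull,
      CoalgPair.pull_comp _ _ g.isAlgHom.map_one, AlgData.barMap_pull]
    rfl

end Bar

/-! ### The cobar functor -/

section Cobar

variable [GradedRing 𝒦] [GradedStronglyCommutative 𝒦] {C D : CoalgData 𝒦} {A B : AlgData 𝒦} {d : ℤ}

/-- For a twisting cochain that vanishes on `w`, the Maurer-Cartan equation at `w` computes the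
curvature of the algebra. -/
theorem IsTwisting.curv_eq (hC : C.IsDifferential) {θ : GrHom 1 C.X A.X} (hθ : IsTwisting θ)
    (hw : θ C.w = 0) : A.curv = θ (C.δ₁ C.w) - A.η (C.δ₀ C.w) := by
  have h := DFunLike.congr_fun hθ C.w
  simp only [GrHom.add_apply, GrHom.comp_apply] at h
  rw [conv_apply_w hC.w_δ₂, hw, map_zero, map_zero, map_zero, zero_add, add_zero, C.ε_w] at h
  rw [h, add_sub_cancel_left]
  exact (one_smul k A.curv).symm

/-- For a curved augmented coalgebra the left-hand side of the Bianchi identity vanishes. -/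
theorem IsTwisting.comp_d_d (hC : C.IsCurvedAugmented) (hA : A.IsDifferential)
    {θ : GrHom 1 C.X A.X} (hθ : IsTwisting θ) (c : C.X) :
    A.d (A.d (θ c)) - (A.mul (tmul A.curv (θ c)) - A.mul (tmul (θ c) A.curv)) =
      (show k from C.ε c) • A.d A.curv := by
  have h := DFunLike.congr_fun (hθ.bianchi hC.isDifferential hA) c
  have h₀ : C.δ₁.comp C.δ₀ (n := 3) rfl = 0 := by ext c; exact hC.δ₁_δ₀ c
  have h₁ : C.δ₁.comp C.δ₁ one_add_one_eq_two =
    ract (.id C.X) C.δ₀ (zero_add 2) - lact C.δ₀ (.id C.X) (add_zero 2) := hC.δ₁_δ₁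
  rw [h₀, h₁, GrHom.zero_comp, sub_zero, GrHom.sub_comp, lact_comp _ _ θ _ _ (zero_add 1),
    ract_comp _ _ θ _ _ (zero_add 1), sg_eq (n := 0) ⟨1, rfl⟩, sg_zero, one_smul] at h
  simp only [GrHom.sub_apply, conv_ε_m₀ hC.isDifferential, conv_m₀_ε hC.isDifferential,
    GrHom.comp_apply] at h
  have h' := h.symm.trans (sub_self _)
  rw [sub_eq_zero.1 h']
  exact map_smul A.d (show k from C.ε c) A.curv

/-- The Bianchi identity at `w`. -/
theorem IsTwisting.d_curv (hC : C.IsCurvedAugmented) (hA : A.IsDifferential)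
    {θ : GrHom 1 C.X A.X} (hθ : IsTwisting θ) (hw : θ C.w = 0) : A.d A.curv = 0 := by
  have h := hθ.comp_d_d hC hA C.w
  simp only [hw, map_zero, AddMonoidHom.zero_apply, sub_zero] at h
  have e : (show k from C.ε C.w) • A.d A.curv = A.d A.curv :=
    (congrArg (fun a : k => a • A.d A.curv) C.ε_w).trans (one_smul k _)
  exact e.symm.trans h.symm

theorem IsTwisting.d_d (hC : C.IsCurvedAugmented) (hA : A.IsDifferential)
    {θ : GrHom 1 C.X A.X} (hθ : IsTwisting θ) (hw : θ C.w = 0) (c : C.X) :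
    A.d (A.d (θ c)) = A.mul (tmul A.curv (θ c)) - A.mul (tmul (θ c) A.curv) := by
  rw [← sub_eq_zero, hθ.comp_d_d hC hA, hθ.d_curv hC hA hw, smul_zero]

namespace CoalgData

variable (C) in
/-- The map `C → C̄[-1]`, of degree `1`. -/
def susp : GrHom 1 C.X C.sbar := C.σinv.comp C.spr (add_zero 1)

variable (C) in
/-- The inclusion `C̄[-1] → C`, of degree `-1`. -/
def desusp : GrHom (-1) C.sbar C.X := C.sinc.comp C.σ (zero_add (-1))

theorem desusp_susp (c : C.X) : C.desusp (C.susp c) = c - (show k from C.ε c) • C.w := rfl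

theorem susp_desusp (x : C.sbar) : C.susp (C.desusp x) = x := C.pr_inc x

theorem susp_w : C.susp C.w = 0 := C.pr_w

variable (C) in
/-- The universal twisting cochain `C → C̄[-1] → Cobar C`. -/
def cobarι : GrHom 1 C.X (T C.sbar) := C.susp.comp (tinj1 C.sbar) (add_zero 1)

theorem cobarι_w : C.cobarι C.w = 0 := (congrArg (tinj1 C.sbar) C.susp_w).trans (map_zero _)

theorem cobarι_desusp (x : C.sbar) : C.cobarι (C.desusp x) = tinj1 C.sbar x :=
  congrArg (tinj1 C.sbar) (C.susp_desusp x)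

variable (C) in
theorem cobarData_isDifferential : C.cobarData.IsDifferential where
  mul_assoc := tMul_assoc
  one_mul := tMul_one_left
  mul_one := tMul_one_right
  leibniz := der_leibniz C.ξbar
  d_one := der_tone C.ξbar

theorem tMul_tmap_tinj1 {X : GrMod 𝒦} (z : tensor X X) :
    tMul X (tmap (tinj1 X) (tinj1 X) (add_zero 0) z) = tinj2 X z := by
  induction z using tensor_induction with
  | h i j x y hx hy => rw [tmap_tmul_zero, tMul_tinj1, tinj2_tmul]
  | hadd s t hs ht => simp only [map_add, hs, ht]

variable (C) in
/-- The convolution square of the universal twisting cochain. -/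
def cobarιSq : GrHom 2 C.X (T C.sbar) :=
  C.δ₂.comp ((tmap C.cobarι C.cobarι one_add_one_eq_two).comp (tMul C.sbar) (add_zero 2)) (zero_add 2)

theorem cobarιSq_apply (c : C.X) : C.cobarιSq c =
    tinj2 C.sbar (tmap C.spr C.spr (add_zero 0) (tmap C.σinv C.σinv one_add_one_eq_two (C.δ₂ c))) := by
  rw [← tMul_tmap_tinj1, tmap_postcomp, tmap_postcomp]
  rfl

theorem ξbar_apply (x : C.sbar) : C.ξbar x = tinjZero C.sbar (C.δ₀ (C.desusp x)) -
    C.cobarι (C.δ₁ (C.desusp x)) - C.cobarιSq (C.desusp x) := by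
  rw [cobarιSq_apply, sub_eq_add_neg, sub_eq_add_neg, ← map_neg C.cobarι, ← map_neg (tinj2 C.sbar),
    ← map_neg (tmap C.spr C.spr (add_zero 0))]
  rfl

theorem cobarCurv_eq : C.cobarCurv = C.cobarι (C.δ₁ C.w) - tinjZero C.sbar (C.δ₀ C.w) := by
  rw [sub_eq_neg_add, ← neg_neg (C.cobarι (C.δ₁ C.w)), ← map_neg C.cobarι, ← sub_eq_add_neg]
  rfl

variable (C) in
/-- The universal twisting cochain, as a map to the underlying module of `Cobar C`. -/
def cobarTwist : GrHom 1 C.X C.cobarData.X := C.cobarι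

theorem cobarTwist_w : C.cobarTwist C.w = 0 := C.cobarι_w

/-- On generators the Maurer-Cartan equation is the definition of the derivation of `Cobar C`, and
at `w` it is the definition of the curvature. -/
theorem isTwisting_cobarTwist (hC : C.IsDifferential) : IsTwisting C.cobarTwist := by
  have hw : C.cobarιSq C.w = 0 :=
    (conv_apply_w (A := C.cobarData) hC.w_δ₂ C.cobarTwist C.cobarTwist one_add_one_eq_two).trans (by
      rw [cobarTwist_w, map_zero, map_zero]; rfl)
  -- The value of the derivation on `C̄[-1]` is given by a map that is defined on all of `C` and
  -- takes the value `-m₀` at `w`.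
  obtain ⟨G, hG⟩ : ∃ G : GrHom 2 C.X (T C.sbar), ∀ c, G c = tinjZero C.sbar (C.δ₀ c) -
      C.cobarι (C.δ₁ c) - C.cobarιSq c :=
    ⟨C.δ₀.comp (tinjZero C.sbar) (add_zero 2) - C.δ₁.comp C.cobarι one_add_one_eq_two - C.cobarιSq,
      fun c => rfl⟩
  have hGw : G C.w = -C.cobarCurv := by rw [hG, hw, cobarCurv_eq, sub_zero, neg_sub]
  refine GrHom.ext fun c => ?_
  have e : der C.ξbar (C.cobarι c) = G c + (show k from C.ε c) • C.cobarCurv := by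
    refine (der_tinj1 C.ξbar (C.susp c)).trans ?_
    rw [ξbar_apply, ← hG, desusp_susp, map_sub, map_smul, hGw, smul_neg, sub_neg_eq_add]
  change der C.ξbar (C.cobarι c) + C.cobarι (C.δ₁ c) + C.cobarιSq c =
    (show k from C.δ₀ c) • tone C.sbar + (show k from C.ε c) • C.cobarCurv
  rw [e, hG, tinjZero_apply]
  abel

/-- Homomorphisms of unital algebras from the cobar construction are determined by the induced
cochain. -/
theorem eq_of_cobarTwist_comp {f g : GrHom 0 C.cobarData.X A.X}
    (hf : (tmap f f).comp A.mul (add_zero 0) = C.cobarData.mul.comp f (add_zero 0))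
    (hg : (tmap g g).comp A.mul (add_zero 0) = C.cobarData.mul.comp g (add_zero 0))
    (hf₁ : f C.cobarData.one = A.one) (hg₁ : g C.cobarData.one = A.one)
    (h : C.cobarTwist.comp f (add_zero 1) = C.cobarTwist.comp g (add_zero 1)) : f = g := by
  have key : ∀ f : GrHom 0 C.cobarData.X A.X,
      (tmap f f).comp A.mul (add_zero 0) = C.cobarData.mul.comp f (add_zero 0) →
      ∀ (x : C.sbar) (t : T C.sbar), f (tcons C.sbar (tmul x t)) =
        A.mul (tmul (f (C.cobarTwist (C.desusp x))) (f t)) := by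
    intro f hf x t
    have e := DFunLike.congr_fun hf (tmul (C.cobarTwist (C.desusp x)) (show C.cobarData.X from t))
    rw [GrHom.comp_apply, tmap_tmul_zero] at e
    refine Eq.trans ?_ e.symm
    refine congrArg f ?_
    rw [← tMul_tinj1, ← C.cobarι_desusp]
    rfl
  refine T_hom_ext (f := (f : GrHom 0 (T C.sbar) A.X)) (hf₁.trans hg₁.symm) fun i j x t _ _ ih => ?_
  refine (key f hf x t).trans (Eq.trans ?_ (key g hg x t).symm)
  exact congrArg₂ (fun a b => A.mul (tmul a b)) (DFunLike.congr_fun h (C.desusp x)) ih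

/-- The homomorphism of algebras from the cobar construction defined by a cochain. -/
def cobarLift (θ : GrHom 1 C.X A.X) : GrHom 0 C.cobarData.X A.X :=
  lift (C.desusp.comp θ (by lia))

theorem cobarLift_twist (hA : A.IsDifferential) {θ : GrHom 1 C.X A.X} (hw : θ C.w = 0) :
    C.cobarTwist.comp (cobarLift θ) (add_zero 1) = θ := by
  ext c
  refine (lift_tinj1 hA _ (C.susp c)).trans ?_
  rw [GrHom.comp_apply, desusp_susp, map_sub, map_smul, hw, smul_zero, sub_zero]

theorem cobarLift_map_mul (hA : A.IsDifferential) (θ : GrHom 1 C.X A.X) :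
    (tmap (cobarLift θ) (cobarLift θ)).comp A.mul (add_zero 0) =
      C.cobarData.mul.comp (cobarLift θ) (add_zero 0) := by
  refine tensor_hom_ext fun i j s t _ _ => ?_
  rw [GrHom.comp_apply, tmap_tmul_zero]
  exact (lift_tMul hA _ s t).symm

theorem cobarLift_map_one (θ : GrHom 1 C.X A.X) : cobarLift θ C.cobarData.one = A.one :=
  lift_tone _

end CoalgData

theorem AlgData.IsDifferential.d_mul (hA : A.IsDifferential) (x : A.X) {j : ℤ} {y : A.X}
    (hy : y ∈ A.X.gr j) : A.d (A.mul (tmul x y)) =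
      A.mul (tmul x (A.d y)) + sg j • A.mul (tmul (A.d x) y) := by
  have h := DFunLike.congr_fun hA.leibniz (tmul x y)
  rw [GrHom.comp_apply, GrHom.comp_apply, GrHom.add_apply, tmap_tmul_zero, tmap_tmul _ _ _ _ hy,
    _root_.one_mul, map_add, map_zsmul] at h
  exact h

namespace CoalgData

/-- Derivations along a homomorphism from the cobar construction are determined by their values on
the image of the universal twisting cochain. -/
theorem eq_of_derivation_cobar (f : GrHom 0 C.cobarData.X A.X) {F G : GrHom d C.cobarData.X A.X}
    (hone : F C.cobarData.one = G C.cobarData.one)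
    (hF : ∀ (y : C.cobarData.X) (j : ℤ) (t : C.cobarData.X), t ∈ C.cobarData.X.gr j →
      F (C.cobarData.mul (tmul y t)) =
        A.mul (tmul (f y) (F t)) + sg (d * j) • A.mul (tmul (F y) (f t)))
    (hG : ∀ (y : C.cobarData.X) (j : ℤ) (t : C.cobarData.X), t ∈ C.cobarData.X.gr j →
      G (C.cobarData.mul (tmul y t)) =
        A.mul (tmul (f y) (G t)) + sg (d * j) • A.mul (tmul (G y) (f t)))
    (hgen : ∀ c, F (C.cobarTwist c) = G (C.cobarTwist c)) : F = G := by
  refine eq_of_derivation (A := A) f hone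
    (fun x j t ht => (congrArg F (tMul_tinj1 x t).symm).trans (hF (tinj1 C.sbar x) j t ht))
    (fun x j t ht => (congrArg G (tMul_tinj1 x t).symm).trans (hG (tinj1 C.sbar x) j t ht))
    fun x => ?_
  exact ((congrArg F (C.cobarι_desusp x)).symm.trans (hgen (C.desusp x))).trans
    (congrArg G (C.cobarι_desusp x))

/-- The universal property of the cobar construction: a twisting cochain that vanishes on `w`
extends to a homomorphism of curved algebras. -/
theorem cobarLift_isAlgHom (hC : C.IsDifferential) (hA : A.IsDifferential) {θ : GrHom 1 C.X A.X}
    (hθ : IsTwisting θ) (hw : θ C.w = 0) :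
    IsAlgHom (A := C.cobarData) (B := A) (cobarLift θ) := by
  have hι := C.isTwisting_cobarTwist hC
  have hlift : ∀ c, cobarLift θ (C.cobarTwist c) = θ c :=
    DFunLike.congr_fun (cobarLift_twist hA hw)
  have hη : ∀ a, cobarLift θ (C.cobarData.η a) = A.η a := fun a =>
    (map_smul (cobarLift θ) (show k from a) C.cobarData.one).trans
      (congrArg ((show k from a) • ·) (cobarLift_map_one θ))
  have hcurv : cobarLift θ C.cobarData.curv = A.curv := by
    rw [hι.curv_eq hC C.cobarTwist_w, hθ.curv_eq hC hw, map_sub, hlift, hη]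
  have hconv : ∀ c, cobarLift θ (conv C.cobarTwist C.cobarTwist one_add_one_eq_two c) =
      conv θ θ one_add_one_eq_two c := by
    intro c
    have h := DFunLike.congr_fun (cobarLift_map_mul hA θ)
      (tmap C.cobarTwist C.cobarTwist one_add_one_eq_two (C.δ₂ c))
    rw [GrHom.comp_apply, tmap_postcomp, cobarLift_twist hA hw] at h
    exact h.symm
  have hgen : ∀ c, A.d (θ c) = cobarLift θ (C.cobarData.d (C.cobarTwist c)) := by
    intro c
    have h₁ := DFunLike.congr_fun hθ c
    have h₂ := congrArg (cobarLift θ) (DFunLike.congr_fun hι c)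
    simp only [GrHom.add_apply, GrHom.comp_apply, map_add, hlift, hη, hconv] at h₁ h₂
    have h₃ : cobarLift θ (C.cobarData.m₀ (C.ε c)) = A.m₀ (C.ε c) :=
      (map_smul (cobarLift θ) (show k from C.ε c) C.cobarData.curv).trans
        (congrArg ((show k from C.ε c) • ·) hcurv)
    rw [h₃, ← h₁] at h₂
    exact (add_right_cancel (add_right_cancel h₂)).symm
  have hmul : ∀ s t, cobarLift θ (C.cobarData.mul (tmul s t)) =
      A.mul (tmul (cobarLift θ s) (cobarLift θ t)) := lift_tMul hA _
  refine ⟨cobarLift_map_mul hA θ, cobarLift_map_one θ, ?_, hcurv⟩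
  refine eq_of_derivation_cobar (cobarLift θ) ?_ (fun y j t ht => ?_) (fun y j t ht => ?_)
    fun c => ?_
  · rw [GrHom.comp_apply, GrHom.comp_apply, cobarLift_map_one, hA.d_one,
      C.cobarData_isDifferential.d_one, map_zero]
  · rw [GrHom.comp_apply, hmul, one_mul, hA.d_mul _ ((cobarLift θ).mem ht (add_zero j))]
    rfl
  · rw [GrHom.comp_apply, C.cobarData_isDifferential.d_mul y ht, map_add, map_zsmul, hmul, hmul,
      one_mul]
    rfl
  · rw [GrHom.comp_apply, GrHom.comp_apply, hlift, hgen]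

/-- The commutator with the curvature, as a map of degree `2`. -/
def curvComm (A : AlgData 𝒦) : GrHom 2 A.X A.X :=
  (lidInv A.X).comp ((tmap A.m₀ (.id A.X)).comp A.mul (add_zero 2)) (zero_add 2) -
    (ridInv A.X).comp ((tmap (.id A.X) A.m₀).comp A.mul (add_zero 2)) (zero_add 2)

theorem curvComm_apply (x : A.X) :
    curvComm A x = A.mul (tmul A.curv x) - A.mul (tmul x A.curv) := by
  have h : A.m₀ (one 𝒦) = A.curv := one_smul k A.curv
  rw [curvComm, GrHom.sub_apply]
  congr 1
  · induction x using A.X.induction with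
    | h j x hx =>
      rw [GrHom.comp_apply, GrHom.comp_apply, lidInv_apply, tmap_tmul _ _ _ _ hx, h,
        sg_eq (n := 0) ⟨j, by ring⟩, sg_zero, one_smul]
      rfl
    | hadd x y hx hy => simp only [map_add, hx, hy]
  · rw [GrHom.comp_apply, GrHom.comp_apply, ridInv_apply, tmap_tmul_zero, h]
    rfl

/-- The square of the derivation and the commutator with the curvature are derivations, which agree
on generators by the Bianchi identity. -/
theorem cobarData_isCurved (hC : C.IsCurvedAugmented) : C.cobarData.IsCurved := by
  have hι := C.isTwisting_cobarTwist hC.isDifferential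
  have hT := C.cobarData_isDifferential
  have hd : C.cobarData.d.comp C.cobarData.d one_add_one_eq_two = curvComm C.cobarData := by
    refine eq_of_derivation_cobar (.id _) ?_ (fun y j t ht => ?_) (fun y j t ht => ?_) fun c => ?_
    · rw [GrHom.comp_apply, hT.d_one, map_zero, curvComm_apply, hT.mul_one, hT.one_mul, sub_self]
    · simp only [GrHom.comp_apply, GrHom.id_apply]
      rw [hT.d_mul y ht, map_add, map_zsmul, hT.d_mul _ ht, hT.d_mul _ (C.cobarData.d.mem ht rfl),
        sg_add, sg_one, smul_add, smul_smul, two_mul, sg_add]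
      simp only [mul_neg, mul_one, neg_smul]
      abel
    · rw [curvComm_apply, curvComm_apply, curvComm_apply, sg_eq (n := 0) ⟨j, by ring⟩, sg_zero,
        one_smul]
      simp only [map_sub, AddMonoidHom.sub_apply, GrHom.id_apply]
      rw [hT.mul_assoc, hT.mul_assoc, hT.mul_assoc]
      abel
    · rw [GrHom.comp_apply, hι.d_d hC hT C.cobarTwist_w, curvComm_apply]
  exact
  { mul_assoc := hT.mul_assoc
    one_mul := hT.one_mul
    mul_one := hT.mul_one
    leibniz := hT.leibniz
    d_d := fun x => (DFunLike.congr_fun hd x).trans (curvComm_apply x)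
    d_curv := hι.d_curv hC hT C.cobarTwist_w
    d_one := hT.d_one }

theorem ext_eq_lift (φ : GrHom 0 C.sbar (T D.sbar)) :
    GrMod.ext φ = lift (A := D.cobarData) φ := by
  have h : ∀ n, extPow φ n = liftPow (A := D.cobarData) φ n := by
    intro n
    induction n with
    | zero => exact unit_hom_ext (one_smul k (tone D.sbar)).symm
    | succ n ih =>
      change (tmap φ (extPow φ n)).comp (tMul D.sbar) (add_zero 0) = _
      rw [ih]
      rfl
  exact congrArg tdesc (funext h)

theorem cobarMap_eq (g : CoalgPair C D) : cobarMap g = cobarLift (g.pull D.cobarTwist) := by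
  refine (ext_eq_lift _).trans ?_
  refine congrArg lift (GrHom.ext fun x => ?_)
  exact congrArg (fun y : T D.sbar => D.cobarι (g.g₁ (C.desusp x)) + y)
    (tinjZero_apply (g.g₀ (C.desusp x)))

theorem pull_cobarTwist_w {g : CoalgPair C D} (hw : g.g₁ C.w = D.w) (hw₀ : g.g₀ C.w = 0) :
    g.pull D.cobarTwist C.w = 0 := by
  rw [CoalgPair.pull_apply, hw, hw₀, cobarTwist_w, map_zero, add_zero]

/-- The cochain induced by the homomorphism `Cobar g` is the universal one pulled back along `g`. -/
theorem cobarTwist_comp_cobarMap {g : CoalgPair C D} (hw : g.g₁ C.w = D.w) (hw₀ : g.g₀ C.w = 0) :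
    C.cobarTwist.comp (cobarMap g) (add_zero 1) = g.pull D.cobarTwist := by
  rw [cobarMap_eq]
  exact cobarLift_twist D.cobarData_isDifferential (pull_cobarTwist_w hw hw₀)

theorem cobarMap_isAlgHom (hC : C.IsDifferential) (hD : D.IsDifferential) {g : CoalgPair C D}
    (hg : g.IsHom) : IsAlgHom (cobarMap g) := by
  rw [cobarMap_eq]
  exact cobarLift_isAlgHom hC D.cobarData_isDifferential
    ((isTwisting_cobarTwist hD).pull D.cobarData_isDifferential hg)
    (pull_cobarTwist_w hg.map_w hg.w_g₀)

end CoalgData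

variable (𝒦) in
theorem cobarIsFunctor : CobarIsFunctor 𝒦 where
  obj C := CoalgData.cobarData_isCurved C.isCurvedAugmented
  map {C D} g := CoalgData.cobarMap_isAlgHom C.isCurvedAugmented.isDifferential
    D.isCurvedAugmented.isDifferential g.isHom
  map_id C := by
    have hC := C.isCurvedAugmented.isDifferential
    have h₁ := CoalgData.cobarMap_isAlgHom hC hC (CoalgPair.IsHom.id C.toCoalgData)
    have h₂ := IsAlgHom.id C.cobarData
    refine CoalgData.eq_of_cobarTwist_comp h₁.map_mul h₂.map_mul h₁.map_one h₂.map_one ?_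
    refine (CoalgData.cobarTwist_comp_cobarMap rfl rfl).trans ?_
    ext c
    rw [CoalgPair.pull_apply]
    change C.cobarTwist c + C.cobarData.η 0 = C.cobarTwist c
    rw [map_zero, add_zero]
  map_comp {C D E} f g := by
    have hC := C.isCurvedAugmented.isDifferential
    have hD := D.isCurvedAugmented.isDifferential
    have hE := E.isCurvedAugmented.isDifferential
    have h₁ := CoalgData.cobarMap_isAlgHom hC hE (f.isHom.comp g.isHom)
    have hf := CoalgData.cobarMap_isAlgHom hC hD f.isHom
    have hg := CoalgData.cobarMap_isAlgHom hD hE g.isHom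
    have h₂ := hf.comp hg
    refine CoalgData.eq_of_cobarTwist_comp h₁.map_mul h₂.map_mul h₁.map_one h₂.map_one ?_
    have hfg := f.isHom.comp g.isHom
    refine (CoalgData.cobarTwist_comp_cobarMap hfg.map_w hfg.w_g₀).trans ?_
    rw [← GrHom.comp_assoc _ _ _ (add_zero 1) (add_zero 1),
      CoalgData.cobarTwist_comp_cobarMap f.isHom.map_w f.isHom.w_g₀,
      ← CoalgPair.pull_comp _ _ hg.map_one,
      CoalgData.cobarTwist_comp_cobarMap g.isHom.map_w g.isHom.w_g₀, CoalgPair.comp_pull]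

end Cobar

/-! ### The adjunction -/

section Adjunction

variable [GradedRing 𝒦] [GradedStronglyCommutative 𝒦] {C D : CoalgData 𝒦} {A B : AlgData 𝒦}

namespace CoalgPair

/-- The functional and the map to `Ā[1]` that a cochain `θ : C → A` consists of define a pair of
maps to the bar construction. -/
def ofTwisting (hC : C.IsCurvedAugmented) (θ : GrHom 1 C.X A.X) (hw : θ C.w = 0) :
    CoalgPair C A.barData where
  g₁ := cofree (θ.comp A.susp (by lia)) (exists_cofreePow_eq_zero hC
    ((congrArg A.susp hw).trans (map_zero A.susp)))
  g₀ := θ.comp A.v (add_zero 1)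

theorem ofTwisting_pull (hC : C.IsCurvedAugmented) (θ : GrHom 1 C.X A.X) (hw : θ C.w = 0) :
    (ofTwisting hC θ hw).pull A.barTwist = θ := by
  ext c
  refine (congrArg₂ (· + ·) (congrArg A.desusp (tpr1_cofree hC.isDifferential _ _ c)) rfl).trans ?_
  rw [GrHom.comp_apply, A.desusp_susp]
  exact sub_add_cancel _ _

theorem ofTwisting_isHom (hC : C.IsCurvedAugmented) (hA : A.IsDifferential) {θ : GrHom 1 C.X A.X}
    (hθ : IsTwisting θ) (hw : θ C.w = 0) : (ofTwisting hC θ hw).IsHom := by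
  refine isHom_of_isTwisting_pull hC.isDifferential hA (cofree_isCoalgHom hC.isDifferential _ _)
    (cofree_tpr0 _ _) (cofree_w hC.isDifferential ((congrArg A.susp hw).trans (map_zero A.susp)) _)
    ((congrArg A.v hw).trans (map_zero A.v)) ?_
  rw [ofTwisting_pull]
  exact hθ

theorem pull_barTwist_w {g : CoalgPair C A.barData} (hw : g.g₁ C.w = A.barData.w)
    (hw₀ : g.g₀ C.w = 0) : g.pull A.barTwist C.w = 0 := by
  rw [pull_apply, hw, hw₀, map_zero, add_zero]
  exact A.barτ_tone

end CoalgPair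

section Cochains

variable {C D : CaCoalg 𝒦} {A B : UccAlg 𝒦}

/-- The twisting cochain `C → Cobar C → A` that corresponds to a morphism `Cobar C → A`. -/
def cobarCochain (f : (cobarFunctor (cobarIsFunctor 𝒦)).obj C ⟶ A) : GrHom 1 C.X A.X :=
  GrHom.comp (N := C.cobarData.X) C.cobarTwist f.f (add_zero 1)

theorem cobarCochain_w (f : (cobarFunctor (cobarIsFunctor 𝒦)).obj C ⟶ A) :
    cobarCochain f C.w = 0 :=
  (congrArg f.f C.cobarTwist_w).trans (map_zero f.f)

theorem isTwisting_cobarCochain (f : (cobarFunctor (cobarIsFunctor 𝒦)).obj C ⟶ A) :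
    IsTwisting (cobarCochain f) :=
  (C.isTwisting_cobarTwist C.isCurvedAugmented.isDifferential).comp_algHom f.isAlgHom

theorem hom_ext_of_cobarCochain {f f' : (cobarFunctor (cobarIsFunctor 𝒦)).obj C ⟶ A}
    (h : cobarCochain f = cobarCochain f') : f = f' :=
  UccAlg.Hom.ext (CoalgData.eq_of_cobarTwist_comp f.isAlgHom.map_mul f'.isAlgHom.map_mul
    f.isAlgHom.map_one f'.isAlgHom.map_one h)

theorem cobarCochain_map_comp (f : C ⟶ D) (h : (cobarFunctor (cobarIsFunctor 𝒦)).obj D ⟶ A) :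
    cobarCochain ((cobarFunctor (cobarIsFunctor 𝒦)).map f ≫ h) = f.pair.pull (cobarCochain h) :=
  Eq.trans (congrArg (fun p => GrHom.comp (N := D.cobarData.X) p h.f (add_zero 1))
      (CoalgData.cobarTwist_comp_cobarMap f.isHom.map_w f.isHom.w_g₀))
    (CoalgPair.pull_comp _ _ h.isAlgHom.map_one).symm

theorem cobarCochain_comp (f : (cobarFunctor (cobarIsFunctor 𝒦)).obj C ⟶ A) (g : A ⟶ B) :
    cobarCochain (f ≫ g) = (cobarCochain f).comp g.f (add_zero 1) := rfl

/-- The twisting cochain `C → A` that corresponds to a morphism `C → Bar A`. -/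
def barCochain (g : C ⟶ (barFunctor (barIsFunctor 𝒦)).obj A) : GrHom 1 C.X A.X :=
  CoalgPair.pull (D := A.barData) g.pair A.barTwist

theorem barCochain_w (g : C ⟶ (barFunctor (barIsFunctor 𝒦)).obj A) : barCochain g C.w = 0 :=
  CoalgPair.pull_barTwist_w g.isHom.map_w g.isHom.w_g₀

theorem isTwisting_barCochain (g : C ⟶ (barFunctor (barIsFunctor 𝒦)).obj A) :
    IsTwisting (barCochain g) :=
  A.isTwisting_barTwist.pull A.isCurved.isDifferential g.isHom

theorem hom_ext_of_barCochain {g g' : C ⟶ (barFunctor (barIsFunctor 𝒦)).obj A}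
    (h : barCochain g = barCochain g') : g = g' :=
  CaCoalg.Hom.ext (CoalgPair.eq_of_pull_barTwist g.isHom.map_δ₂ g'.isHom.map_δ₂ g.isHom.map_ε
    g'.isHom.map_ε h)

theorem barCochain_comp (f : C ⟶ D) (g : D ⟶ (barFunctor (barIsFunctor 𝒦)).obj A) :
    barCochain (f ≫ g) = f.pair.pull (barCochain g) :=
  CoalgPair.comp_pull f.pair (E := A.barData) g.pair A.barTwist

theorem barCochain_comp_map (g : C ⟶ (barFunctor (barIsFunctor 𝒦)).obj A) (f : A ⟶ B) :
    barCochain (g ≫ (barFunctor (barIsFunctor 𝒦)).map f) = (barCochain g).comp f.f (add_zero 1) :=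
  (CoalgPair.comp_pull (D := A.barData) (E := B.barData) g.pair (AlgData.barMap f.f)
    B.barTwist).trans <|
      (congrArg (CoalgPair.pull (D := A.barData) g.pair) (AlgData.barMap_pull f.f)).trans
        (CoalgPair.pull_comp _ _ f.isAlgHom.map_one)

/-- The morphism `Cobar C → A` that corresponds to a twisting cochain. -/
def homOfTwisting {θ : GrHom 1 C.X A.X} (hθ : IsTwisting θ) (hw : θ C.w = 0) :
    (cobarFunctor (cobarIsFunctor 𝒦)).obj C ⟶ A :=
  ⟨CoalgData.cobarLift θ, CoalgData.cobarLift_isAlgHom C.isCurvedAugmented.isDifferential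
    A.isCurved.isDifferential hθ hw⟩

theorem cobarCochain_homOfTwisting {θ : GrHom 1 C.X A.X} (hθ : IsTwisting θ) (hw : θ C.w = 0) :
    cobarCochain (homOfTwisting hθ hw) = θ :=
  CoalgData.cobarLift_twist A.isCurved.isDifferential hw

/-- The morphism `C → Bar A` that corresponds to a twisting cochain. -/
def cohomOfTwisting {θ : GrHom 1 C.X A.X} (hθ : IsTwisting θ) (hw : θ C.w = 0) :
    C ⟶ (barFunctor (barIsFunctor 𝒦)).obj A :=
  ⟨CoalgPair.ofTwisting C.isCurvedAugmented θ hw,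
    CoalgPair.ofTwisting_isHom C.isCurvedAugmented A.isCurved.isDifferential hθ hw⟩

theorem barCochain_cohomOfTwisting {θ : GrHom 1 C.X A.X} (hθ : IsTwisting θ) (hw : θ C.w = 0) :
    barCochain (cohomOfTwisting hθ hw) = θ :=
  CoalgPair.ofTwisting_pull C.isCurvedAugmented θ hw

end Cochains

/-- Homomorphisms of curved algebras `Cobar C → A` and morphisms of curved augmented coalgebras
`C → Bar A` both correspond to the twisting cochains `C → A` that vanish on `w`. -/
def cobarBarEquiv (C : CaCoalg 𝒦) (A : UccAlg 𝒦) :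
    ((cobarFunctor (cobarIsFunctor 𝒦)).obj C ⟶ A) ≃ (C ⟶ (barFunctor (barIsFunctor 𝒦)).obj A) where
  toFun f := cohomOfTwisting (isTwisting_cobarCochain f) (cobarCochain_w f)
  invFun g := homOfTwisting (isTwisting_barCochain g) (barCochain_w g)
  left_inv f := hom_ext_of_cobarCochain ((cobarCochain_homOfTwisting _ _).trans
    (barCochain_cohomOfTwisting (isTwisting_cobarCochain f) (cobarCochain_w f)))
  right_inv g := hom_ext_of_barCochain ((barCochain_cohomOfTwisting _ _).trans
    (cobarCochain_homOfTwisting (isTwisting_barCochain g) (barCochain_w g)))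

theorem barCochain_cobarBarEquiv {C : CaCoalg 𝒦} {A : UccAlg 𝒦}
    (f : (cobarFunctor (cobarIsFunctor 𝒦)).obj C ⟶ A) :
    barCochain (cobarBarEquiv C A f) = cobarCochain f :=
  barCochain_cohomOfTwisting (isTwisting_cobarCochain f) (cobarCochain_w f)

theorem cobarCochain_cobarBarEquiv_symm {C : CaCoalg 𝒦} {A : UccAlg 𝒦}
    (g : C ⟶ (barFunctor (barIsFunctor 𝒦)).obj A) :
    cobarCochain ((cobarBarEquiv C A).symm g) = barCochain g :=
  cobarCochain_homOfTwisting (isTwisting_barCochain g) (barCochain_w g)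

variable (𝒦) in
/-- The cobar functor is left adjoint to the bar functor, already before the restriction to
algebras without curvature. -/
def cobarBarAdjunction :
    cobarFunctor (cobarIsFunctor 𝒦) ⊣ barFunctor (barIsFunctor 𝒦) :=
  Adjunction.mkOfHomEquiv
    { homEquiv := cobarBarEquiv
      homEquiv_naturality_left_symm := fun {C D A} f g => hom_ext_of_cobarCochain <| by
        rw [cobarCochain_map_comp, cobarCochain_cobarBarEquiv_symm, cobarCochain_cobarBarEquiv_symm]
        exact barCochain_comp f g
      homEquiv_naturality_right := fun {C A B} f g => hom_ext_of_barCochain <| by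
        rw [barCochain_comp_map, barCochain_cobarBarEquiv, barCochain_cobarBarEquiv]
        exact cobarCochain_comp f g }

theorem isAugmented_bar (A : UccAlg 𝒦) (hA : isDg 𝒦 A) :
    isAugmented 𝒦 ((barFunctor (barIsFunctor 𝒦)).obj A) := by
  have hA' : A.curv = 0 := hA
  constructor
  · have h₁ : A.bbar₀ (one 𝒦) = 0 := A.desusp_injective (by
      rw [A.desusp_bbar₀, hA', map_zero, map_zero]
      exact (sub_eq_zero.2 (zero_smul k A.one).symm))
    refine (coder_tone (b₀ := A.bbar₀) (b₁ := A.bbar₁) (b₂ := A.bbar₂)).trans ?_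
    rw [head]
    simp only [GrHom.add_apply, GrHom.comp_apply, uncons_tone, map_zero, add_zero]
    change tcons A.sbar (tmap A.bbar₀ (.id _) (add_zero 1) (tmul (one 𝒦) (tone A.sbar))) = 0
    rw [tmap_tmul _ _ _ _ tone_mem, h₁, map_zero, AddMonoidHom.zero_apply, smul_zero, map_zero]
  · refine A.barCurv_tone.trans ?_
    rw [hA', map_zero, neg_zero]

theorem isDg_cobar (C : CaCoalg 𝒦) (hC : isAugmented 𝒦 C) :
    isDg 𝒦 ((cobarFunctor (cobarIsFunctor 𝒦)).obj C) := by
  refine (CoalgData.cobarCurv_eq (C := C.toCoalgData)).trans ?_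
  rw [hC.1, hC.2, map_zero, map_zero, sub_zero]
  rfl

end Adjunction

end Curved

end

theorem mainTheorem3 {k : Type*} [Ring k] (𝒦 : ℤ → AddSubgroup k) [GradedRing 𝒦]
    [Curved.GradedStronglyCommutative 𝒦] :
    ∃ (hB : Curved.BarIsFunctor 𝒦) (hC : Curved.CobarIsFunctor 𝒦)
      (hB' : ∀ A, Curved.isDg 𝒦 A → Curved.isAugmented 𝒦 ((Curved.barFunctor hB).obj A))
      (hC' : ∀ C, Curved.isAugmented 𝒦 C → Curved.isDg 𝒦 ((Curved.cobarFunctor hC).obj C)),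
      Nonempty (Curved.cobarRestr hC hC' ⊣ Curved.barRestr hB hB') :=
  ⟨Curved.barIsFunctor 𝒦, Curved.cobarIsFunctor 𝒦, Curved.isAugmented_bar, Curved.isDg_cobar,
    ⟨(Curved.cobarBarAdjunction 𝒦).restrictFullyFaithful
      (Curved.isAugmented 𝒦).fullyFaithfulι (Curved.isDg 𝒦).fullyFaithfulι
      (CategoryTheory.Iso.refl _) (CategoryTheory.Iso.refl _)⟩⟩
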